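/- **Setting.** A temporal network $N=(V,E,\tau,\{u_e\}_{e\in E})$ consists of a finite vertex set $V$ with a source $s$ and a sink $d\neq s$, a set $E\subseteq V\times V$ of directed edges, one static length $\tau\in\{0,1,2,\dots\}$ common to all edges, and capacities $u_e:\mathbb Z\to\mathbb R_{\ge 0}$; node storage is unbounded. Put $n=|V|$, $m=|E|$, and let $T\ge 0$ be an integer; $[0,T]$ denotes $\{0,1,\dots,T\}$. For $f_e(t)$ ($e\in E$, $t\in[0,T]$) put $$\mathrm{in}_i(t)=\sum_{ji\in E}\ \sum_{t'=0}^{t-\tau}f_{ji}(t')-\sum_{ij\in E}\ \sum_{t'=0}^{t}f_{ij}(t').$$ A flow over time $T$ is such an $f$ with $0\le f_e(t)\le u_e(t)$ for all $e,t$, with $\mathrm{in}_i(t)\ge 0$ for all $i\ne s$ and $t\in[0,T]$, and with $\mathrm{in}_i(T)=0$ for all $i\notin\{s,d\}$; its value is $\mathrm{in}_d(T)$. A steady-state flow in a network with capacities in $[0,\infty]$ is a nonnegative function on the edges that respects the capacities and is conserved at all vertices other than the source and the sink; its value is the net flow into the sink. Suppose $u_e$ is piecewise constant with at most $\mu_e$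 pieces (at most $\mu_e-1$ times $t$ with $u_e(t)\ne u_e(t-1)$), and put $\mu=\sum_{e\in E}\mu_e$. Let $\mathcal T=\{t:\exists e\in E,\ u_e(t)\neq u_e(t-1)\}\cup\{0,T,T+1\}$, $$\mathrm{crit}(N)=\{\theta\pm\ell\tau:\theta\in\mathcal T,\ \ell\in[0,n]\},$$ let $A=\mathrm{crit}(N)\cap[0,T]=\{t_1<\dots<t_k\}$ and $t_{k+1}=T+1$. The steady-state network $\mathrm{cTEN}(N,A,T)$ has vertex set $V\times A$, source $(s,0)$, sink $(d,T)$, an edge of infinite capacity from $(x,t_j)$ to $(x,t_{j+1})$ for all $x\in V$, $1\le j<k$, and, for all $xy\in E$ and $1\le i,j\le k$, an edge from $(x,t_i)$ to $(y,t_j)$ of capacity $$\sum_{t\,:\,t_i\le t<t_{i+1},\ t_j\le t+\tau<t_{j+1}}u_{xy}(t)$$ whenever this is nonzero (if two edges have the same ends, their capacities are added). **Theorem.** There is an absolute constant $K$ such that the following hold. 1. The maximum value of an $s$-$d$ flow over time $T$ in $N$ and the maximum value of a steady-state flow in $\mathrm{cTEN}(N,A,T)$ both exist and are equal. If $E\ne\emptyset$,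 then $\mathrm{cTEN}(N,A,T)$ has at most $Kn^2\mu$ vertices and at most $K(n^2\mu+nm\mu)$ edges, and at most $Knm\mu$ edges if every vertex is incident to an edge. 2. Running times are numbers of steps on a real RAM: a finite program with integer and real variables and arrays, in which arithmetic operations ($+,-,\times$ on integers, $+,-,\times,\div$ on reals), conversions of integers to reals, comparisons and memory accesses cost one step each. Let $P$ be any such program that computes the maximum steady-state flow value in every network with $n'$ nodes, $m'$ edges and finite real capacities, given by a list of its edges, in at most $MF(n',m')$ steps. Then there is a program $Q$ such that for every temporal network $N$ as above with $E\ne\emptyset$, given by $n$, $m$, $s$, $d$, $T$, $\tau$, a list of its edges and for each edge the list of the pieces of its capacity function (starting time and value of each piece), $\mu$ being the total number of listed pieces, $Q$ computes the maximum value of a flow over time $T$ in $N$ in at most $$MF(n',m')+K\,mn\mu\quad\text{steps, for some } n'\le Kn^2\mu \text{ and } m'\le K\,mn\mu .$$ In particular, if $MF$ is nondecreasing in both arguments and $MF(a,b)\ge b$ for all $a,b$, then $Q$ takes at most $K\cdot MF(Kn^2\mu,\,K\,mn\mu)$ steps. -/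

import Mathlib

open scoped NNReal ENNReal

noncomputable section

/-! ## Temporal networks and flows over time -/

/-- A temporal network `(V, E, τ, u)` with source `s` and sink `d`, one static length `τ` for all
edges and unbounded storage at every node.  Time is discrete; `u e t` is the capacity of the edge
`e` at time `t` (only the values of `u` on `E` matter). -/
structure TemporalNetwork (V : Type*) where
  E : Finset (V × V)
  u : V × V → ℤ → ℝ≥0
  τ : ℕ
  s : V
  d : V
  s_ne_d : s ≠ d

namespace TemporalNetwork

variable {V : Type*}

open Classical in
/-- The amount that has arrived at `i` up to time `t` minus the amount that has left `i` up to time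
`t`, when `f e t'` is the amount that enters the edge `e` at time `t'`. -/
def netIn (N : TemporalNetwork V) (f : V × V → ℤ → ℝ) (i : V) (t : ℤ) : ℝ :=
  (∑ e ∈ N.E with e.2 = i, ∑ t' ∈ Finset.Icc (0 : ℤ) (t - N.τ), f e t') -
    ∑ e ∈ N.E with e.1 = i, ∑ t' ∈ Finset.Icc (0 : ℤ) t, f e t'

/-- `f` is an `s`-`d` flow over time `T`. -/
structure IsFlowOverTime (N : TemporalNetwork V) (T : ℕ) (f : V × V → ℤ → ℝ) : Prop where
  nonneg : ∀ e ∈ N.E, ∀ t ∈ Finset.Icc (0 : ℤ) T, 0 ≤ f e t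
  le_capacity : ∀ e ∈ N.E, ∀ t ∈ Finset.Icc (0 : ℤ) T, f e t ≤ N.u e t
  netIn_nonneg : ∀ i, i ≠ N.s → ∀ t ∈ Finset.Icc (0 : ℤ) T, 0 ≤ N.netIn f i t
  netIn_eq_zero : ∀ i, i ≠ N.s → i ≠ N.d → N.netIn f i T = 0

/-- The values of the flows over time `T`; the value is the net flow into `d` at time `T`. -/
def flowValues (N : TemporalNetwork V) (T : ℕ) : Set ℝ :=
  {v | ∃ f, N.IsFlowOverTime T f ∧ N.netIn f N.d T = v}

end TemporalNetwork

/-- `g` is piecewise constant with at most `k` pieces (so it has at most `k - 1` changes). -/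
def HasAtMostPieces (g : ℤ → ℝ≥0) (k : ℕ) : Prop :=
  {t : ℤ | g t ≠ g (t - 1)}.encard + 1 ≤ (k : ℕ∞)

/-! ## Steady-state networks and flows -/

/-- A steady-state flow network on the vertex set `W` (only the values of `cap` on `E` matter). -/
structure FlowNetwork (W : Type*) where
  E : Finset (W × W)
  cap : W × W → ℝ≥0∞
  source : W
  sink : W

namespace FlowNetwork

variable {W : Type*}

open Classical in
/-- Flow into `w` minus flow out of `w`. -/
def netIn (G : FlowNetwork W) (f : W × W → ℝ) (w : W) : ℝ :=
  (∑ e ∈ G.E with e.2 = w, f e) - ∑ e ∈ G.E with e.1 = w, f e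

structure IsFlow (G : FlowNetwork W) (f : W × W → ℝ) : Prop where
  nonneg : ∀ e ∈ G.E, 0 ≤ f e
  le_capacity : ∀ e ∈ G.E, ENNReal.ofReal (f e) ≤ G.cap e
  conservation : ∀ w, w ≠ G.source → w ≠ G.sink → G.netIn f w = 0

/-- The values of the source-sink flows. -/
def flowValues (G : FlowNetwork W) : Set ℝ :=
  {v | ∃ f, G.IsFlow f ∧ G.netIn f G.sink = v}

end FlowNetwork

/-! ## The condensed time-expanded network -/

/-- The times of `[0, T]` that are represented by `a ∈ A`: with `t₁ < ⋯ < tₖ` the elements of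
`A ⊆ [0, T]`, `T ∈ A`, and `tₖ₊₁ = T + 1`, the block of `tᵢ` is `{tᵢ, …, tᵢ₊₁ - 1}`. -/
def timeBlock (A : Finset ℤ) (T : ℕ) (a : ℤ) : Finset ℤ :=
  {r ∈ Finset.Icc a (T : ℤ) | ∀ b ∈ A, a < b → r < b}

namespace TemporalNetwork

variable {V : Type*}

open Classical in
/-- The capacity in the condensed network from `(x, a)` to `(y, b)`: it is infinite if `x = y` and
`b` is the successor of `a` in `A`, and an edge `xy` adds what can enter it during the block of `a`
so as to arrive during the block of `b`. -/
def condensedCap (N : TemporalNetwork V) (A : Finset ℤ) (T : ℕ) (p q : V × A) : ℝ≥0∞ :=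
  (if p.1 = q.1 ∧ (p.2 : ℤ) < q.2 ∧ ∀ c ∈ A, (p.2 : ℤ) < c → (q.2 : ℤ) ≤ c then ⊤ else 0) +
    if (p.1, q.1) ∈ N.E then
      ∑ r ∈ timeBlock A T p.2 with (r + N.τ : ℤ) ∈ timeBlock A T q.2, (N.u (p.1, q.1) r : ℝ≥0∞)
    else 0

open Classical in
/-- The condensed time-expanded network `cTEN(N, A, T)`, for `A ⊆ [0, T]` containing `0` and `T`. -/
def cTEN [Fintype V] (N : TemporalNetwork V) (A : Finset ℤ) (T : ℕ)
    (h0 : (0 : ℤ) ∈ A) (hT : (T : ℤ) ∈ A) : FlowNetwork (V × A) where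
  E := {e | N.condensedCap A T e.1 e.2 ≠ 0}
  cap := fun e => N.condensedCap A T e.1 e.2
  source := (N.s, ⟨0, h0⟩)
  sink := (N.d, ⟨T, hT⟩)

/-- The times at which some capacity changes, together with `0`, `T` and `T + 1`. -/
def changeTimes (N : TemporalNetwork V) (T : ℕ) : Set ℤ :=
  {t | ∃ e ∈ N.E, N.u e t ≠ N.u e (t - 1)} ∪ {0, (T : ℤ), (T : ℤ) + 1}

/-- The critical times `θ ± ℓ τ` with `θ` a change time and `0 ≤ ℓ ≤ n`. -/
def crit [Fintype V] (N : TemporalNetwork V) (T : ℕ) : Set ℤ :=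
  {t | ∃ θ ∈ N.changeTimes T, ∃ l : ℕ, l ≤ Fintype.card V ∧
    (t = θ + (l : ℤ) * N.τ ∨ t = θ - (l : ℤ) * N.τ)}

open Classical in
/-- The critical times in `[0, T]`. -/
def critTimes [Fintype V] (N : TemporalNetwork V) (T : ℕ) : Finset ℤ :=
  {t ∈ Finset.Icc (0 : ℤ) T | t ∈ N.crit T}

theorem zero_mem_critTimes [Fintype V] (N : TemporalNetwork V) (T : ℕ) :
    (0 : ℤ) ∈ N.critTimes T := by
  simp only [critTimes, Finset.mem_filter, Finset.mem_Icc]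
  exact ⟨⟨le_refl _, by positivity⟩, 0, by simp [changeTimes], 0, by simp, by simp⟩

theorem horizon_mem_critTimes [Fintype V] (N : TemporalNetwork V) (T : ℕ) :
    (T : ℤ) ∈ N.critTimes T := by
  simp only [critTimes, Finset.mem_filter, Finset.mem_Icc]
  exact ⟨⟨by positivity, le_refl _⟩, (T : ℤ), by simp [changeTimes], 0, by simp, by simp⟩

/-- `cTEN(N, crit(N), T)`. -/
def critCTEN [Fintype V] (N : TemporalNetwork V) (T : ℕ) : FlowNetwork (V × N.critTimes T) :=
  N.cTEN (N.critTimes T) T (N.zero_mem_critTimes T) (N.horizon_mem_critTimes T)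

end TemporalNetwork

/-! ## The machine model: a real RAM

Programs are finite while programs over integer and real variables and over arrays of integers and
of reals that are indexed by integers.  Arithmetic, comparisons and memory accesses have unit cost;
the only real constants are integers, and nothing turns a real into an integer. -/

structure RAMState where
  intVar : ℕ → ℤ
  realVar : ℕ → ℝ
  intArr : ℕ → ℤ → ℤ
  realArr : ℕ → ℤ → ℝ

/-- Integer expressions. -/
inductive IExpr where
  | const (c : ℤ)
  | var (x : ℕ)
  | get (a : ℕ) (i : IExpr)
  | add (e₁ e₂ : IExpr)
  | sub (e₁ e₂ : IExpr)
  | mul (e₁ e₂ : IExpr)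

/-- Real expressions. -/
inductive RExpr where
  | ofInt (e : IExpr)
  | var (x : ℕ)
  | get (a : ℕ) (i : IExpr)
  | add (e₁ e₂ : RExpr)
  | sub (e₁ e₂ : RExpr)
  | mul (e₁ e₂ : RExpr)
  | div (e₁ e₂ : RExpr)

/-- Tests. -/
inductive BExpr where
  | leI (e₁ e₂ : IExpr)
  | leR (e₁ e₂ : RExpr)
  | not (b : BExpr)
  | and (b₁ b₂ : BExpr)

/-- Programs. -/
inductive Prog where
  | skip
  | setI (x : ℕ) (e : IExpr)
  | setR (x : ℕ) (e : RExpr)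
  | putI (a : ℕ) (i : IExpr) (e : IExpr)
  | putR (a : ℕ) (i : IExpr) (e : RExpr)
  | seq (p q : Prog)
  | ite (b : BExpr) (p q : Prog)
  | loop (b : BExpr) (p : Prog)

def IExpr.eval (σ : RAMState) : IExpr → ℤ
  | .const c => c
  | .var x => σ.intVar x
  | .get a i => σ.intArr a (i.eval σ)
  | .add e₁ e₂ => e₁.eval σ + e₂.eval σ
  | .sub e₁ e₂ => e₁.eval σ - e₂.eval σ
  | .mul e₁ e₂ => e₁.eval σ * e₂.eval σ

/-- The number of steps for evaluating an expression: one for each of its nodes. -/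
def IExpr.cost : IExpr → ℕ
  | .const _ => 1
  | .var _ => 1
  | .get _ i => i.cost + 1
  | .add e₁ e₂ => e₁.cost + e₂.cost + 1
  | .sub e₁ e₂ => e₁.cost + e₂.cost + 1
  | .mul e₁ e₂ => e₁.cost + e₂.cost + 1

def RExpr.eval (σ : RAMState) : RExpr → ℝ
  | .ofInt e => (e.eval σ : ℝ)
  | .var x => σ.realVar x
  | .get a i => σ.realArr a (i.eval σ)
  | .add e₁ e₂ => e₁.eval σ + e₂.eval σ
  | .sub e₁ e₂ => e₁.eval σ - e₂.eval σ
  | .mul e₁ e₂ => e₁.eval σ * e₂.eval σ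
  | .div e₁ e₂ => e₁.eval σ / e₂.eval σ

def RExpr.cost : RExpr → ℕ
  | .ofInt e => e.cost + 1
  | .var _ => 1
  | .get _ i => i.cost + 1
  | .add e₁ e₂ => e₁.cost + e₂.cost + 1
  | .sub e₁ e₂ => e₁.cost + e₂.cost + 1
  | .mul e₁ e₂ => e₁.cost + e₂.cost + 1
  | .div e₁ e₂ => e₁.cost + e₂.cost + 1

def BExpr.holds (σ : RAMState) : BExpr → Prop
  | .leI e₁ e₂ => e₁.eval σ ≤ e₂.eval σ
  | .leR e₁ e₂ => e₁.eval σ ≤ e₂.eval σ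
  | .not b => ¬ b.holds σ
  | .and b₁ b₂ => b₁.holds σ ∧ b₂.holds σ

def BExpr.cost : BExpr → ℕ
  | .leI e₁ e₂ => e₁.cost + e₂.cost + 1
  | .leR e₁ e₂ => e₁.cost + e₂.cost + 1
  | .not b => b.cost + 1
  | .and b₁ b₂ => b₁.cost + b₂.cost + 1

/-- `Exec p σ k σ'`: started in the state `σ`, the program `p` halts after `k` steps in the
state `σ'`. -/
inductive Exec : Prog → RAMState → ℕ → RAMState → Prop where
  | skip (σ : RAMState) : Exec .skip σ 1 σ
  | setI (σ : RAMState) (x : ℕ) (e : IExpr) :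
      Exec (.setI x e) σ (e.cost + 1) { σ with intVar := Function.update σ.intVar x (e.eval σ) }
  | setR (σ : RAMState) (x : ℕ) (e : RExpr) :
      Exec (.setR x e) σ (e.cost + 1) { σ with realVar := Function.update σ.realVar x (e.eval σ) }
  | putI (σ : RAMState) (a : ℕ) (i e : IExpr) :
      Exec (.putI a i e) σ (i.cost + e.cost + 1)
        { σ with intArr := Function.update σ.intArr a
                   (Function.update (σ.intArr a) (i.eval σ) (e.eval σ)) }
  | putR (σ : RAMState) (a : ℕ) (i : IExpr) (e : RExpr) :
      Exec (.putR a i e) σ (i.cost + e.cost + 1)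
        { σ with realArr := Function.update σ.realArr a
                   (Function.update (σ.realArr a) (i.eval σ) (e.eval σ)) }
  | seq {p q : Prog} {σ σ₁ σ₂ : RAMState} {k₁ k₂ : ℕ} :
      Exec p σ k₁ σ₁ → Exec q σ₁ k₂ σ₂ → Exec (.seq p q) σ (k₁ + k₂) σ₂
  | ite_true {b : BExpr} {p q : Prog} {σ σ₁ : RAMState} {k : ℕ} :
      b.holds σ → Exec p σ k σ₁ → Exec (.ite b p q) σ (b.cost + 1 + k) σ₁
  | ite_false {b : BExpr} {p q : Prog} {σ σ₁ : RAMState} {k : ℕ} :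
      ¬ b.holds σ → Exec q σ k σ₁ → Exec (.ite b p q) σ (b.cost + 1 + k) σ₁
  | loop_true {b : BExpr} {p : Prog} {σ σ₁ σ₂ : RAMState} {k₁ k₂ : ℕ} :
      b.holds σ → Exec p σ k₁ σ₁ → Exec (.loop b p) σ₁ k₂ σ₂ →
        Exec (.loop b p) σ (b.cost + 1 + k₁ + k₂) σ₂
  | loop_false {b : BExpr} {p : Prog} {σ : RAMState} :
      ¬ b.holds σ → Exec (.loop b p) σ (b.cost + 1) σ

/-! ## Inputs of programs -/

/-- The content of a memory that holds the list `l` in the cells `0, 1, …` and zeros elsewhere. -/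
def memOfList {α : Type*} [Zero α] (l : List α) (i : ℤ) : α :=
  if 0 ≤ i then l.getD i.toNat 0 else 0

/-- The initial state for a steady-state maximum flow problem on the vertices `0, …, n - 1`, with
the edges listed in the order `edge`: variables `n`, number of edges, source, sink; arrays of the
tails, of the heads and of the capacities. All other memory is zero. -/
def FlowNetwork.initState {n : ℕ} (G : FlowNetwork (Fin n)) (edge : Fin G.E.card ≃ G.E) :
    RAMState where
  intVar := fun x => memOfList [(n : ℤ), (G.E.card : ℤ), (G.source : ℕ), (G.sink : ℕ)] x
  realVar := fun _ => 0
  intArr := fun a =>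
    if a = 0 then memOfList (List.ofFn fun j => (((edge j : Fin n × Fin n).1 : ℕ) : ℤ))
    else if a = 1 then memOfList (List.ofFn fun j => (((edge j : Fin n × Fin n).2 : ℕ) : ℤ))
    else fun _ => 0
  realArr := fun a =>
    if a = 0 then memOfList (List.ofFn fun j => (G.cap (edge j)).toReal) else fun _ => 0

/-- The program `P` is a steady-state maximum flow algorithm with running time `MF`: for every
network with `n'` nodes, `m'` edges and finite capacities it leaves the value of a maximum flow in
the real variable `0` after at most `MF n' m'` steps. -/
def IsMaxFlowAlgorithm (P : Prog) (MF : ℕ → ℕ → ℕ) : Prop :=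
  ∀ (n : ℕ) (G : FlowNetwork (Fin n)) (edge : Fin G.E.card ≃ G.E),
    G.source ≠ G.sink → (∀ e ∈ G.E, G.cap e ≠ ⊤) →
    ∃ (k : ℕ) (σ : RAMState), Exec P (G.initState edge) k σ ∧
      IsGreatest G.flowValues (σ.realVar 0) ∧ k ≤ MF n G.E.card

/-- A concise description of a temporal network on the vertices `0, …, n - 1`: a list of its edges
and, for each edge, the list of the pieces of its capacity function, each piece given by its first
time and its value, in increasing order of the times.  The last piece has no end. -/
structure Description {n : ℕ} (N : TemporalNetwork (Fin n)) where
  edge : Fin N.E.card ≃ N.E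
  pieces : Fin N.E.card → List (ℤ × ℝ≥0)
  pieces_ne_nil : ∀ j, pieces j ≠ []
  head_le : ∀ j, ∀ p ∈ (pieces j).head?, p.1 ≤ 0
  increasing : ∀ j, ((pieces j).map Prod.fst).Pairwise (· < ·)
  spec : ∀ (j : Fin N.E.card) (k : ℕ) (p : ℤ × ℝ≥0), (pieces j)[k]? = some p →
    ∀ t : ℤ, p.1 ≤ t → (∀ q, (pieces j)[k + 1]? = some q → t < q.1) → N.u (edge j) t = p.2

namespace Description

variable {n : ℕ} {N : TemporalNetwork (Fin n)}

/-- The total number `μ` of pieces. -/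
def numPieces (D : Description N) : ℕ := ∑ j, (D.pieces j).length

/-- The initial state for the maximum flow over time problem: variables `n`, number of edges,
source, sink, `T`, `τ`; arrays of the tails, of the heads, of the numbers of pieces of the edges,
and, for the pieces of all edges one after the other, of their first times and of their values.
All other memory is zero. -/
def initState (D : Description N) (T : ℕ) : RAMState where
  intVar := fun x =>
    memOfList [(n : ℤ), (N.E.card : ℤ), (N.s : ℕ), (N.d : ℕ), (T : ℤ), (N.τ : ℤ)] x
  realVar := fun _ => 0
  intArr := fun a =>
    if a = 0 then memOfList (List.ofFn fun j => (((D.edge j : Fin n × Fin n).1 : ℕ) : ℤ))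
    else if a = 1 then memOfList (List.ofFn fun j => (((D.edge j : Fin n × Fin n).2 : ℕ) : ℤ))
    else if a = 2 then memOfList (List.ofFn fun j => ((D.pieces j).length : ℤ))
    else if a = 3 then memOfList ((List.ofFn D.pieces).flatten.map Prod.fst)
    else fun _ => 0
  realArr := fun a =>
    if a = 0 then memOfList ((List.ofFn D.pieces).flatten.map fun p => (p.2 : ℝ)) else fun _ => 0

end Description

end

/-! Everything goes through minimum cuts. In the time-expanded network on V × [0, T] the holdover
edges get a capacity too large for a minimum cut, so the source side of a minimum cut is, over each
vertex x, an up-set {t ≥ α x}. A cut is therefore a threshold function α with α s = 0 and α d = T +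
1, and its cost is the sum of u_xy(t) over all edges xy and all t with α x ≤ t < α y - τ
(`cutCost`). Max-flow min-cut (`exists_maxFlow_minCut`), the reading of time-expanded flows as flows
over time (`isFlowOverTime_flowOfTEN`) and weak duality (`IsFlowOverTime.value_le_cutCost`) show
that the maximum flow over time equals the minimum of `cutCost`.

The key is `exists_critical_cut`: some minimum cut has only critical thresholds. Call an edge xy
tight if α y - τ = α x. If no vertex y of a tight component has α y or α y - τ among the times θ at
which capacities change, the whole component can be moved by +1 or by -1, and the two new costs
average to the old one (`cutCost_shift`). Both new cuts are then minimum cuts. But the sum of the α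
x ^ 2 is strictly convex, so a minimum cut that maximizes it admits no such move. Hence every tight
component contains a vertex at some θ or θ + τ, and along a tight path thresholds change by ±τ per
edge. So α x = θ + lτ, where |l| is at most n, and also at most m + 1.

For the first part, contracting every block of times carries a time-expanded flow to the condensed
network, for any A (`mem_flowValues_cTEN`). Conversely, a cut with thresholds at block starts is a
cut of the condensed network of no larger cost (`flow_cTEN_le_cutCost`). The size bound rests on
`card_staircase_le`: an edge joins only O(|A|) pairs of blocks.

For the second part, a program writes a variant of the condensed network to memory and then runs a
relocated copy of the given algorithm on it. The critical times arise by merging sorted lists, so no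
logarithmic factor appears. Only min(n, m + 1) + 1 multiples of τ are used in each direction. The
bound by n controls the m transit chains and the bound by m controls the n vertex chains, so O(nmμ)
edges suffice even with isolated vertices. The one additional multiple makes α y - τ a block start
as well. A block of departures is then never split by a critical cut, and one transit edge per edge
and block is enough. Infinite capacities are replaced by the total transit capacity plus one.
Correctness is again checked on cuts, in both directions (`Blocks.exists_timeCut`,
`Blocks.exists_cut`), without routing any flow. -/

open scoped NNReal ENNReal

/-! ## Maximum flows and minimum cuts in finite multigraphs -/

open Classical in
/-- The net flow into `w` when the edge `e` of a multigraph carries `f e` from `src e` to `dst e`. -/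
noncomputable def netFlow {W ι : Type*} [Fintype ι] (src dst : ι → W) (f : ι → ℝ) (w : W) : ℝ :=
  ∑ e, ((if dst e = w then f e else 0) - if src e = w then f e else 0)

section MultigraphFlow

variable {W ι : Type*} [Fintype ι] (src dst : ι → W)

theorem netFlow_add (f g : ι → ℝ) (w : W) :
    netFlow src dst (fun e => f e + g e) w = netFlow src dst f w + netFlow src dst g w := by
  simp only [netFlow, ← Finset.sum_add_distrib]
  refine Finset.sum_congr rfl fun e _ => ?_
  split_ifs <;> ring

theorem netFlow_smul (c : ℝ) (f : ι → ℝ) (w : W) :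
    netFlow src dst (fun e => c * f e) w = c * netFlow src dst f w := by
  simp only [netFlow, Finset.mul_sum]
  refine Finset.sum_congr rfl fun e _ => ?_
  split_ifs <;> ring

open Classical in
theorem netFlow_single (e₀ : ι) (x : ℝ) (w : W) :
    netFlow src dst (fun e => if e = e₀ then x else 0) w =
      (if dst e₀ = w then x else 0) - if src e₀ = w then x else 0 := by
  rw [netFlow, Finset.sum_eq_single e₀]
  · simp
  · intro e _ he
    simp [he]
  · simp

theorem sum_netFlow (f : ι → ℝ) (Z : Finset W) [∀ w, Decidable (w ∈ Z)] :
    ∑ w ∈ Z, netFlow src dst f w =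
      ∑ e, ((if dst e ∈ Z then f e else 0) - if src e ∈ Z then f e else 0) := by
  classical
  simp only [netFlow]
  rw [Finset.sum_comm]
  refine Finset.sum_congr rfl fun e _ => ?_
  rw [Finset.sum_sub_distrib, Finset.sum_ite_eq, Finset.sum_ite_eq]
  congr

/-- A flow from `s` to `t` that respects the capacities `c`. -/
structure IsMultiFlow (c : ι → ℝ) (s t : W) (f : ι → ℝ) : Prop where
  nonneg : ∀ e, 0 ≤ f e
  le_capacity : ∀ e, f e ≤ c e
  conservation : ∀ w, w ≠ s → w ≠ t → netFlow src dst f w = 0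

variable {src dst}

/-- Sum the net flow over the complement of `S`: only `t` contributes, and edges with both ends in
the complement cancel. -/
theorem netFlow_eq_cut [Fintype W] {c : ι → ℝ} {s t : W} {f : ι → ℝ}
    (hf : IsMultiFlow src dst c s t f) (S : Set W) [∀ w, Decidable (w ∈ S)] (hs : s ∈ S) (ht : t ∉ S) :
    netFlow src dst f t =
      ∑ e, ((if src e ∈ S ∧ dst e ∉ S then f e else 0) -
        if src e ∉ S ∧ dst e ∈ S then f e else 0) := by
  classical
  have h := sum_netFlow src dst f (Finset.univ.filter fun w => w ∉ S)
  rw [Finset.sum_eq_single t] at h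
  · rw [h]
    refine Finset.sum_congr rfl fun e _ => ?_
    by_cases h1 : src e ∈ S <;> by_cases h2 : dst e ∈ S <;> simp [h1, h2]
  · intro w hw hwt
    refine hf.conservation w ?_ hwt
    rintro rfl
    simp [hs] at hw
  · simp [ht]

/-- The value of a flow is at most the capacity of a cut. -/
theorem netFlow_le_cut [Fintype W] {c : ι → ℝ} {s t : W} {f : ι → ℝ}
    (hf : IsMultiFlow src dst c s t f) (S : Set W) [∀ w, Decidable (w ∈ S)] (hs : s ∈ S) (ht : t ∉ S) :
    netFlow src dst f t ≤ ∑ e, if src e ∈ S ∧ dst e ∉ S then c e else 0 := by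
  rw [netFlow_eq_cut hf S hs ht]
  refine Finset.sum_le_sum fun e _ => ?_
  have h1 := hf.nonneg e
  have h2 := hf.le_capacity e
  split_ifs <;> linarith

/-- The flows form a nonempty closed subset of the compact box [0, c], and the value is continuous.
-/
theorem exists_isMultiFlow_max (c : ι → ℝ) (hc : ∀ e, 0 ≤ c e) (s t : W) :
    ∃ f, IsMultiFlow src dst c s t f ∧
      ∀ g, IsMultiFlow src dst c s t g → netFlow src dst g t ≤ netFlow src dst f t := by
  have hcont : ∀ w, Continuous fun f : ι → ℝ => netFlow src dst f w := by
    intro w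
    refine continuous_finsetSum _ fun e _ => ?_
    refine Continuous.sub ?_ ?_ <;> split_ifs <;> fun_prop
  have hcompact : IsCompact {f : ι → ℝ | IsMultiFlow src dst c s t f} := by
    have hset : {f : ι → ℝ | IsMultiFlow src dst c s t f} =
        Set.Icc 0 c ∩ ⋂ w, ⋂ (_ : w ≠ s), ⋂ (_ : w ≠ t), {f | netFlow src dst f w = 0} := by
      ext f
      simp only [Set.mem_ofPred_eq, Set.mem_inter_iff, Set.mem_Icc, Set.mem_iInter]
      exact ⟨fun h => ⟨⟨h.nonneg, h.le_capacity⟩, h.conservation⟩,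
        fun h => ⟨h.1.1, h.1.2, h.2⟩⟩
    rw [hset]
    refine isCompact_Icc.inter_right ?_
    refine isClosed_iInter fun w => isClosed_iInter fun _ => isClosed_iInter fun _ => ?_
    exact isClosed_eq (hcont w) continuous_const
  have hne : {f : ι → ℝ | IsMultiFlow src dst c s t f}.Nonempty :=
    ⟨fun _ => 0, fun _ => le_rfl, hc, fun w _ _ => by simp [netFlow]⟩
  obtain ⟨f, hf, hmax⟩ := hcompact.exists_isMaxOn hne (hcont t).continuousOn
  exact ⟨f, hf, fun g hg => hmax hg⟩

/-- A change of `f` within the capacities sends a positive amount from `s` to `w`. -/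
def CanSend (src dst : ι → W) (c : ι → ℝ) (s : W) (f : ι → ℝ) (w : W) : Prop :=
  ∃ ε > 0, ∃ f' : ι → ℝ, (∀ e, 0 ≤ f' e ∧ f' e ≤ c e) ∧
    ∀ v, netFlow src dst f' v = netFlow src dst f v +
      (open Classical in (if w = v then ε else 0) - if s = v then ε else 0)

/-- This replaces augmenting paths by convex combinations. The change that reaches `w` is scaled by
`η` so that it sends at most 1, mixed with `f` with weight `δ`, and the same amount is then pushed
over `e₀`, forwards for `σ = 1` and backwards for `σ = -1`. The weight `δ` depends only on the slack
of `e₀`, so the change obtained for `w` may use `e₀` arbitrarily. -/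
theorem CanSend.step {c : ι → ℝ} {s : W} {f : ι → ℝ} {w v : W}
    (hf : ∀ e, 0 ≤ f e ∧ f e ≤ c e) (h : CanSend src dst c s f w) (e₀ : ι) (σ : ℝ)
    (hnet : ∀ z, (open Classical in
      netFlow src dst (fun e => if e = e₀ then σ else 0) z =
        (if v = z then 1 else 0) - if w = z then 1 else 0))
    (hroom : ∃ δ > 0, δ ≤ 1 ∧ ∀ y, 0 ≤ y → y ≤ c e₀ → ∀ ε > 0, ε ≤ 1 → 
      0 ≤ (1 - δ) * f e₀ + δ * (y + ε * σ) ∧ (1 - δ) * f e₀ + δ * (y + ε * σ) ≤ c e₀) :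
    CanSend src dst c s f v := by
  classical
  obtain ⟨ε, hε, f', hf', hn⟩ := h
  obtain ⟨δ, hδ, hδ1, hroom⟩ := hroom
  set η := min 1 ε⁻¹ with hη
  have hη0 : 0 < η := lt_min one_pos (inv_pos.2 hε)
  have hη1 : η ≤ 1 := min_le_left _ _
  have hηε : η * ε ≤ 1 := by
    calc η * ε ≤ ε⁻¹ * ε := by gcongr; exact min_le_right _ _
      _ = 1 := inv_mul_cancel₀ hε.ne'
  refine ⟨δ * (η * ε), by positivity, fun e => ((1 - δ) * f e + δ * ((1 - η) * f e + η * f' e)) +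
    δ * (η * ε) * (if e = e₀ then σ else 0), fun e => ?_, fun z => ?_⟩
  · have h0 : 0 ≤ (1 - η) * f e + η * f' e :=
      add_nonneg (mul_nonneg (by linarith) (hf e).1) (mul_nonneg hη0.le (hf' e).1)
    have h1 : (1 - η) * f e + η * f' e ≤ c e := by nlinarith [(hf e).2, (hf' e).2]
    by_cases he : e = e₀
    · subst he
      have := hroom _ h0 h1 (η * ε) (by positivity) hηε
      simp only [if_true]
      constructor
      · convert this.1 using 1; ring
      · convert this.2 using 1; ring
    · simp only [he, if_false, mul_zero, add_zero]
      constructor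
      · exact add_nonneg (mul_nonneg (by linarith) (hf e).1) (mul_nonneg hδ.le h0)
      · nlinarith [(hf e).2]
  · rw [netFlow_add, netFlow_add, netFlow_smul, netFlow_smul, netFlow_add, netFlow_smul,
      netFlow_smul, netFlow_smul, hn, hnet]
    split_ifs <;> ring

open Classical in
/-- The max-flow min-cut theorem. -/
theorem exists_maxFlow_minCut [Fintype W] (src dst : ι → W) (c : ι → ℝ) (hc : ∀ e, 0 ≤ c e)
    {s t : W} (hst : s ≠ t) :
    ∃ f, IsMultiFlow src dst c s t f ∧ ∃ S : Set W, s ∈ S ∧ t ∉ S ∧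
      netFlow src dst f t = ∑ e, if src e ∈ S ∧ dst e ∉ S then c e else 0 := by
  obtain ⟨f, hf, hmax⟩ := exists_isMultiFlow_max (src := src) (dst := dst) c hc s t
  have hfc : ∀ e, 0 ≤ f e ∧ f e ≤ c e := fun e => ⟨hf.nonneg e, hf.le_capacity e⟩
  -- The source side consists of all vertices to which the maximum flow can still send something. It
  -- misses `t` by maximality, and an outgoing edge with slack or an incoming edge with flow would
  -- enlarge it.
  refine ⟨f, hf, {w | CanSend src dst c s f w}, ⟨1, one_pos, f, hfc, by simp⟩, ?_, ?_⟩
  · rintro ⟨ε, hε, f', hf', hn⟩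
    have h1 : IsMultiFlow src dst c s t f' := by
      refine ⟨fun e => (hf' e).1, fun e => (hf' e).2, fun w hws hwt => ?_⟩
      rw [hn, hf.conservation w hws hwt]
      simp [hws.symm, hwt.symm]
    have h2 := hmax f' h1
    rw [hn] at h2
    simp [hst] at h2
    linarith
  · rw [netFlow_eq_cut hf {w | CanSend src dst c s f w} ⟨1, one_pos, f, hfc, by simp⟩]
    · refine Finset.sum_congr rfl fun e _ => ?_
      by_cases h1 : CanSend src dst c s f (src e) <;> by_cases h2 : CanSend src dst c s f (dst e)
      · simp [h1, h2]
      · simp only [Set.mem_ofPred_eq, h1, h2, not_true, not_false_iff, and_self, if_true, if_false,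
          sub_zero]
        by_contra hne
        have hlt : f e < c e := lt_of_le_of_ne (hfc e).2 hne
        refine h2 (h1.step hfc e 1 (fun z => by rw [netFlow_single]) ?_)
        have hpos : 0 < c e - f e := sub_pos.2 hlt
        have hpos' : 0 < c e + 1 - f e := by linarith
        -- The worst case is y = c and ε = 1; this `δ` makes (1 - δ) f + δ (c + 1) equal to c.
        refine ⟨(c e - f e) / (c e + 1 - f e), by positivity, ?_, fun y hy0 hy1 ε hε hε1 => ?_⟩
        · rw [div_le_one hpos']; linarith
        · have hδ0 : 0 < (c e - f e) / (c e + 1 - f e) := by positivity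
          have hδ : (c e - f e) / (c e + 1 - f e) * (c e + 1 - f e) = c e - f e :=
            div_mul_cancel₀ _ hpos'.ne'
          have hδ1 : (c e - f e) / (c e + 1 - f e) ≤ 1 := by
            rw [div_le_one hpos']; linarith
          generalize (c e - f e) / (c e + 1 - f e) = δ at *
          have := (hfc e).1
          constructor
          · have h3 : 0 ≤ (1 - δ) * f e := mul_nonneg (by linarith) this
            have h4 : 0 ≤ δ * (y + ε * 1) := mul_nonneg hδ0.le (by linarith)
            linarith
          · have h4 : δ * (y + ε * 1) ≤ δ * (c e + 1) :=
              mul_le_mul_of_nonneg_left (by linarith) hδ0.le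
            linarith
      · simp only [Set.mem_ofPred_eq, h1, h2, not_true, not_false_iff, and_self, if_true, if_false,
          zero_sub, neg_eq_zero]
        by_contra hne
        have hlt : 0 < f e := lt_of_le_of_ne (hfc e).1 (Ne.symm hne)
        refine h1 (h2.step hfc e (-1) (fun z => by rw [netFlow_single]; split_ifs <;> ring) ?_)
        have hpos' : 0 < f e + 1 := by linarith
        -- The worst case is y = 0 and ε = 1; this `δ` makes (1 - δ) f - δ equal to 0.
        refine ⟨f e / (f e + 1), by positivity, ?_, fun y hy0 hy1 ε hε hε1 => ?_⟩
        · rw [div_le_one hpos']; linarith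
        · have hδ0 : 0 < f e / (f e + 1) := by positivity
          have hδ : f e / (f e + 1) * (f e + 1) = f e :=
            div_mul_cancel₀ _ hpos'.ne'
          have hδ1 : f e / (f e + 1) ≤ 1 := by
            rw [div_le_one hpos']; linarith
          generalize f e / (f e + 1) = δ at *
          have := (hfc e).2
          constructor
          · have h4 : δ * (-1) ≤ δ * (y + ε * (-1)) :=
              mul_le_mul_of_nonneg_left (by linarith) hδ0.le
            linarith
          · have h3 : (1 - δ) * f e ≤ (1 - δ) * c e :=
              mul_le_mul_of_nonneg_left this (by linarith)
            have h4 : δ * (y + ε * (-1)) ≤ δ * c e :=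
              mul_le_mul_of_nonneg_left (by linarith) hδ0.le
            linarith
      · simp [h1, h2]
    · rintro ⟨ε, hε, f', hf', hn⟩
      have h1 : IsMultiFlow src dst c s t f' := by
        refine ⟨fun e => (hf' e).1, fun e => (hf' e).2, fun w hws hwt => ?_⟩
        rw [hn, hf.conservation w hws hwt]
        simp [hws.symm, hwt.symm]
      have h2 := hmax f' h1
      rw [hn] at h2
      simp [hst] at h2
      linarith

open Classical in
/-- The max-flow min-cut theorem when the edges of a second kind have so large a capacity that they
do not occur in minimum cuts. -/
theorem exists_maxFlow_minCut_sum [Fintype W] {κ : Type*} [Fintype κ] (src dst : ι ⊕ κ → W)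
    (c : ι → ℝ) (hc : ∀ e, 0 ≤ c e) {s t : W} (S₀ : Set W) (hs : s ∈ S₀) (ht : t ∉ S₀)
    (hS₀ : ∀ h : κ, src (.inr h) ∈ S₀ → dst (.inr h) ∈ S₀) :
    ∃ f, IsMultiFlow src dst (Sum.elim c fun _ => ∑ e, c e + 1) s t f ∧
      ∃ S : Set W, s ∈ S ∧ t ∉ S ∧ (∀ h : κ, src (.inr h) ∈ S → dst (.inr h) ∈ S) ∧
      netFlow src dst f t =
        ∑ e : ι, if src (.inl e) ∈ S ∧ dst (.inl e) ∉ S then c e else 0 := by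
  have hsum : 0 ≤ ∑ e, c e := Finset.sum_nonneg fun e _ => hc e
  have hst : s ≠ t := by rintro rfl; exact ht hs
  have hc' : ∀ e, 0 ≤ Sum.elim c (fun _ : κ => ∑ e, c e + 1) e := by
    rintro (e | e)
    · exact hc e
    · exact add_nonneg hsum zero_le_one
  obtain ⟨f, hf, S, hsS, htS, hval⟩ := exists_maxFlow_minCut src dst _ hc' hst
  have hle := netFlow_le_cut hf S₀ hs ht
  rw [Fintype.sum_sum_type] at hval hle
  simp only [Sum.elim_inl, Sum.elim_inr] at hval hle
  have h1 : ∑ h : κ, (if src (.inr h) ∈ S₀ ∧ dst (.inr h) ∉ S₀ then ∑ e, c e + 1 else 0) = 0 :=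
    Finset.sum_eq_zero fun h _ => if_neg fun hh => hh.2 (hS₀ h hh.1)
  have h2 : ∑ e : ι, (if src (.inl e) ∈ S₀ ∧ dst (.inl e) ∉ S₀ then c e else 0) ≤ ∑ e, c e := by
    refine Finset.sum_le_sum fun e _ => ?_
    split_ifs
    exacts [le_rfl, hc e]
  have h3 : 0 ≤ ∑ e : ι, (if src (.inl e) ∈ S ∧ dst (.inl e) ∉ S then c e else 0) :=
    Finset.sum_nonneg fun e _ => by split_ifs; exacts [hc e, le_rfl]
  -- The cut `S₀` costs at most ∑ c, so a minimum cut cannot afford an edge of capacity ∑ c + 1.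
  have hno : ∀ h : κ, src (.inr h) ∈ S → dst (.inr h) ∈ S := by
    intro h hh
    by_contra hh'
    have h4 : ∑ e, c e + 1 ≤
        ∑ h : κ, (if src (.inr h) ∈ S ∧ dst (.inr h) ∉ S then ∑ e, c e + 1 else 0) := by
      have := Finset.single_le_sum (s := Finset.univ)
        (f := fun h : κ => if src (.inr h) ∈ S ∧ dst (.inr h) ∉ S then ∑ e, c e + 1 else 0)
        (fun i _ => by
          show (0 : ℝ) ≤ ite _ _ _
          split_ifs
          exacts [add_nonneg hsum zero_le_one, le_rfl])
        (Finset.mem_univ h)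
      simpa [hh, hh'] using this
    linarith
  refine ⟨f, hf, S, hsS, htS, hno, ?_⟩
  have h5 : ∑ h : κ, (if src (.inr h) ∈ S ∧ dst (.inr h) ∉ S then ∑ e, c e + 1 else 0) = 0 :=
    Finset.sum_eq_zero fun h _ => if_neg fun hh => hh.2 (hno h hh.1)
  rw [hval, h5, add_zero]

end MultigraphFlow

/-! ## Transfer to steady-state networks -/

namespace FlowNetwork

variable {W : Type*}

/-- The flow itself serves as a finite capacity function in the multigraph bound, so infinite
capacities never have to be turned into reals. -/
theorem flow_value_le_cut [Fintype W] {G : FlowNetwork W} {f : W × W → ℝ} (hf : G.IsFlow f)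
    (S : Set W) [∀ w, Decidable (w ∈ S)] (hs : G.source ∈ S) (ht : G.sink ∉ S) (C : ℝ) (hC : 0 ≤ C)
    (hcut : ∑ e ∈ G.E with e.1 ∈ S ∧ e.2 ∉ S, G.cap e ≤ ENNReal.ofReal C) :
    G.netIn f G.sink ≤ C := by
  have hnet : ∀ w, G.netIn f w = netFlow (fun e : G.E => e.1.1) (fun e : G.E => e.1.2)
      (fun e => f e) w := by
    intro w
    classical
    rw [FlowNetwork.netIn, netFlow, Finset.sum_filter, Finset.sum_filter, ← Finset.sum_sub_distrib,
      ← Finset.sum_coe_sort]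
  have hm : IsMultiFlow (fun e : G.E => e.1.1) (fun e : G.E => e.1.2) (fun e => f e) G.source
      G.sink (fun e => f e) :=
    ⟨fun e => hf.nonneg e e.2, fun e => le_rfl,
      fun w h1 h2 => by rw [← hnet]; exact hf.conservation w h1 h2⟩
  rw [hnet]
  refine (netFlow_le_cut hm S hs ht).trans ?_
  classical
  rw [Finset.sum_coe_sort G.E (fun e => if e.1 ∈ S ∧ e.2 ∉ S then f e else 0),
    ← Finset.sum_filter, ← ENNReal.ofReal_le_ofReal_iff hC]
  refine le_trans ?_ hcut
  rw [ENNReal.ofReal_sum_of_nonneg]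
  · exact Finset.sum_le_sum fun e he => hf.le_capacity e (Finset.mem_filter.1 he).1
  · exact fun e he => hf.nonneg e (Finset.mem_filter.1 he).1

open Classical in
/-- A multigraph flow becomes a flow in a network when parallel edges are added. -/
theorem mem_flowValues_of_multiFlow {ι : Type*} [Fintype ι] {src dst : ι → W} (g : ι → ℝ)
    (G : FlowNetwork W) (hg : ∀ e, 0 ≤ g e)
    (hcap : ∀ p : W × W, ENNReal.ofReal (∑ e, if (src e, dst e) = p then g e else 0) ≤ G.cap p)
    (hE : ∀ p : W × W, p ∉ G.E → ∀ e, (src e, dst e) = p → g e = 0)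
    (hcons : ∀ w, w ≠ G.source → w ≠ G.sink → netFlow src dst g w = 0) :
    netFlow src dst g G.sink ∈ G.flowValues := by
  have hnet : ∀ w, G.netIn (fun p => ∑ e, if (src e, dst e) = p then g e else 0) w =
      netFlow src dst g w := by
    intro w
    have key : ∀ P : W × W → Prop,
        (∑ p ∈ G.E with P p, ∑ e, if (src e, dst e) = p then g e else 0) =
          ∑ e, if P (src e, dst e) then g e else 0 := by
      intro P
      rw [Finset.sum_comm]
      refine Finset.sum_congr rfl fun e _ => ?_
      rw [Finset.sum_ite_eq]
      by_cases h : (src e, dst e) ∈ G.E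
      · simp [h]
      · simp [h, hE _ h e rfl]
    rw [FlowNetwork.netIn, netFlow, Finset.sum_sub_distrib, key fun p => p.2 = w,
      key fun p => p.1 = w]
  refine ⟨fun p => ∑ e, if (src e, dst e) = p then g e else 0, ⟨fun p _ => ?_, fun p _ => hcap p,
    fun w h1 h2 => ?_⟩, hnet _⟩
  · exact Finset.sum_nonneg fun e _ => by split_ifs; exacts [hg e, le_rfl]
  · rw [hnet, hcons w h1 h2]

end FlowNetwork

/-! ## Cuts over time -/

namespace TemporalNetwork

variable {V : Type*}

/-- A threshold `α x` for each vertex `x`: the copies of `x` at times from `α x` on are on the side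
of the source. -/
structure IsTimeCut (N : TemporalNetwork V) (T : ℕ) (α : V → ℤ) : Prop where
  nonneg : ∀ x, 0 ≤ α x
  le_horizon : ∀ x, α x ≤ T + 1
  source : α N.s = 0
  sink : α N.d = T + 1

/-- The edge xy is cut at departure time t when the copy of x at t is on the source side, α x ≤ t,
and the copy of y at t + τ is not, t + τ < α y. -/
noncomputable def cutCost (N : TemporalNetwork V) (α : V → ℤ) : ℝ :=
  ∑ e ∈ N.E, ∑ t ∈ Finset.Ico (α e.1) (α e.2 - N.τ), (N.u e t : ℝ)

theorem cutCost_nonneg (N : TemporalNetwork V) (α : V → ℤ) : 0 ≤ N.cutCost α :=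
  Finset.sum_nonneg fun _ _ => Finset.sum_nonneg fun _ _ => NNReal.coe_nonneg _

theorem sum_netIn [Fintype V] (N : TemporalNetwork V) (f : V × V → ℤ → ℝ) (β : V → ℤ) :
    ∑ x, N.netIn f x (β x) =
      ∑ e ∈ N.E, ((∑ t ∈ Finset.Icc (0 : ℤ) (β e.2 - N.τ), f e t) -
        ∑ t ∈ Finset.Icc (0 : ℤ) (β e.1), f e t) := by
  classical
  simp only [netIn, Finset.sum_sub_distrib, Finset.sum_filter]
  congr 1
  · rw [Finset.sum_comm]
    refine Finset.sum_congr rfl fun e _ => ?_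
    rw [Finset.sum_ite_eq]; simp
  · rw [Finset.sum_comm]
    refine Finset.sum_congr rfl fun e _ => ?_
    rw [Finset.sum_ite_eq]; simp

/-- Sum over all x the net inflow up to time α x - 1. The sink contributes the value and every other
term is nonnegative; a vertex with threshold 0, such as the source, contributes 0. For an edge xy,
what arrives before α y minus what departs before α x is at most what enters during [α x, α y - τ).
-/
theorem IsFlowOverTime.value_le_cutCost [Fintype V] {N : TemporalNetwork V} {T : ℕ}
    {f : V × V → ℤ → ℝ} (hf : N.IsFlowOverTime T f) {α : V → ℤ} (hα : N.IsTimeCut T α) :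
    N.netIn f N.d T ≤ N.cutCost α := by
  classical
  have hzero : ∀ x, ∀ b < 0, N.netIn f x b = 0 := by
    intro x b hb
    have h1 : Finset.Icc (0 : ℤ) b = ∅ := Finset.Icc_eq_empty (by omega)
    have h2 : Finset.Icc (0 : ℤ) (b - N.τ) = ∅ := Finset.Icc_eq_empty (by omega)
    simp [netIn, h1, h2]
  have hnn : ∀ x, 0 ≤ N.netIn f x (α x - 1) := by
    intro x
    by_cases hx : α x = 0
    · rw [hx, hzero x _ (by omega)]
    · have h1 := hα.nonneg x
      have h2 := hα.le_horizon x
      refine hf.netIn_nonneg x ?_ _ (Finset.mem_Icc.2 ⟨by omega, by omega⟩)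
      rintro rfl
      exact hx hα.source
  have h1 : N.netIn f N.d T ≤ ∑ x, N.netIn f x (α x - 1) := by
    have := Finset.single_le_sum (fun x _ => hnn x) (Finset.mem_univ N.d)
    simpa [hα.sink] using this
  refine h1.trans ?_
  rw [sum_netIn N f fun x => α x - 1, cutCost]
  refine Finset.sum_le_sum fun e he => ?_
  have ha := hα.nonneg e.1
  have hb := hα.le_horizon e.2
  rw [sub_le_iff_le_add]
  have hsub : Finset.Icc (0 : ℤ) (α e.2 - 1 - N.τ) ⊆
      Finset.Ico (α e.1) (α e.2 - N.τ) ∪ Finset.Icc 0 (α e.1 - 1) := by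
    intro t ht
    simp only [Finset.mem_union, Finset.mem_Icc, Finset.mem_Ico] at ht ⊢
    omega
  have hmem : ∀ t ∈ Finset.Ico (α e.1) (α e.2 - N.τ) ∪ Finset.Icc 0 (α e.1 - 1),
      t ∈ Finset.Icc (0 : ℤ) T := by
    intro t ht
    have hle := hα.le_horizon e.1
    simp only [Finset.mem_union, Finset.mem_Icc, Finset.mem_Ico] at ht ⊢
    omega
  calc ∑ t ∈ Finset.Icc (0 : ℤ) (α e.2 - 1 - N.τ), f e t
      ≤ ∑ t ∈ Finset.Ico (α e.1) (α e.2 - N.τ) ∪ Finset.Icc 0 (α e.1 - 1), f e t :=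
        Finset.sum_le_sum_of_subset_of_nonneg hsub fun t ht _ => hf.nonneg e he t (hmem t ht)
    _ = ∑ t ∈ Finset.Ico (α e.1) (α e.2 - N.τ), f e t +
          ∑ t ∈ Finset.Icc 0 (α e.1 - 1), f e t := by
        refine Finset.sum_union (Finset.disjoint_left.2 fun t h1 h2 => ?_)
        simp only [Finset.mem_Icc, Finset.mem_Ico] at h1 h2
        omega
    _ ≤ _ := by
        gcongr with t ht
        exact hf.le_capacity e he t (hmem t (Finset.mem_union_left _ ht))

/-! ### Critical cuts -/

theorem sum_Ico_add_one_right (u : ℤ → ℝ) {a b : ℤ} (h : a ≤ b) :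
    ∑ t ∈ Finset.Ico a (b + 1), u t = ∑ t ∈ Finset.Ico a b, u t + u b := by
  have : Finset.Ico a (b + 1) = insert b (Finset.Ico a b) := by
    ext t; simp only [Finset.mem_Ico, Finset.mem_insert]; omega
  rw [this, Finset.sum_insert (by simp), add_comm]

theorem sum_Ico_sub_one_left (u : ℤ → ℝ) {a b : ℤ} (h : a ≤ b) :
    ∑ t ∈ Finset.Ico (a - 1) b, u t = u (a - 1) + ∑ t ∈ Finset.Ico a b, u t := by
  have : Finset.Ico (a - 1) b = insert (a - 1) (Finset.Ico a b) := by
    ext t; simp only [Finset.mem_Ico, Finset.mem_insert]; omega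
  rw [this, Finset.sum_insert (by simp)]

/-- A sum over [a, b) is affine in the endpoints as long as `u` does not jump at a moving endpoint.
The only kink is at a = b, where moving a single endpoint makes an empty interval nonempty; `hne`
excludes it. -/
theorem sum_Ico_shift (u : ℤ → ℝ) (a b δ ε : ℤ) (hδ : δ = 0 ∨ δ = 1) (hε : ε = 0 ∨ ε = 1)
    (hne : δ = ε ∨ a ≠ b) (ha : a < b → δ = 1 → u a = u (a - 1))
    (hb : a < b → ε = 1 → u b = u (b - 1)) :
    ∑ t ∈ Finset.Ico (a + δ) (b + ε), u t + ∑ t ∈ Finset.Ico (a - δ) (b - ε), u t =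
      2 * ∑ t ∈ Finset.Ico a b, u t := by
  by_cases hab : a < b
  · have h1 : ∑ t ∈ Finset.Ico (a + δ) (b + ε), u t =
        ∑ t ∈ Finset.Ico a b, u t - δ * u a + ε * u b := by
      have hl : ∑ t ∈ Finset.Ico (a + δ) (b + ε), u t =
          ∑ t ∈ Finset.Ico a (b + ε), u t - δ * u a := by
        rcases hδ with rfl | rfl
        · simp
        · have := sum_Ico_sub_one_left u (a := a + 1) (b := b + ε) (by omega)
          simp only [add_sub_cancel_right] at this
          rw [this]; simp
      have hr : ∑ t ∈ Finset.Ico a (b + ε), u t = ∑ t ∈ Finset.Ico a b, u t + ε * u b := by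
        rcases hε with rfl | rfl
        · simp
        · rw [sum_Ico_add_one_right u hab.le]; simp
      rw [hl, hr]; ring
    have h2 : ∑ t ∈ Finset.Ico (a - δ) (b - ε), u t =
        ∑ t ∈ Finset.Ico a b, u t + δ * u (a - 1) - ε * u (b - 1) := by
      have hl : ∑ t ∈ Finset.Ico (a - δ) (b - ε), u t =
          ∑ t ∈ Finset.Ico a (b - ε), u t + δ * u (a - 1) := by
        rcases hδ with rfl | rfl
        · simp
        · rw [sum_Ico_sub_one_left u (by omega)]; simp [add_comm]
      have hr : ∑ t ∈ Finset.Ico a (b - ε), u t =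
          ∑ t ∈ Finset.Ico a b, u t - ε * u (b - 1) := by
        rcases hε with rfl | rfl
        · simp
        · have := sum_Ico_add_one_right u (a := a) (b := b - 1) (by omega)
          simp only [sub_add_cancel] at this
          rw [this]; simp
      rw [hl, hr]; ring
    have h3 : (δ : ℝ) * u a = δ * u (a - 1) := by
      rcases hδ with rfl | rfl
      · simp
      · rw [ha hab rfl]
    have h4 : (ε : ℝ) * u b = ε * u (b - 1) := by
      rcases hε with rfl | rfl
      · simp
      · rw [hb hab rfl]
    rw [h1, h2]; linarith
  · rw [Finset.Ico_eq_empty (show ¬ a + δ < b + ε by omega),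
      Finset.Ico_eq_empty (show ¬ a - δ < b - ε by omega), Finset.Ico_eq_empty hab]
    simp

/-- The edges that are tight for `α`. -/
def tightGraph (N : TemporalNetwork V) (α : V → ℤ) : SimpleGraph V :=
  SimpleGraph.fromRel fun x y => (x, y) ∈ N.E ∧ α y - N.τ = α x

theorem tightGraph_walk (N : TemporalNetwork V) (α : V → ℤ) {x y : V}
    (p : (N.tightGraph α).Walk x y) :
    ∃ k : ℤ, |k| ≤ p.length ∧ α x = α y + k * N.τ := by
  induction p with
  | nil => exact ⟨0, by simp, by simp⟩
  | @cons x y z h p ih =>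
    obtain ⟨k, hk, he⟩ := ih
    rw [abs_le] at hk
    rw [tightGraph, SimpleGraph.fromRel_adj] at h
    rcases h.2 with h | h
    · refine ⟨k - 1, abs_le.2 ?_, by linear_combination he - h.2⟩
      rw [SimpleGraph.Walk.length_cons]; push_cast; constructor <;> linarith
    · refine ⟨k + 1, abs_le.2 ?_, by linear_combination he + h.2⟩
      rw [SimpleGraph.Walk.length_cons]; push_cast; constructor <;> linarith

/-- Bounding by edges rather than vertices keeps the number of multiples of τ small when most
vertices are isolated; the edge count of the program's network depends on it. -/
theorem tightGraph_path_length_le (N : TemporalNetwork V) (α : V → ℤ) {x y : V}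
    {p : (N.tightGraph α).Walk x y} (hp : p.IsPath) : p.length ≤ N.E.card := by
  classical
  rw [← SimpleGraph.Walk.length_edges, ← List.toFinset_card_of_nodup hp.isTrail.edges_nodup]
  refine (Finset.card_le_card ?_).trans (Finset.card_image_le (s := N.E) (f := fun e => s(e.1, e.2)))
  intro e he
  rw [List.mem_toFinset] at he
  have he' := p.edges_subset_edgeSet he
  induction e with
  | h a b =>
    rw [SimpleGraph.mem_edgeSet, tightGraph, SimpleGraph.fromRel_adj] at he'
    rw [Finset.mem_image]
    rcases he'.2 with h | h
    · exact ⟨(a, b), h.1, rfl⟩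
    · exact ⟨(b, a), h.1, Sym2.eq_swap⟩

/-- Here `χ` is constant on tight components, so the two ends of the departure interval of a tight
edge move together, while on other edges the interval is away from the kink. `hfree` keeps moving
endpoints off the capacity changes. Since 0 and T + 1 lie in Θ, the endpoints in question lie in the
range where `hΘ` applies. -/
theorem cutCost_shift (N : TemporalNetwork V) {T : ℕ} {Θ : Set ℤ} (h0 : 0 ∈ Θ)
    (hT : (T : ℤ) + 1 ∈ Θ)
    (hΘ : ∀ e ∈ N.E, ∀ t : ℤ, 0 < t → t ≤ T → N.u e t ≠ N.u e (t - 1) → t ∈ Θ)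
    {α : V → ℤ} (hα : N.IsTimeCut T α) (χ : V → ℤ) (hχ : ∀ x, χ x = 0 ∨ χ x = 1)
    (hadj : ∀ x y, (N.tightGraph α).Adj x y → χ x = χ y)
    (hfree : ∀ x, χ x = 1 → α x ∉ Θ ∧ α x - N.τ ∉ Θ) :
    N.cutCost (fun x => α x + χ x) + N.cutCost (fun x => α x - χ x) = 2 * N.cutCost α := by
  rw [cutCost, cutCost, cutCost, ← Finset.sum_add_distrib, Finset.mul_sum]
  refine Finset.sum_congr rfl fun e he => ?_
  have hx0 := hα.nonneg e.1
  have hxT := hα.le_horizon e.1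
  have hyT := hα.le_horizon e.2
  have := sum_Ico_shift (fun t => (N.u e t : ℝ)) (α e.1) (α e.2 - N.τ) (χ e.1) (χ e.2) (hχ _) (hχ _)
    ?_ ?_ ?_
  · rw [← this]
    congr 2 <;> congr 1 <;> ring
  · by_cases hxy : e.1 = e.2
    · left; rw [hxy]
    · by_cases ht : α e.1 = α e.2 - N.τ
      · left
        exact hadj _ _ ((SimpleGraph.fromRel_adj _ _ _).2 ⟨hxy, .inl ⟨he, ht.symm⟩⟩)
      · exact .inr ht
  · intro hlt h1
    have hf := (hfree _ h1).1
    by_contra hne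
    have h2 : α e.1 ≠ 0 := fun h => hf (h ▸ h0)
    exact hf (hΘ e he _ (by omega) (by omega) fun h => hne (by simp [h]))
  · intro hlt h1
    have hf := (hfree _ h1).2
    by_contra hne
    have h2 : α e.2 - N.τ ≠ T + 1 := fun h => hf (h ▸ hT)
    exact hf (hΘ e he _ (by omega) (by omega) fun h => hne (by simp [h]))

theorem finite_isTimeCut [Finite V] (N : TemporalNetwork V) (T : ℕ) :
    {α : V → ℤ | N.IsTimeCut T α}.Finite := by
  refine (Set.Finite.pi fun _ : V => Set.finite_Icc (0 : ℤ) (T + 1)).subset ?_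
  intro α hα x _
  exact ⟨hα.nonneg x, hα.le_horizon x⟩

/-- There is a cut of minimum cost all of whose thresholds are critical. -/
theorem exists_critical_cut [Fintype V] (N : TemporalNetwork V) {T : ℕ} {Θ : Set ℤ} (h0 : 0 ∈ Θ)
    (hT : (T : ℤ) + 1 ∈ Θ)
    (hΘ : ∀ e ∈ N.E, ∀ t : ℤ, 0 < t → t ≤ T → N.u e t ≠ N.u e (t - 1) → t ∈ Θ) :
    ∃ α, N.IsTimeCut T α ∧ (∀ β, N.IsTimeCut T β → N.cutCost α ≤ N.cutCost β) ∧
      ∀ x, ∃ θ ∈ Θ, ∃ l : ℤ, |l| ≤ Fintype.card V ∧ |l| ≤ N.E.card + 1 ∧ α x = θ + l * N.τ := by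
  classical
  have hne : {α : V → ℤ | N.IsTimeCut T α}.Nonempty := by
    refine ⟨fun x => if x = N.d then T + 1 else 0, fun x => ?_, fun x => ?_, ?_, ?_⟩
    · split_ifs <;> omega
    · split_ifs <;> omega
    · simp [N.s_ne_d]
    · simp
  obtain ⟨α₀, hα₀, hmin₀⟩ := Set.exists_min_image _ N.cutCost (N.finite_isTimeCut T) hne
  -- Among the minimum cuts, one extremal for a strictly convex function is chosen; it cannot be the
  -- midpoint of two other minimum cuts.
  obtain ⟨α, ⟨hα, hαc⟩, hmax⟩ := Set.exists_max_image
    {α : V → ℤ | N.IsTimeCut T α ∧ N.cutCost α ≤ N.cutCost α₀} (fun α => ∑ x, α x ^ 2)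
    ((N.finite_isTimeCut T).subset fun α h => h.1) ⟨α₀, hα₀, le_rfl⟩
  have hmin : ∀ β, N.IsTimeCut T β → N.cutCost α ≤ N.cutCost β := fun β hβ =>
    hαc.trans (hmin₀ β hβ)
  refine ⟨α, hα, hmin, fun x => ?_⟩
  by_cases hgood : ∃ y, (N.tightGraph α).Reachable x y ∧ (α y ∈ Θ ∨ α y - N.τ ∈ Θ)
  · obtain ⟨y, hy, hyΘ⟩ := hgood
    obtain ⟨p, hp⟩ := hy.exists_isPath
    obtain ⟨k, hk, he⟩ := N.tightGraph_walk α p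
    have h1 := hp.length_lt
    have h2 := N.tightGraph_path_length_le α hp
    rw [abs_le] at hk
    -- A path has at most n - 1 and at most m edges; the case α y - τ ∈ Θ adds one more multiple of
    -- τ.
    rcases hyΘ with h | h
    · exact ⟨_, h, k, abs_le.2 (by omega), abs_le.2 (by omega), he⟩
    · exact ⟨_, h, k + 1, abs_le.2 (by omega), abs_le.2 (by omega), by rw [he]; ring⟩
  · exfalso
    push Not at hgood
    set χ : V → ℤ := fun y => if (N.tightGraph α).Reachable x y then 1 else 0 with hχdef
    have hχ : ∀ y, χ y = 0 ∨ χ y = 1 := fun y => by simp only [hχdef]; split_ifs <;> simp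
    have hfree : ∀ y, χ y = 1 → α y ∉ Θ ∧ α y - N.τ ∉ Θ := by
      intro y hy
      refine hgood y ?_
      by_contra hr
      simp [hχdef, hr] at hy
    have hadj : ∀ y z, (N.tightGraph α).Adj y z → χ y = χ z := by
      intro y z h
      have : (N.tightGraph α).Reachable x y ↔ (N.tightGraph α).Reachable x z :=
        ⟨fun h1 => h1.trans h.reachable, fun h1 => h1.trans h.reachable.symm⟩
      simp only [hχdef, this]
    have hint : ∀ y, χ y = 1 → 0 < α y ∧ α y < T + 1 := by
      intro y hy
      have h1 : α y ≠ 0 := fun h => (hfree y hy).1 (h ▸ h0)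
      have h2 : α y ≠ T + 1 := fun h => (hfree y hy).1 (h ▸ hT)
      have := hα.nonneg y
      have := hα.le_horizon y
      omega
    have hs : χ N.s = 0 := (hχ _).resolve_right fun h => by
      have := (hint _ h).1; rw [hα.source] at this; omega
    have hd : χ N.d = 0 := (hχ _).resolve_right fun h => by
      have := (hint _ h).2; rw [hα.sink] at this; omega
    have hplus : N.IsTimeCut T fun y => α y + χ y := by
      refine ⟨fun y => ?_, fun y => ?_, by simp [hs, hα.source], by simp [hd, hα.sink]⟩
      · have := hα.nonneg y
        rcases hχ y with h | h <;> simp only [h] <;> omega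
      · have := hα.le_horizon y
        rcases hχ y with h | h
        · simp only [h]; omega
        · have := hint y h; simp only [h]; omega
    have hminus : N.IsTimeCut T fun y => α y - χ y := by
      refine ⟨fun y => ?_, fun y => ?_, by simp [hs, hα.source], by simp [hd, hα.sink]⟩
      · have := hα.nonneg y
        rcases hχ y with h | h
        · simp only [h]; omega
        · have := hint y h; simp only [h]; omega
      · have := hα.le_horizon y
        rcases hχ y with h | h <;> simp only [h] <;> omega
    have hsum := N.cutCost_shift h0 hT hΘ hα χ hχ hadj hfree
    have h1 := hmin _ hplus
    have h2 := hmin _ hminus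
    have h3 := hmax _ ⟨hplus, by linarith⟩
    have h4 := hmax _ ⟨hminus, by linarith⟩
    -- Parallelogram identity: the two shifted cuts have on average a larger sum of squares than
    -- `α`, although each is a minimum cut and hence bounded by `α`.
    have h5 : ∑ y, (α y + χ y) ^ 2 + ∑ y, (α y - χ y) ^ 2 = 2 * ∑ y, α y ^ 2 + 2 * ∑ y, χ y ^ 2 := by
      rw [← Finset.sum_add_distrib, Finset.mul_sum, Finset.mul_sum, ← Finset.sum_add_distrib]
      exact Finset.sum_congr rfl fun y _ => by ring
    have h6 : 0 < ∑ y, χ y ^ 2 := by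
      refine Finset.sum_pos' (fun y _ => sq_nonneg _) ⟨x, Finset.mem_univ x, ?_⟩
      simp [hχdef]
    linarith

end TemporalNetwork

/-! ## The time-expanded network -/

namespace TemporalNetwork

variable {V : Type*} (N : TemporalNetwork V) (T : ℕ)

/-- The edges of the time-expanded network: transit edges and holdover edges. -/
abbrev TENEdge : Type _ := (N.E × Fin (T + 1 - N.τ)) ⊕ (V × Fin T)

def tenSrc : N.TENEdge T → V × Fin (T + 1)
  | .inl e => (e.1.1.1, ⟨e.2, by omega⟩)
  | .inr h => (h.1, h.2.castSucc)

/-- Only departures up to T - τ are present, so `t + τ` is a valid copy; for τ > T the truncated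
subtraction leaves no transit edge at all. -/
def tenDst : N.TENEdge T → V × Fin (T + 1)
  | .inl e => (e.1.1.2, ⟨e.2 + N.τ, by omega⟩)
  | .inr h => (h.1, h.2.succ)

noncomputable def tenCap (e : N.E × Fin (T + 1 - N.τ)) : ℝ := N.u e.1 (e.2 : ℕ)

theorem tenCap_nonneg (e : N.E × Fin (T + 1 - N.τ)) : 0 ≤ N.tenCap T e := NNReal.coe_nonneg _

variable {N T} in
theorem sum_tenEdge_Ico (h : ℤ → ℝ) :
    ∑ t : Fin (T + 1 - N.τ), h (t : ℕ) = ∑ t ∈ Finset.Ico (0 : ℤ) (T + 1 - N.τ), h t := by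
  rw [Fin.sum_univ_eq_sum_range (fun t : ℕ => h t)]
  refine Finset.sum_nbij (fun t : ℕ => (t : ℤ)) ?_ ?_ ?_ ?_
  · intro t ht
    simp only [Finset.mem_range, Finset.mem_Ico] at ht ⊢
    omega
  · intro a _ b _ hab
    simpa using hab
  · intro t ht
    simp only [Finset.coe_Ico, Set.mem_Ico] at ht
    refine ⟨t.toNat, ?_, ?_⟩
    · simp only [Finset.coe_range, Set.mem_Iio]; omega
    · simp [ht.1]
  · intro t _; rfl

open Classical in
/-- The minimum cut of the time-expanded network is a cut over time. -/
theorem exists_tenFlow [Fintype V] :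
    ∃ g, IsMultiFlow (N.tenSrc T) (N.tenDst T)
        (Sum.elim (N.tenCap T) fun _ => ∑ e, N.tenCap T e + 1) (N.s, 0) (N.d, Fin.last T) g ∧
      ∃ α, N.IsTimeCut T α ∧ N.cutCost α ≤ netFlow (N.tenSrc T) (N.tenDst T) g (N.d, Fin.last T) := by
  -- The set of all copies of vertices other than the sink is closed under holdover edges; it
  -- certifies that a cut without them exists.
  obtain ⟨g, hg, S, hs, hd, hS, hval⟩ := exists_maxFlow_minCut_sum (N.tenSrc T) (N.tenDst T)
    (N.tenCap T) (N.tenCap_nonneg T) (s := (N.s, 0)) (t := (N.d, Fin.last T)) {p | p.1 ≠ N.d}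
    N.s_ne_d (by simp) (fun h hh => hh)
  refine ⟨g, hg, ?_⟩
  have hstep : ∀ (x : V) (a b : ℕ) (hb : b < T + 1) (hab : a ≤ b),
      (x, (⟨a, by omega⟩ : Fin (T + 1))) ∈ S → (x, (⟨b, hb⟩ : Fin (T + 1))) ∈ S := by
    intro x a b hb hab ha
    induction b, hab using Nat.le_induction with
    | base => exact ha
    | succ c hc ih => exact hS (x, ⟨c, by omega⟩) (ih (by omega) ha)
  -- Closedness under holdover edges turns `S` into a threshold over each vertex; the threshold is T
  -- + 1 when no copy lies in `S`.
  have hex : ∀ x, ∃ k : ℕ, k ≤ T + 1 ∧ ∀ (t : ℕ) (ht : t < T + 1),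
      (x, (⟨t, ht⟩ : Fin (T + 1))) ∈ S ↔ k ≤ t := by
    intro x
    by_cases h : ∃ t : ℕ, ∃ ht : t < T + 1, (x, (⟨t, ht⟩ : Fin (T + 1))) ∈ S
    · obtain ⟨ht, hm⟩ := Nat.find_spec h
      exact ⟨Nat.find h, ht.le, fun t ht' => ⟨fun hm' => Nat.find_min' h ⟨ht', hm'⟩,
        fun hle => hstep x _ _ ht' hle hm⟩⟩
    · push Not at h
      exact ⟨T + 1, le_rfl, fun t ht => ⟨fun hm => absurd hm (h t ht), fun hle => by omega⟩⟩
  choose κ hκ1 hκ2 using hex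
  refine ⟨fun x => κ x, ⟨fun x => by positivity, fun x => by exact_mod_cast hκ1 x, ?_, ?_⟩, ?_⟩
  · have := (hκ2 N.s 0 (by omega)).1 hs
    exact_mod_cast Nat.le_zero.1 this
  · have h1 := mt (hκ2 N.d T (by omega)).2 hd
    have h2 := hκ1 N.d
    push_cast [show κ N.d = T + 1 by omega]; rfl
  · rw [hval, cutCost, Fintype.sum_prod_type, ← Finset.sum_coe_sort]
    refine Finset.sum_le_sum fun e _ => ?_
    simp only [tenSrc, tenDst, tenCap, hκ2]
    have := sum_tenEdge_Ico (N := N) (T := T) fun t =>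
      if (κ e.1.1 : ℤ) ≤ t ∧ ¬ (κ e.1.2 : ℤ) ≤ t + N.τ then (N.u e t : ℝ) else 0
    have h2 : ∀ t : Fin (T + 1 - N.τ), (κ e.1.1 ≤ (t : ℕ) ∧ ¬ κ e.1.2 ≤ (t : ℕ) + N.τ) ↔
        ((κ e.1.1 : ℤ) ≤ (t : ℕ) ∧ ¬ (κ e.1.2 : ℤ) ≤ (t : ℕ) + N.τ) := by
      intro t; omega
    simp only [h2]
    rw [this, ← Finset.sum_filter]
    refine Finset.sum_le_sum_of_subset_of_nonneg ?_ fun _ _ _ => NNReal.coe_nonneg _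
    intro t ht
    have := hκ1 e.1.2
    simp only [Finset.mem_filter, Finset.mem_Ico] at ht ⊢
    omega

variable {N T}

open Classical in
/-- The flow over time that belongs to a flow in the time-expanded network. -/
noncomputable def flowOfTEN (g : N.TENEdge T → ℝ) (e : V × V) (t : ℤ) : ℝ :=
  if h : e ∈ N.E ∧ 0 ≤ t ∧ t.toNat < T + 1 - N.τ then g (.inl (⟨e, h.1⟩, ⟨t.toNat, h.2.2⟩)) else 0

open Classical in
theorem sum_flowOfTEN (g : N.TENEdge T → ℝ) (e : N.E) (b : ℤ) :
    ∑ t ∈ Finset.Icc (0 : ℤ) b, flowOfTEN g e t =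
      ∑ t : Fin (T + 1 - N.τ), if ((t : ℕ) : ℤ) ≤ b then g (.inl (e, t)) else 0 := by
  have h := sum_tenEdge_Ico (N := N) (T := T) fun t => if t ≤ b then flowOfTEN g e t else 0
  have h2 : ∀ t : Fin (T + 1 - N.τ), flowOfTEN g e ((t : ℕ) : ℤ) = g (.inl (e, t)) := by
    intro t
    rw [flowOfTEN, dif_pos ⟨e.2, by omega, by simp⟩]
    rfl
  simp only [h2] at h
  rw [h, ← Finset.sum_filter]
  symm
  refine Finset.sum_subset ?_ ?_
  · intro t ht
    simp only [Finset.mem_filter, Finset.mem_Ico, Finset.mem_Icc] at ht ⊢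
    omega
  · intro t ht ht'
    simp only [Finset.mem_filter, Finset.mem_Ico, Finset.mem_Icc] at ht ht'
    rw [flowOfTEN, dif_neg]
    rintro ⟨-, h0, h1⟩
    omega

-- Add up the balances of the copies of `i` at the times 0, …, b. The holdover edges telescope, and
-- only the one that leaves the copy at time b remains: it carries what is stored at `i`.
open Classical in
theorem netIn_flowOfTEN [Fintype V] (g : N.TENEdge T → ℝ) (i : V) (b : ℕ) :
    N.netIn (flowOfTEN g) i b =
      ∑ z ∈ Finset.univ.filter (fun z : V × Fin (T + 1) => z.1 = i ∧ (z.2 : ℕ) ≤ b), netFlow (N.tenSrc T) (N.tenDst T) g z +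
      ∑ t : Fin T, if (t : ℕ) = b then g (.inr (i, t)) else 0 := by
  rw [sum_netFlow, Fintype.sum_sum_type]
  have hinr : ∑ h : V × Fin T, ((if N.tenDst T (.inr h) ∈
        Finset.univ.filter (fun z : V × Fin (T + 1) => z.1 = i ∧ (z.2 : ℕ) ≤ b) then g (.inr h) else 0) -
        if N.tenSrc T (.inr h) ∈ Finset.univ.filter (fun z : V × Fin (T + 1) => z.1 = i ∧ (z.2 : ℕ) ≤ b) then g (.inr h) else 0) =
      - ∑ t : Fin T, if (t : ℕ) = b then g (.inr (i, t)) else 0 := by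
    rw [Fintype.sum_prod_type, Finset.sum_eq_single i, ← Finset.sum_neg_distrib]
    · refine Finset.sum_congr rfl fun t _ => ?_
      simp only [tenSrc, tenDst, Finset.mem_filter, Finset.mem_univ, true_and, Fin.val_succ, Fin.val_castSucc]
      rcases lt_trichotomy (t : ℕ) b with h | h | h
      · simp [show (t : ℕ) + 1 ≤ b by omega, h.le, h.ne]
      · simp [h]
      · simp [show ¬ (t : ℕ) + 1 ≤ b by omega, show ¬ (t : ℕ) ≤ b by omega, h.ne']
    · intro x _ hx
      refine Finset.sum_eq_zero fun t _ => ?_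
      simp [tenSrc, tenDst, hx]
    · simp
  rw [hinr, neg_add_cancel_right, netIn, Finset.sum_filter, Finset.sum_filter,
    ← Finset.sum_coe_sort N.E, ← Finset.sum_coe_sort N.E, ← Finset.sum_sub_distrib, Fintype.sum_prod_type]
  refine Finset.sum_congr rfl fun e _ => ?_
  rw [sum_flowOfTEN, sum_flowOfTEN, Finset.sum_sub_distrib]
  congr 1
  · by_cases h : e.1.2 = i
    · rw [if_pos h]
      refine Finset.sum_congr rfl fun t _ => ?_
      simp only [tenDst, Finset.mem_filter, Finset.mem_univ, true_and, h]
      exact if_congr (by omega) rfl rfl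
    · simp [tenDst, h]
  · by_cases h : e.1.1 = i
    · rw [if_pos h]
      refine Finset.sum_congr rfl fun t _ => ?_
      simp only [tenSrc, Finset.mem_filter, Finset.mem_univ, true_and, h]
      exact if_congr (by omega) rfl rfl
    · simp [tenSrc, h]

/-- Conservation at the copies makes the amount stored at `i` equal to the flow on a holdover edge,
hence nonnegative, and zero at time T, which no holdover edge leaves. At the sink at time T it is
the value instead; this is where `hv` enters. -/
theorem isFlowOverTime_flowOfTEN [Fintype V] {g : N.TENEdge T → ℝ} {M : ℝ}
    (hg : IsMultiFlow (N.tenSrc T) (N.tenDst T) (Sum.elim (N.tenCap T) fun _ => M) (N.s, 0)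
      (N.d, Fin.last T) g)
    (hv : 0 ≤ netFlow (N.tenSrc T) (N.tenDst T) g (N.d, Fin.last T)) :
    N.IsFlowOverTime T (flowOfTEN g) ∧
      N.netIn (flowOfTEN g) N.d T = netFlow (N.tenSrc T) (N.tenDst T) g (N.d, Fin.last T) := by
  classical
  have hnet : ∀ i ≠ N.s, ∀ b : ℕ, (i ≠ N.d ∨ b < T) →
      N.netIn (flowOfTEN g) i b = ∑ t : Fin T, if (t : ℕ) = b then g (.inr (i, t)) else 0 := by
    intro i hi b hib
    rw [netIn_flowOfTEN, Finset.sum_eq_zero, zero_add]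
    intro z hz
    simp only [Finset.mem_filter, Finset.mem_univ, true_and] at hz
    obtain ⟨rfl, ht⟩ := hz
    refine hg.conservation _ (fun h => hi (Prod.ext_iff.1 h).1) fun h => ?_
    rcases hib with h1 | h1
    · exact h1 (Prod.ext_iff.1 h).1
    · rw [h, Fin.val_last] at ht
      omega
  have hlast : ∀ i, (∑ t : Fin T, if (t : ℕ) = T then g (.inr (i, t)) else 0) = 0 := fun i =>
    Finset.sum_eq_zero fun t _ => if_neg (by omega)
  have hval : N.netIn (flowOfTEN g) N.d T =
      netFlow (N.tenSrc T) (N.tenDst T) g (N.d, Fin.last T) := by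
    rw [netIn_flowOfTEN, hlast, add_zero]
    refine Finset.sum_eq_single _ ?_ ?_
    · intro z hz hne
      rw [Finset.mem_filter] at hz
      exact hg.conservation _ (fun h => N.s_ne_d (by rw [← hz.2.1, h])) hne
    · simp
  refine ⟨⟨?_, ?_, ?_, ?_⟩, hval⟩
  · intro e _ t _
    rw [flowOfTEN]
    split_ifs
    exacts [hg.nonneg _, le_rfl]
  · intro e _ t _
    rw [flowOfTEN]
    split_ifs with h
    · refine (hg.le_capacity _).trans ?_
      simp [tenCap, h.2.1]
    · exact NNReal.coe_nonneg _
  · intro i hi t ht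
    rw [Finset.mem_Icc] at ht
    lift t to ℕ using ht.1
    by_cases hd : i = N.d ∧ t = T
    · rw [hd.1, hd.2, hval]; exact hv
    · rw [hnet i hi t (by by_cases h : i = N.d <;> [right; left] <;> [skip; exact h]
                          have := ht.2; have : t ≠ T := fun h' => hd ⟨h, h'⟩; omega)]
      exact Finset.sum_nonneg fun t _ => by split_ifs; exacts [hg.nonneg _, le_rfl]
  · intro i hi hd
    rw [hnet i hi T (.inl hd), hlast]

/-! ## The condensed network -/

theorem exists_mem_timeBlock {A : Finset ℤ} (h0 : (0 : ℤ) ∈ A) {r : ℤ} (hr0 : 0 ≤ r)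
    (hrT : r ≤ T) : ∃ a ∈ A, r ∈ timeBlock A T a := by
  have hne : (A.filter fun a => a ≤ r).Nonempty := ⟨0, by simp [h0, hr0]⟩
  have hm := Finset.max'_mem _ hne
  rw [Finset.mem_filter] at hm
  refine ⟨_, hm.1, ?_⟩
  rw [timeBlock, Finset.mem_filter, Finset.mem_Icc]
  refine ⟨⟨hm.2, hrT⟩, fun b hb hlt => ?_⟩
  by_contra hle
  exact absurd (Finset.le_max' (A.filter fun a => a ≤ r) b
    (Finset.mem_filter.2 ⟨hb, not_lt.1 hle⟩)) (not_le.2 hlt)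

theorem timeBlock_unique {A : Finset ℤ} {a b r : ℤ} (ha : a ∈ A) (hb : b ∈ A)
    (hra : r ∈ timeBlock A T a) (hrb : r ∈ timeBlock A T b) : a = b := by
  rw [timeBlock, Finset.mem_filter, Finset.mem_Icc] at hra hrb
  rcases lt_trichotomy a b with h | h | h
  · have := hra.2 b hb h; omega
  · exact h
  · have := hrb.2 a ha h; omega

open Classical in
/-- The condensed network carries the flow of the time-expanded network. -/
theorem mem_flowValues_cTEN [Fintype V] {A : Finset ℤ} (h0 : (0 : ℤ) ∈ A) (hT : (T : ℤ) ∈ A)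
    {g : N.TENEdge T → ℝ} {M : ℝ}
    (hg : IsMultiFlow (N.tenSrc T) (N.tenDst T) (Sum.elim (N.tenCap T) fun _ => M) (N.s, 0)
      (N.d, Fin.last T) g) :
    netFlow (N.tenSrc T) (N.tenDst T) g (N.d, Fin.last T) ∈ (N.cTEN A T h0 hT).flowValues := by
  have hex : ∀ t : Fin (T + 1), ∃ a : A, ((t : ℕ) : ℤ) ∈ timeBlock A T a := fun t => by
    obtain ⟨a, ha, h⟩ := exists_mem_timeBlock (T := T) h0 (r := ((t : ℕ) : ℤ)) (by omega) (by omega)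
    exact ⟨⟨a, ha⟩, h⟩
  choose blk hblk using hex
  have hblk_eq : ∀ (t : Fin (T + 1)) (a : A), ((t : ℕ) : ℤ) ∈ timeBlock A T a → blk t = a :=
    fun t a h => Subtype.ext (timeBlock_unique (blk t).2 a.2 (hblk t) h)
  have hblk0 : blk 0 = ⟨0, h0⟩ := by
    refine hblk_eq _ _ ?_
    rw [timeBlock, Finset.mem_filter, Finset.mem_Icc]
    exact ⟨⟨by simp, by simp⟩, fun b _ h => by simpa using h⟩
  have hblkT : blk (Fin.last T) = ⟨T, hT⟩ := by
    refine hblk_eq _ _ ?_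
    rw [timeBlock, Finset.mem_filter, Finset.mem_Icc]
    exact ⟨⟨by simp, by simp⟩, fun b _ h => by simpa using h⟩
  -- The map `π` contracts every block of copies of a vertex to one node.
  set π : V × Fin (T + 1) → V × A := fun z => (z.1, blk z.2) with hπ
  -- Holdover edges inside a block become loops, for which the condensed network need not have
  -- capacity. They are dropped; transit loops are kept, since they do have capacity.
  set g' : N.TENEdge T → ℝ := fun e => if π (N.tenSrc T e) = π (N.tenDst T e) ∧ e.isRight then 0
    else g e with hg'
  have hnet : ∀ w, netFlow (fun e => π (N.tenSrc T e)) (fun e => π (N.tenDst T e)) g' w =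
      ∑ z with π z = w, netFlow (N.tenSrc T) (N.tenDst T) g z := by
    intro w
    rw [sum_netFlow, netFlow]
    refine Finset.sum_congr rfl fun e _ => ?_
    simp only [Finset.mem_filter, Finset.mem_univ, true_and, hg']
    by_cases h : π (N.tenSrc T e) = π (N.tenDst T e)
    · simp [h]
    · simp [h]
  have hfib : ∀ w : V × A, w ≠ (N.s, ⟨0, h0⟩) → ∀ z, π z = w → z ≠ (N.s, 0) := by
    rintro w hw z hz rfl
    exact hw (by rw [← hz, hπ]; simp [hblk0])
  have hval : netFlow (fun e => π (N.tenSrc T e)) (fun e => π (N.tenDst T e)) g'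
      (N.d, ⟨T, hT⟩) = netFlow (N.tenSrc T) (N.tenDst T) g (N.d, Fin.last T) := by
    rw [hnet]
    refine Finset.sum_eq_single _ ?_ ?_
    · intro z hz hne
      rw [Finset.mem_filter] at hz
      exact hg.conservation z (hfib _ (fun h => N.s_ne_d (Prod.ext_iff.1 h).1.symm) z hz.2) hne
    · intro h
      exact absurd (by simp [hπ, hblkT]) h
  rw [← hval]
  have hcapSum : ∀ p : (V × A) × (V × A),
      ENNReal.ofReal (∑ e, if (π (N.tenSrc T e), π (N.tenDst T e)) = p then g' e else 0) ≤
        N.condensedCap A T p.1 p.2 := by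
    intro p
    by_cases hp : p.1.1 = p.2.1 ∧ (p.1.2 : ℤ) < p.2.2 ∧
        ∀ c ∈ A, (p.1.2 : ℤ) < c → (p.2.2 : ℤ) ≤ c
    · rw [condensedCap, if_pos hp]; simp
    rw [Fintype.sum_sum_type]
    have hinr : ∑ h : V × Fin T, (if (π (N.tenSrc T (.inr h)), π (N.tenDst T (.inr h))) = p
        then g' (.inr h) else 0) = 0 := by
      refine Finset.sum_eq_zero fun h _ => ?_
      split_ifs with heq
      · simp only [hg']
        refine if_pos ⟨?_, rfl⟩
        by_contra hne
        -- A holdover edge advances the time by one, so two different blocks that it joins are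
        -- consecutive, which `hp` rules out.
        apply hp
        have hb1 := hblk h.2.castSucc
        have hb2 := hblk h.2.succ
        rw [← heq]
        rw [timeBlock, Finset.mem_filter, Finset.mem_Icc] at hb1 hb2
        simp only [Fin.val_succ, Fin.val_castSucc, Nat.cast_add, Nat.cast_one] at hb1 hb2
        have hlt : ((blk h.2.castSucc : A) : ℤ) < blk h.2.succ := by
          rcases lt_trichotomy ((blk h.2.castSucc : A) : ℤ) (blk h.2.succ) with h1 | h1 | h1
          · exact h1
          · exact absurd (by simp [hπ, tenSrc, tenDst, Subtype.ext h1]) hne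
          · have := hb2.2 _ (blk h.2.castSucc).2 h1; omega
        refine ⟨rfl, hlt, fun c hc hlt' => ?_⟩
        have h3 := hb1.2 c hc hlt'
        by_contra hcon
        have h4 : c < ((blk h.2.succ : A) : ℤ) := not_le.1 hcon
        have := hb1.2 _ (blk h.2.succ).2 hlt
        omega
      · rfl
    rw [hinr, add_zero, condensedCap, if_neg hp, zero_add]
    by_cases hE : (p.1.1, p.2.1) ∈ N.E
    · rw [if_pos hE, ← ENNReal.ofNNReal_finsetSum, ← ENNReal.ofReal_coe_nnreal]
      refine ENNReal.ofReal_le_ofReal ?_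
      rw [Fintype.sum_prod_type, Finset.sum_eq_single ⟨_, hE⟩]
      · push_cast
        have := sum_tenEdge_Ico (N := N) (T := T) fun t =>
          if t ∈ timeBlock A T p.1.2 ∧ t + N.τ ∈ timeBlock A T p.2.2 then
            (N.u (p.1.1, p.2.1) t : ℝ) else 0
        refine le_trans (Finset.sum_le_sum fun t _ => ?_) (this.trans_le ?_)
        · split_ifs with h1 h2 h2
          · simp only [hg']
            simpa [tenCap] using hg.le_capacity (.inl (⟨_, hE⟩, t))
          · refine absurd ?_ h2
            have h3 := hblk (N.tenSrc T (.inl (⟨(p.1.1, p.2.1), hE⟩, t))).2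
            have h4 := hblk (N.tenDst T (.inl (⟨(p.1.1, p.2.1), hE⟩, t))).2
            have h5 : blk (N.tenSrc T (.inl (⟨(p.1.1, p.2.1), hE⟩, t))).2 = p.1.2 :=
              congrArg (fun q => q.1.2) h1
            have h6 : blk (N.tenDst T (.inl (⟨(p.1.1, p.2.1), hE⟩, t))).2 = p.2.2 :=
              congrArg (fun q => q.2.2) h1
            rw [h5] at h3
            rw [h6] at h4
            exact ⟨h3, by simpa [tenDst] using h4⟩
          · exact NNReal.coe_nonneg _
          · exact le_rfl
        · rw [← Finset.sum_filter]
          refine Finset.sum_le_sum_of_subset_of_nonneg ?_ fun _ _ _ => NNReal.coe_nonneg _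
          intro t ht
          rw [Finset.mem_filter] at ht ⊢
          exact ht.2
      · intro e _ hne
        refine Finset.sum_eq_zero fun t _ => if_neg fun h => hne (Subtype.ext ?_)
        exact congrArg (fun q => (q.1.1, q.2.1)) h
      · simp
    · rw [if_neg hE, Finset.sum_eq_zero]
      · simp
      · intro e _
        refine if_neg fun h => hE ?_
        rw [← h]
        exact e.1.2
  have hg'0 : ∀ e, 0 ≤ g' e := by
    intro e
    simp only [hg']
    split_ifs
    exacts [le_rfl, hg.nonneg e]
  refine FlowNetwork.mem_flowValues_of_multiFlow g' (N.cTEN A T h0 hT) hg'0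
    (fun p => by convert hcapSum p; rfl) ?_ ?_
  · intro p hp e he
    have h1 : N.condensedCap A T p.1 p.2 = 0 := by
      by_contra hne
      exact hp (by simp [cTEN, hne])
    have h2 := hcapSum p
    -- A missing edge is one of capacity zero, so the capacity bound already forces the flow on it
    -- to vanish.
    rw [h1, nonpos_iff_eq_zero, ENNReal.ofReal_eq_zero] at h2
    have h3 := Finset.single_le_sum (f := fun e => if (π (N.tenSrc T e), π (N.tenDst T e)) = p
      then g' e else 0) (fun i _ => by show (0 : ℝ) ≤ ite _ _ _; split_ifs; exacts [hg'0 i, le_rfl])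
      (Finset.mem_univ e)
    simp only [he, if_true] at h3
    exact le_antisymm (h3.trans h2) (hg'0 e)
  · intro w hws hwd
    rw [hnet]
    refine Finset.sum_eq_zero fun z hz => ?_
    rw [Finset.mem_filter] at hz
    refine hg.conservation z (hfib w hws z hz.2) ?_
    rintro rfl
    exact hwd (by rw [← hz.2, hπ]; simp [hblkT, cTEN])

-- With thresholds at block starts, the set of nodes (x, a) with α x ≤ a is left by no chain edge. A
-- time r counted by a crossing pair of blocks satisfies α x ≤ r and r + τ < α y, the latter because
-- the block of r + τ starts before α y and α y is itself a block start or T + 1. Each r belongs to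
-- only one pair of blocks.
open Classical in
theorem flow_cTEN_le_cutCost [Fintype V] {A : Finset ℤ} (h0 : (0 : ℤ) ∈ A) (hT : (T : ℤ) ∈ A)
    {α : V → ℤ} (hα : N.IsTimeCut T α) (hαA : ∀ x, α x ∈ A ∨ α x = T + 1)
    {v : ℝ} (hv : v ∈ (N.cTEN A T h0 hT).flowValues) : v ≤ N.cutCost α := by
  obtain ⟨f, hf, rfl⟩ := hv
  refine FlowNetwork.flow_value_le_cut hf {p | α p.1 ≤ p.2} (by simp [cTEN, hα.source])
    (by simp [cTEN, hα.sink]) _ (N.cutCost_nonneg α) ?_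
  have hcut : N.cutCost α = ((∑ e ∈ N.E, ∑ t ∈ Finset.Ico (α e.1) (α e.2 - N.τ), N.u e t : ℝ≥0) : ℝ) := by
    simp [cutCost]
  rw [hcut, ENNReal.ofReal_coe_nnreal]
  set D : A × A → Finset ℤ := fun ab =>
    (timeBlock A T ab.1).filter fun r => r + N.τ ∈ timeBlock A T ab.2 with hD
  set X : V × V → Finset (A × A) := fun e =>
    Finset.univ.filter fun ab => α e.1 ≤ ab.1 ∧ ¬ α e.2 ≤ ab.2 with hX
  have hone : ∀ e, ∑ ab ∈ X e, ∑ r ∈ D ab, N.u e r ≤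
      ∑ t ∈ Finset.Ico (α e.1) (α e.2 - N.τ), N.u e t := by
    intro e
    rw [← Finset.sum_biUnion]
    · refine Finset.sum_le_sum_of_subset fun r hr => ?_
      simp only [Finset.mem_biUnion, hX, hD, Finset.mem_filter, Finset.mem_univ, true_and,
        timeBlock, Finset.mem_Icc] at hr
      obtain ⟨ab, ⟨h1, h2⟩, ⟨⟨h3, h4⟩, h5⟩, ⟨⟨h6, h7⟩, h8⟩⟩ := hr
      rw [Finset.mem_Ico]
      refine ⟨by omega, ?_⟩
      rcases hαA e.2 with h | h
      · have := h8 _ h (by omega); omega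
      · omega
    · intro ab _ cd _ hne
      refine Finset.disjoint_left.2 fun r h1 h2 => hne ?_
      simp only [hD, Finset.mem_filter] at h1 h2
      exact Prod.ext (Subtype.ext (timeBlock_unique ab.1.2 cd.1.2 h1.1 h2.1))
        (Subtype.ext (timeBlock_unique ab.2.2 cd.2.2 h1.2 h2.2))
  calc _ ≤ ∑ e : (V × A) × (V × A), if α e.1.1 ≤ e.1.2 ∧ ¬ α e.2.1 ≤ e.2.2 then
          (if (e.1.1, e.2.1) ∈ N.E then ((∑ r ∈ D (e.1.2, e.2.2), N.u (e.1.1, e.2.1) r : ℝ≥0) : ℝ≥0∞)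
            else 0) else 0 := by
        rw [← Finset.sum_filter]
        refine (Finset.sum_le_sum ?_).trans (Finset.sum_le_sum_of_subset ?_)
        · intro e he
          rw [Finset.mem_filter] at he
          show N.condensedCap A T e.1 e.2 ≤ _
          have h1 : α e.1.1 ≤ e.1.2 := he.2.1
          have h2 : ¬ α e.2.1 ≤ e.2.2 := he.2.2
          rw [condensedCap, if_neg, zero_add]
          · push_cast; rfl
          · rintro ⟨h3, h4, -⟩
            rw [h3] at h1; omega
        · intro e he
          rw [Finset.mem_filter] at he
          exact Finset.mem_filter.2 ⟨Finset.mem_univ _, he.2⟩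
    _ = ∑ e : V × V, ∑ ab : A × A, if α e.1 ≤ ab.1 ∧ ¬ α e.2 ≤ ab.2 then
          (if e ∈ N.E then ((∑ r ∈ D ab, N.u e r : ℝ≥0) : ℝ≥0∞) else 0) else 0 := by
        rw [← Fintype.sum_prod_type']
        exact Fintype.sum_equiv (Equiv.prodProdProdComm V A V A) _ _ fun e => rfl
    _ = ∑ e ∈ N.E, ((∑ ab ∈ X e, ∑ r ∈ D ab, N.u e r : ℝ≥0) : ℝ≥0∞) := by
        rw [← Finset.sum_subset (Finset.subset_univ N.E)]
        · refine Finset.sum_congr rfl fun e he => ?_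
          simp only [he, if_true, hX]
          rw [← Finset.sum_filter]
          push_cast; rfl
        · intro e _ he
          simp [he]
    _ ≤ _ := by
        rw [ENNReal.ofNNReal_finsetSum]
        exact Finset.sum_le_sum fun e _ => ENNReal.coe_le_coe.2 (hone e)

variable (N T)

/-- The maximum value of a flow over time is the minimum cost of a cut over time. -/
theorem exists_isGreatest_flowValues [Fintype V] :
    ∃ v, IsGreatest (N.flowValues T) v ∧ (∃ α, N.IsTimeCut T α ∧ N.cutCost α = v) ∧
      ∀ (A : Finset ℤ) (h0 : (0 : ℤ) ∈ A) (hT : (T : ℤ) ∈ A),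
        v ∈ (N.cTEN A T h0 hT).flowValues := by
  obtain ⟨g, hg, α, hα, hle⟩ := N.exists_tenFlow T
  have h1 := isFlowOverTime_flowOfTEN hg ((N.cutCost_nonneg α).trans hle)
  have h2 := h1.1.value_le_cutCost hα
  rw [h1.2] at h2
  refine ⟨_, ⟨⟨_, h1.1, h1.2⟩, ?_⟩, ⟨α, hα, le_antisymm hle h2⟩,
    fun A h0 hT => mem_flowValues_cTEN h0 hT hg⟩
  rintro _ ⟨f, hf, rfl⟩
  exact (hf.value_le_cutCost hα).trans hle

/-- The condensed network never loses flow, whatever A is. Critical times are needed only for the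
upper bound, where a critical minimum cut is transferred. -/
theorem exists_isGreatest_critCTEN [Fintype V] :
    ∃ v : ℝ, IsGreatest (N.flowValues T) v ∧ IsGreatest (N.critCTEN T).flowValues v := by
  obtain ⟨v, hv, ⟨α₀, hα₀, hαv⟩, hmem⟩ := N.exists_isGreatest_flowValues T
  refine ⟨v, hv, hmem _ _ _, fun w hw => ?_⟩
  obtain ⟨α, hα, hmin, hcrit⟩ := N.exists_critical_cut (T := T) (Θ := N.changeTimes T)
    (by simp [changeTimes]) (by simp [changeTimes])
    (fun e he t _ _ hne => .inl ⟨e, he, hne⟩)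
  refine (flow_cTEN_le_cutCost _ _ hα (fun x => ?_) hw).trans ((hmin α₀ hα₀).trans_eq hαv)
  by_cases hx : α x = T + 1
  · exact .inr hx
  left
  have h0 := hα.nonneg x
  have h1 := hα.le_horizon x
  simp only [critTimes, Finset.mem_filter, Finset.mem_Icc]
  refine ⟨⟨h0, by omega⟩, ?_⟩
  obtain ⟨θ, hθ, l, hl, -, he⟩ := hcrit x
  refine ⟨θ, hθ, l.natAbs, by rw [Int.abs_eq_natAbs] at hl; omega, ?_⟩
  rcases Int.natAbs_eq l with h | h
  · left; rw [he, ← h]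
  · right; rw [he]; nth_rw 1 [h]; ring

end TemporalNetwork

/-! ## The size of the condensed network -/

namespace TemporalNetwork

variable {V : Type*} (N : TemporalNetwork V) (T : ℕ)

/-- An edge with μ_e pieces has at most μ_e - 1 changes. Keeping the saved m on the left gives at
most 3μ times when there is an edge, in spite of the three additional times. -/
theorem exists_finset_changeTimes {μ : V × V → ℕ} (hμ : ∀ e ∈ N.E, HasAtMostPieces (N.u e) (μ e)) :
    ∃ F : Finset ℤ, N.changeTimes T ⊆ F ∧ F.card + N.E.card ≤ ∑ e ∈ N.E, μ e + 3 := by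
  classical
  have hfin : ∀ e ∈ N.E, ∃ C : Finset ℤ, {t : ℤ | N.u e t ≠ N.u e (t - 1)} ⊆ C ∧
      C.card + 1 ≤ μ e := by
    intro e he
    have h := hμ e he
    rw [HasAtMostPieces] at h
    have hf : {t : ℤ | N.u e t ≠ N.u e (t - 1)}.Finite := by
      refine Set.finite_of_encard_le_coe (k := μ e) (le_trans le_self_add h)
    refine ⟨hf.toFinset, by simp, ?_⟩
    rw [hf.encard_eq_coe_toFinset_card] at h
    exact_mod_cast h
  choose! C hC1 hC2 using hfin
  refine ⟨N.E.biUnion C ∪ {0, (T : ℤ), (T : ℤ) + 1}, ?_, ?_⟩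
  · rintro t (⟨e, he, hne⟩ | ht)
    · simp only [Finset.coe_union, Finset.coe_biUnion, Set.mem_union, Set.mem_iUnion]
      exact .inl ⟨e, he, hC1 e he hne⟩
    · simp only [Finset.coe_union, Set.mem_union]
      right
      simpa using ht
  · have h1 := Finset.card_union_le (N.E.biUnion C) {0, (T : ℤ), (T : ℤ) + 1}
    have h2 : ({0, (T : ℤ), (T : ℤ) + 1} : Finset ℤ).card ≤ 3 := Finset.card_le_three
    have h3 := Finset.card_biUnion_le (s := N.E) (t := C)
    have h4 : ∑ e ∈ N.E, ((C e).card + 1) ≤ ∑ e ∈ N.E, μ e := Finset.sum_le_sum hC2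
    rw [Finset.sum_add_distrib, Finset.sum_const, smul_eq_mul, mul_one] at h4
    omega

variable [Fintype V]

theorem card_critTimes_le {μ : V × V → ℕ} (hμ : ∀ e ∈ N.E, HasAtMostPieces (N.u e) (μ e))
    (hE : N.E.Nonempty) :
    (N.critTimes T).card ≤ 9 * (Fintype.card V * ∑ e ∈ N.E, μ e) := by
  classical
  obtain ⟨F, hF1, hF2⟩ := N.exists_finset_changeTimes T hμ
  have hsub : N.critTimes T ⊆ (F ×ˢ Finset.Icc (-(Fintype.card V : ℤ)) (Fintype.card V)).image
      fun p => p.1 + p.2 * N.τ := by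
    intro t ht
    simp only [critTimes, Finset.mem_filter] at ht
    obtain ⟨θ, hθ, l, hl, h⟩ := ht.2
    simp only [Finset.mem_image, Finset.mem_product, Finset.mem_Icc, Prod.exists]
    rcases h with h | h
    · exact ⟨θ, l, ⟨hF1 hθ, by omega, by omega⟩, h.symm⟩
    · exact ⟨θ, -l, ⟨hF1 hθ, by omega, by omega⟩, by rw [h]; ring⟩
  have h1 := (Finset.card_le_card hsub).trans Finset.card_image_le
  rw [Finset.card_product, Int.card_Icc] at h1
  have h2 : ((Fintype.card V : ℤ) + 1 - -(Fintype.card V : ℤ)).toNat = 2 * Fintype.card V + 1 := by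
    omega
  rw [h2] at h1
  have h3 : 1 ≤ Fintype.card V := Fintype.card_pos_iff.2 ⟨N.s⟩
  have h4 : 1 ≤ N.E.card := hE.card_pos
  have h5 : N.E.card ≤ ∑ e ∈ N.E, μ e := by
    rw [Finset.card_eq_sum_ones]
    refine Finset.sum_le_sum fun e he => ?_
    have := hμ e he
    rw [HasAtMostPieces] at this
    exact_mod_cast le_trans le_add_self this
  generalize ∑ e ∈ N.E, μ e = M at *
  calc (N.critTimes T).card ≤ F.card * (2 * Fintype.card V + 1) := h1
    _ ≤ (3 * M) * (3 * Fintype.card V) := Nat.mul_le_mul (by omega) (by omega)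
    _ = _ := by ring

-- If some departure in block a arrives in block b, the earliest one is at time max(a, b - τ). This
-- time determines both blocks and lies in A ∪ (A - τ).
variable {T} in
theorem card_staircase_le (A : Finset ℤ) (τ : ℕ) :
    (Finset.univ.filter fun ab : A × A =>
      ((timeBlock A T ab.1).filter fun r => r + (τ : ℤ) ∈ timeBlock A T ab.2).Nonempty).card ≤
      2 * A.card := by
  classical
  have hmem : ∀ ab ∈ Finset.univ.filter (fun ab : A × A =>
      ((timeBlock A T ab.1).filter fun r => r + (τ : ℤ) ∈ timeBlock A T ab.2).Nonempty),
      max (ab.1 : ℤ) (ab.2 - τ) ∈ timeBlock A T ab.1 ∧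
        max (ab.1 : ℤ) (ab.2 - τ) + τ ∈ timeBlock A T ab.2 := by
    intro ab hab
    obtain ⟨r, hr⟩ := (Finset.mem_filter.1 hab).2
    simp only [timeBlock, Finset.mem_filter, Finset.mem_Icc] at hr ⊢
    obtain ⟨⟨⟨h1, h2⟩, h3⟩, ⟨h4, h5⟩, h6⟩ := hr
    refine ⟨⟨⟨le_max_left _ _, by omega⟩, fun b hb h => ?_⟩, ⟨by omega, by omega⟩,
      fun b hb h => ?_⟩
    · have := h3 b hb h; omega
    · have := h6 b hb h; omega
  calc _ ≤ (A ∪ A.image fun a => a - τ).card := by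
        refine Finset.card_le_card_of_injOn (fun ab => max (ab.1 : ℤ) (ab.2 - τ)) ?_ ?_
        · intro ab _
          simp only [Finset.coe_union, Finset.coe_image, Set.mem_union, Finset.mem_coe,
            Set.mem_image]
          rcases max_choice (ab.1 : ℤ) (ab.2 - τ) with h | h
          · left; rw [h]; exact ab.1.2
          · right; rw [h]; exact ⟨_, ab.2.2, rfl⟩
        · intro ab hab cd hcd heq
          have h1 := hmem ab hab
          have h2 := hmem cd hcd
          simp only at heq
          rw [← heq] at h2
          exact Prod.ext (Subtype.ext (timeBlock_unique ab.1.2 cd.1.2 h1.1 h2.1))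
            (Subtype.ext (timeBlock_unique ab.2.2 cd.2.2 h1.2 h2.2))
    _ ≤ A.card + A.card := (Finset.card_union_le _ _).trans
        (Nat.add_le_add_left Finset.card_image_le _)
    _ = _ := by ring

theorem card_cTEN_edges_le {A : Finset ℤ} (h0 : (0 : ℤ) ∈ A) (hT : (T : ℤ) ∈ A) :
    (N.cTEN A T h0 hT).E.card ≤ Fintype.card V * A.card + N.E.card * (2 * A.card) := by
  classical
  set H : Finset ((V × A) × (V × A)) := Finset.univ.filter fun e =>
    e.1.1 = e.2.1 ∧ (e.1.2 : ℤ) < e.2.2 ∧ ∀ c ∈ A, (e.1.2 : ℤ) < c → (e.2.2 : ℤ) ≤ c with hH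
  set X : Finset (A × A) := Finset.univ.filter fun ab : A × A =>
      ((timeBlock A T ab.1).filter fun r => r + (N.τ : ℤ) ∈ timeBlock A T ab.2).Nonempty with hX
  have hsub : (N.cTEN A T h0 hT).E ⊆
      H ∪ (N.E ×ˢ X).image fun p => ((p.1.1, p.2.1), (p.1.2, p.2.2)) := by
    intro e he
    have hne : N.condensedCap A T e.1 e.2 ≠ 0 := by simpa [cTEN] using he
    rw [Finset.mem_union]
    by_cases hh : e ∈ H
    · exact .inl hh
    right
    rw [condensedCap, if_neg (by simpa [hH] using hh), zero_add] at hne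
    split_ifs at hne with hE
    · rw [Finset.mem_image]
      refine ⟨((e.1.1, e.2.1), (e.1.2, e.2.2)), ?_, rfl⟩
      rw [Finset.mem_product]
      refine ⟨hE, ?_⟩
      rw [hX, Finset.mem_filter]
      refine ⟨Finset.mem_univ _, ?_⟩
      by_contra hemp
      rw [Finset.not_nonempty_iff_eq_empty] at hemp
      apply hne
      convert Finset.sum_empty
    · exact absurd rfl hne
  have hHcard : H.card ≤ Fintype.card V * A.card := by
    calc H.card ≤ (Finset.univ : Finset (V × A)).card := by
          refine Finset.card_le_card_of_injOn (fun e => e.1) (fun _ _ => Finset.mem_coe.2 (Finset.mem_univ _)) ?_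
          intro e he e' he' heq
          have h1 := (Finset.mem_filter.1 he).2
          have h2 := (Finset.mem_filter.1 he').2
          have heq' : e.1 = e'.1 := heq
          rw [← heq'] at h2
          have h3 := h1.2.2 _ e'.2.2.2 h2.2.1
          have h4 := h2.2.2 _ e.2.2.2 h1.2.1
          exact Prod.ext heq (Prod.ext (h1.1.symm.trans h2.1) (Subtype.ext (le_antisymm h3 h4)))
      _ = _ := by rw [Finset.card_univ, Fintype.card_prod, Fintype.card_coe]
  calc _ ≤ _ := Finset.card_le_card hsub
    _ ≤ _ := Finset.card_union_le _ _
    _ ≤ _ := by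
        refine Nat.add_le_add hHcard (Finset.card_image_le.trans ?_)
        rw [Finset.card_product]
        exact Nat.mul_le_mul_left _ (card_staircase_le A N.τ)

theorem card_le_two_mul_card_edges (h : ∀ x : V, ∃ e ∈ N.E, e.1 = x ∨ e.2 = x) :
    Fintype.card V ≤ 2 * N.E.card := by
  classical
  have hsub : (Finset.univ : Finset V) ⊆ N.E.image Prod.fst ∪ N.E.image Prod.snd := by
    intro x _
    obtain ⟨e, he, h | h⟩ := h x
    · exact Finset.mem_union_left _ (Finset.mem_image.2 ⟨e, he, h⟩)
    · exact Finset.mem_union_right _ (Finset.mem_image.2 ⟨e, he, h⟩)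
  have h1 := (Finset.card_le_card hsub).trans (Finset.card_union_le _ _)
  have h2 : (N.E.image Prod.fst).card ≤ N.E.card := Finset.card_image_le
  have h3 : (N.E.image Prod.snd).card ≤ N.E.card := Finset.card_image_le
  rw [Finset.card_univ] at h1
  omega

theorem card_critCTEN_le {K : ℕ} (hK : 36 ≤ K) {μ : V × V → ℕ}
    (hμ : ∀ e ∈ N.E, HasAtMostPieces (N.u e) (μ e)) (hE : N.E.Nonempty) :
    Fintype.card (V × N.critTimes T) ≤ K * (Fintype.card V ^ 2 * ∑ e ∈ N.E, μ e) ∧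
    (N.critCTEN T).E.card ≤ K * (Fintype.card V ^ 2 * ∑ e ∈ N.E, μ e +
      Fintype.card V * N.E.card * ∑ e ∈ N.E, μ e) ∧
    ((∀ x : V, ∃ e ∈ N.E, e.1 = x ∨ e.2 = x) →
      (N.critCTEN T).E.card ≤ K * (Fintype.card V * N.E.card * ∑ e ∈ N.E, μ e)) := by
  have h1 := N.card_critTimes_le T hμ hE
  have h2 := N.card_cTEN_edges_le T (N.zero_mem_critTimes T) (N.horizon_mem_critTimes T)
  have h3 := N.card_le_two_mul_card_edges
  rw [Fintype.card_prod, Fintype.card_coe, critCTEN]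
  generalize (N.cTEN _ T _ _).E.card = r at *
  generalize (N.critTimes T).card = k at *
  generalize Fintype.card V = n at *
  generalize N.E.card = m at *
  generalize ∑ e ∈ N.E, μ e = M at *
  have h4 : n * k ≤ 9 * (n ^ 2 * M) := (Nat.mul_le_mul_left n h1).trans_eq (by ring)
  have h5 : m * (2 * k) ≤ 18 * (n * m * M) :=
    (Nat.mul_le_mul_left m (Nat.mul_le_mul_left 2 h1)).trans_eq (by ring)
  refine ⟨h4.trans (Nat.mul_le_mul_right _ (by omega)), ?_, fun h => ?_⟩
  · refine (h2.trans (Nat.add_le_add h4 h5)).trans ?_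
    rw [mul_add]
    exact Nat.add_le_add (Nat.mul_le_mul_right _ (by omega)) (Nat.mul_le_mul_right _ (by omega))
  · have h6 : n ^ 2 * M ≤ 2 * (n * m * M) := by
      calc n ^ 2 * M = n * n * M := by ring
        _ ≤ n * (2 * m) * M := Nat.mul_le_mul_right _ (Nat.mul_le_mul_left _ (h3 h))
        _ = _ := by ring
    -- Chain edges give 9 n² M ≤ 18 nmM since n ≤ 2m, and transit edges give another 18 nmM.
    calc r ≤ 36 * (n * m * M) := by omega
      _ ≤ _ := Nat.mul_le_mul_right _ hK

end TemporalNetwork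

/-! ## Reasoning about programs -/

/-! ### Relocation of a program -/

def IExpr.shift (B : ℕ) : IExpr → IExpr
  | .const c => .const c
  | .var x => .var (x + B)
  | .get a i => .get (a + B) (i.shift B)
  | .add e₁ e₂ => .add (e₁.shift B) (e₂.shift B)
  | .sub e₁ e₂ => .sub (e₁.shift B) (e₂.shift B)
  | .mul e₁ e₂ => .mul (e₁.shift B) (e₂.shift B)

def RExpr.shift (B : ℕ) : RExpr → RExpr
  | .ofInt e => .ofInt (e.shift B)
  | .var x => .var (x + B)
  | .get a i => .get (a + B) (i.shift B)
  | .add e₁ e₂ => .add (e₁.shift B) (e₂.shift B)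
  | .sub e₁ e₂ => .sub (e₁.shift B) (e₂.shift B)
  | .mul e₁ e₂ => .mul (e₁.shift B) (e₂.shift B)
  | .div e₁ e₂ => .div (e₁.shift B) (e₂.shift B)

def BExpr.shift (B : ℕ) : BExpr → BExpr
  | .leI e₁ e₂ => .leI (e₁.shift B) (e₂.shift B)
  | .leR e₁ e₂ => .leR (e₁.shift B) (e₂.shift B)
  | .not b => .not (b.shift B)
  | .and b₁ b₂ => .and (b₁.shift B) (b₂.shift B)

/-- The program `p` with all its variables and arrays moved by `B`. -/
def Prog.shift (B : ℕ) : Prog → Prog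
  | .skip => .skip
  | .setI x e => .setI (x + B) (e.shift B)
  | .setR x e => .setR (x + B) (e.shift B)
  | .putI a i e => .putI (a + B) (i.shift B) (e.shift B)
  | .putR a i e => .putR (a + B) (i.shift B) (e.shift B)
  | .seq p q => .seq (p.shift B) (q.shift B)
  | .ite b p q => .ite (b.shift B) (p.shift B) (q.shift B)
  | .loop b p => .loop (b.shift B) (p.shift B)

/-- The memory from the addresses `B` on. -/
def RAMState.view (B : ℕ) (σ : RAMState) : RAMState where
  intVar := fun x => σ.intVar (x + B)
  realVar := fun x => σ.realVar (x + B)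
  intArr := fun a => σ.intArr (a + B)
  realArr := fun a => σ.realArr (a + B)

theorem IExpr.eval_shift (B : ℕ) (σ : RAMState) (e : IExpr) :
    (e.shift B).eval σ = e.eval (σ.view B) := by
  induction e <;> simp_all [IExpr.shift, IExpr.eval, RAMState.view]

theorem IExpr.cost_shift (B : ℕ) (e : IExpr) : (e.shift B).cost = e.cost := by
  induction e <;> simp_all [IExpr.shift, IExpr.cost]

theorem RExpr.eval_shift (B : ℕ) (σ : RAMState) (e : RExpr) :
    (e.shift B).eval σ = e.eval (σ.view B) := by
  induction e <;> simp_all [RExpr.shift, RExpr.eval, IExpr.eval_shift] <;> simp [RAMState.view]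

theorem RExpr.cost_shift (B : ℕ) (e : RExpr) : (e.shift B).cost = e.cost := by
  induction e <;> simp_all [RExpr.shift, RExpr.cost, IExpr.cost_shift]

theorem BExpr.holds_shift (B : ℕ) (σ : RAMState) (b : BExpr) :
    (b.shift B).holds σ ↔ b.holds (σ.view B) := by
  induction b <;> simp_all [BExpr.shift, BExpr.holds, IExpr.eval_shift, RExpr.eval_shift]

theorem BExpr.cost_shift (B : ℕ) (b : BExpr) : (b.shift B).cost = b.cost := by
  induction b <;> simp_all [BExpr.shift, BExpr.cost, IExpr.cost_shift, RExpr.cost_shift]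

theorem update_comp_add {α : Type*} (B x : ℕ) (f : ℕ → α) (v : α) :
    (fun y => Function.update f (x + B) v (y + B)) = Function.update (fun y => f (y + B)) x v := by
  ext y
  simp [Function.update_apply]

/-- Relocation lets a given algorithm run on an input that is stored from address `B` on. The map
`RAMState.view` is a simulation that preserves the number of steps exactly. -/
theorem Exec.shift (B : ℕ) {p : Prog} {σ σ' : RAMState} {k : ℕ} (h : Exec p σ k σ') :
    ∀ ρ : RAMState, ρ.view B = σ → ∃ ρ', Exec (p.shift B) ρ k ρ' ∧ ρ'.view B = σ' := by
  induction h with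
  | skip σ => exact fun ρ hρ => ⟨ρ, .skip ρ, hρ⟩
  | setI σ x e =>
    rintro ρ rfl
    refine ⟨_, by rw [← e.cost_shift B]; exact .setI ρ (x + B) (e.shift B), ?_⟩
    simp [RAMState.view, update_comp_add, IExpr.eval_shift]
  | setR σ x e =>
    rintro ρ rfl
    refine ⟨_, by rw [← e.cost_shift B]; exact .setR ρ (x + B) (e.shift B), ?_⟩
    simp [RAMState.view, update_comp_add, RExpr.eval_shift]
  | putI σ a i e =>
    rintro ρ rfl
    refine ⟨_, by
      rw [← e.cost_shift B, ← i.cost_shift B]; exact .putI ρ (a + B) (i.shift B) (e.shift B), ?_⟩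
    simp [RAMState.view, update_comp_add, IExpr.eval_shift]
  | putR σ a i e =>
    rintro ρ rfl
    refine ⟨_, by
      rw [← e.cost_shift B, ← i.cost_shift B]; exact .putR ρ (a + B) (i.shift B) (e.shift B), ?_⟩
    simp [RAMState.view, update_comp_add, IExpr.eval_shift, RExpr.eval_shift]
  | seq _ _ ih₁ ih₂ =>
    intro ρ hρ
    obtain ⟨ρ₁, h₁, hρ₁⟩ := ih₁ ρ hρ
    obtain ⟨ρ₂, h₂, hρ₂⟩ := ih₂ ρ₁ hρ₁
    exact ⟨ρ₂, .seq h₁ h₂, hρ₂⟩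
  | @ite_true b _ _ _ _ _ hb _ ih =>
    rintro ρ rfl
    obtain ⟨ρ₁, h₁, hρ₁⟩ := ih ρ rfl
    refine ⟨ρ₁, ?_, hρ₁⟩
    rw [← b.cost_shift B]
    exact .ite_true ((BExpr.holds_shift B ρ b).2 hb) h₁
  | @ite_false b _ _ _ _ _ hb _ ih =>
    rintro ρ rfl
    obtain ⟨ρ₁, h₁, hρ₁⟩ := ih ρ rfl
    refine ⟨ρ₁, ?_, hρ₁⟩
    rw [← b.cost_shift B]
    exact .ite_false (mt (BExpr.holds_shift B ρ b).1 hb) h₁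
  | @loop_true b _ _ _ _ _ _ hb _ _ ih₁ ih₂ =>
    rintro ρ rfl
    obtain ⟨ρ₁, h₁, hρ₁⟩ := ih₁ ρ rfl
    obtain ⟨ρ₂, h₂, hρ₂⟩ := ih₂ ρ₁ hρ₁
    refine ⟨ρ₂, ?_, hρ₂⟩
    rw [← b.cost_shift B]
    exact .loop_true ((BExpr.holds_shift B ρ b).2 hb) h₁ h₂
  | @loop_false b _ _ hb =>
    rintro ρ rfl
    refine ⟨ρ, ?_, rfl⟩
    rw [← b.cost_shift B]
    exact .loop_false (mt (BExpr.holds_shift B ρ b).1 hb)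

/-! ### What a program may change -/

def Prog.intVarsSet : Prog → List ℕ
  | .setI x _ => [x]
  | .seq p q => p.intVarsSet ++ q.intVarsSet
  | .ite _ p q => p.intVarsSet ++ q.intVarsSet
  | .loop _ p => p.intVarsSet
  | _ => []

def Prog.realVarsSet : Prog → List ℕ
  | .setR x _ => [x]
  | .seq p q => p.realVarsSet ++ q.realVarsSet
  | .ite _ p q => p.realVarsSet ++ q.realVarsSet
  | .loop _ p => p.realVarsSet
  | _ => []

def Prog.intArrsSet : Prog → List ℕ
  | .putI a _ _ => [a]
  | .seq p q => p.intArrsSet ++ q.intArrsSet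
  | .ite _ p q => p.intArrsSet ++ q.intArrsSet
  | .loop _ p => p.intArrsSet
  | _ => []

def Prog.realArrsSet : Prog → List ℕ
  | .putR a _ _ => [a]
  | .seq p q => p.realArrsSet ++ q.realArrsSet
  | .ite _ p q => p.realArrsSet ++ q.realArrsSet
  | .loop _ p => p.realArrsSet
  | _ => []

/-- The memory that `p` does not write to agrees in the two states. -/
structure Prog.Frame (p : Prog) (σ σ' : RAMState) : Prop where
  intVar : ∀ x, x ∉ p.intVarsSet → σ'.intVar x = σ.intVar x
  realVar : ∀ x, x ∉ p.realVarsSet → σ'.realVar x = σ.realVar x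
  intArr : ∀ a, a ∉ p.intArrsSet → σ'.intArr a = σ.intArr a
  realArr : ∀ a, a ∉ p.realArrsSet → σ'.realArr a = σ.realArr a

/-- The syntactic lists of written variables and arrays carry all unaffected facts across a
subprogram, so that loop invariants need to mention only what changes. -/
theorem Exec.frame {p : Prog} {σ σ' : RAMState} {k : ℕ} (h : Exec p σ k σ') : p.Frame σ σ' := by
  induction h with
  | skip | loop_false => exact ⟨fun _ _ => rfl, fun _ _ => rfl, fun _ _ => rfl, fun _ _ => rfl⟩
  | setI | setR | putI | putR =>
    refine ⟨fun x hx => ?_, fun x hx => ?_, fun x hx => ?_, fun x hx => ?_⟩ <;>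
    simp_all [Prog.intVarsSet, Prog.realVarsSet, Prog.intArrsSet, Prog.realArrsSet]
  | seq _ _ ih₁ ih₂ =>
    refine ⟨fun x hx => ?_, fun x hx => ?_, fun x hx => ?_, fun x hx => ?_⟩
    · rw [Prog.intVarsSet, List.mem_append, not_or] at hx
      rw [ih₂.intVar x hx.2, ih₁.intVar x hx.1]
    · rw [Prog.realVarsSet, List.mem_append, not_or] at hx
      rw [ih₂.realVar x hx.2, ih₁.realVar x hx.1]
    · rw [Prog.intArrsSet, List.mem_append, not_or] at hx
      rw [ih₂.intArr x hx.2, ih₁.intArr x hx.1]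
    · rw [Prog.realArrsSet, List.mem_append, not_or] at hx
      rw [ih₂.realArr x hx.2, ih₁.realArr x hx.1]
  | ite_true _ _ ih | ite_false _ _ ih =>
    refine ⟨fun x hx => ih.intVar x ?_, fun x hx => ih.realVar x ?_, fun x hx => ih.intArr x ?_,
      fun x hx => ih.realArr x ?_⟩ <;>
    simp_all [Prog.intVarsSet, Prog.realVarsSet, Prog.intArrsSet, Prog.realArrsSet]
  | loop_true _ _ _ ih₁ ih₂ =>
    exact ⟨fun x hx => (ih₂.intVar x hx).trans (ih₁.intVar x hx),
      fun x hx => (ih₂.realVar x hx).trans (ih₁.realVar x hx),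
      fun x hx => (ih₂.intArr x hx).trans (ih₁.intArr x hx),
      fun x hx => (ih₂.realArr x hx).trans (ih₁.realArr x hx)⟩

/-! ### Total correctness with time bounds -/

/-- Started in `σ`, the program `p` halts after at most `c` steps in a state that satisfies `Q`. -/
def Prog.Run (p : Prog) (σ : RAMState) (c : ℕ) (Q : RAMState → Prop) : Prop :=
  ∃ k σ', Exec p σ k σ' ∧ k ≤ c ∧ Q σ'

namespace Prog.Run

variable {p q : Prog} {σ : RAMState} {c c' : ℕ} {Q Q' : RAMState → Prop}

theorem mono (h : p.Run σ c Q) (hc : c ≤ c') (hQ : ∀ σ', p.Frame σ σ' → Q σ' → Q' σ') :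
    p.Run σ c' Q' := by
  obtain ⟨k, σ', h1, h2, h3⟩ := h
  exact ⟨k, σ', h1, h2.trans hc, hQ σ' h1.frame h3⟩

theorem seq (h : p.Run σ c fun σ₁ => q.Run σ₁ c' Q) : (p.seq q).Run σ (c + c') Q := by
  obtain ⟨k, σ₁, h1, h2, k', σ₂, h3, h4, h5⟩ := h
  exact ⟨_, σ₂, .seq h1 h3, Nat.add_le_add h2 h4, h5⟩

/-- The rule for loops; the first argument of the invariant bounds the remaining time. -/
theorem loop {b : BExpr} (Inv : ℕ → RAMState → Prop)
    (hstep : ∀ v σ, Inv v σ → b.holds σ →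
      ∃ c, p.Run σ c fun σ' => ∃ v', v' + c + b.cost + 1 ≤ v ∧ Inv v' σ') :
    ∀ v σ, Inv v σ →
      (Prog.loop b p).Run σ (v + b.cost + 1) fun σ' => (∃ v', Inv v' σ') ∧ ¬ b.holds σ' := by
  intro v
  induction v using Nat.strong_induction_on with
  | _ v ih =>
    intro σ hσ
    by_cases hb : b.holds σ
    · obtain ⟨c, k, σ₁, h1, h2, v', h3, h4⟩ := hstep v σ hσ hb
      obtain ⟨k', σ₂, h5, h6, h7⟩ := ih v' (by omega) σ₁ h4
      exact ⟨_, σ₂, .loop_true hb h1 h5, by omega, h7⟩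
    · exact ⟨_, σ, .loop_false hb, by omega, ⟨v, hσ⟩, hb⟩

end Prog.Run

/-! ### Straight-line programs -/

def Prog.LoopFree : Prog → Prop
  | .seq p q => p.LoopFree ∧ q.LoopFree
  | .ite _ p q => p.LoopFree ∧ q.LoopFree
  | .loop _ _ => False
  | _ => True

/-- The value for loops is a placeholder; the bound is meant for programs that satisfy
`Prog.LoopFree`. -/
def Prog.maxCost : Prog → ℕ
  | .skip => 1
  | .setI _ e => e.cost + 1
  | .setR _ e => e.cost + 1
  | .putI _ i e => i.cost + e.cost + 1
  | .putR _ i e => i.cost + e.cost + 1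
  | .seq p q => p.maxCost + q.maxCost
  | .ite b p q => b.cost + 1 + max p.maxCost q.maxCost
  | .loop _ _ => 0

open Classical in
/-- The effect of a program without loops. -/
noncomputable def Prog.apply : Prog → RAMState → RAMState
  | .skip, σ => σ
  | .setI x e, σ => { σ with intVar := Function.update σ.intVar x (e.eval σ) }
  | .setR x e, σ => { σ with realVar := Function.update σ.realVar x (e.eval σ) }
  | .putI a i e, σ =>
    { σ with intArr := Function.update σ.intArr a
               (Function.update (σ.intArr a) (i.eval σ) (e.eval σ)) }
  | .putR a i e, σ =>
    { σ with realArr := Function.update σ.realArr a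
               (Function.update (σ.realArr a) (i.eval σ) (e.eval σ)) }
  | .seq p q, σ => q.apply (p.apply σ)
  | .ite b p q, σ => if b.holds σ then p.apply σ else q.apply σ
  | .loop _ _, σ => σ

theorem Prog.LoopFree.run {p : Prog} (hp : p.LoopFree) {σ : RAMState} {Q : RAMState → Prop}
    (hQ : Q (p.apply σ)) : p.Run σ p.maxCost Q := by
  suffices ∀ σ, p.Run σ p.maxCost fun σ' => σ' = p.apply σ from
    (this σ).mono le_rfl fun σ' _ h => h ▸ hQ
  clear hQ σ
  induction p with
  | skip => exact fun σ => ⟨_, _, .skip σ, le_rfl, rfl⟩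
  | setI x e => exact fun σ => ⟨_, _, .setI σ x e, le_rfl, rfl⟩
  | setR x e => exact fun σ => ⟨_, _, .setR σ x e, le_rfl, rfl⟩
  | putI a i e => exact fun σ => ⟨_, _, .putI σ a i e, le_rfl, rfl⟩
  | putR a i e => exact fun σ => ⟨_, _, .putR σ a i e, le_rfl, rfl⟩
  | seq p q ih₁ ih₂ =>
    intro σ
    refine Prog.Run.seq ((ih₁ hp.1 σ).mono le_rfl fun σ₁ _ h₁ => ?_)
    exact (ih₂ hp.2 σ₁).mono le_rfl fun σ₂ _ h₂ => by rw [h₂, h₁]; rfl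
  | ite b p q ih₁ ih₂ =>
    intro σ
    by_cases hb : b.holds σ
    · obtain ⟨k, σ', h1, h2, h3⟩ := ih₁ hp.1 σ
      refine ⟨_, σ', .ite_true hb h1, ?_, by rw [h3, Prog.apply, if_pos hb]⟩
      exact Nat.add_le_add_left (h2.trans (le_max_left _ _)) _
    · obtain ⟨k, σ', h1, h2, h3⟩ := ih₂ hp.2 σ
      refine ⟨_, σ', .ite_false hb h1, ?_, by rw [h3, Prog.apply, if_neg hb]⟩
      exact Nat.add_le_add_left (h2.trans (le_max_right _ _)) _
  | loop b p => exact absurd hp (by simp [Prog.LoopFree])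

theorem Prog.LoopFree.run_of_le {p : Prog} (hp : p.LoopFree) {σ : RAMState} {c : ℕ}
    {Q : RAMState → Prop} (hc : p.maxCost ≤ c) (hQ : Q (p.apply σ)) : p.Run σ c Q :=
  (hp.run hQ).mono hc fun _ _ h => h

theorem Prog.LoopFree.frame {p : Prog} (hp : p.LoopFree) (σ : RAMState) : p.Frame σ (p.apply σ) := by
  obtain ⟨k, σ', h1, -, h2⟩ := hp.run (σ := σ) (Q := fun σ' => σ' = p.apply σ) rfl
  exact h2 ▸ h1.frame

theorem Prog.Run.andThen {p q : Prog} {σ : RAMState} {c : ℕ} {Q₁ Q : RAMState → Prop} (c₁ c₂ : ℕ)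
    (hc : c₁ + c₂ ≤ c) (h₁ : p.Run σ c₁ Q₁)
    (h₂ : ∀ σ₁, p.Frame σ σ₁ → Q₁ σ₁ → q.Run σ₁ c₂ Q) : (p.seq q).Run σ c Q :=
  (Prog.Run.seq (h₁.mono le_rfl h₂)).mono hc fun _ _ h => h

theorem Prog.LoopFree.andThen {p q : Prog} (hp : p.LoopFree) {σ : RAMState} {c : ℕ}
    {Q : RAMState → Prop} (c₂ : ℕ) (hc : p.maxCost + c₂ ≤ c) (h : q.Run (p.apply σ) c₂ Q) :
    (p.seq q).Run σ c Q :=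
  (Prog.Run.seq (hp.run h)).mono hc fun _ _ h => h

/-! ### Lists in memory -/

theorem memOfList_natCast {α : Type*} [Zero α] (l : List α) (i : ℕ) :
    memOfList l (i : ℤ) = l.getD i 0 := by
  simp [memOfList]

/-- Cells past the end hold zeros, so appending is a single write, with equality of the entire
array. -/
theorem memOfList_append_singleton {α : Type*} [Zero α] (l : List α) (a : α) :
    memOfList (l ++ [a]) = Function.update (memOfList l) (l.length : ℤ) a := by
  funext i
  by_cases hi : i = l.length
  · subst hi
    rw [memOfList_natCast]; simp
  · rw [Function.update_of_ne hi, memOfList, memOfList]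
    split_ifs with h0
    · lift i to ℕ using h0
      have hi' : i ≠ l.length := fun h => hi (by rw [h])
      simp only [Int.toNat_natCast]
      rcases lt_or_gt_of_ne hi' with h | h
      · rw [List.getD_append _ _ _ _ h]
      · rw [List.getD_eq_default _ _ (by simp; omega), List.getD_eq_default _ _ h.le]
    · rfl

/-! ## Merging sorted arrays -/

theorem Prog.apply_ite_of_pos {b : BExpr} {p q : Prog} {σ : RAMState} (h : b.holds σ) :
    (Prog.ite b p q).apply σ = p.apply σ := if_pos h

theorem Prog.apply_ite_of_neg {b : BExpr} {p q : Prog} {σ : RAMState} (h : ¬ b.holds σ) :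
    (Prog.ite b p q).apply σ = q.apply σ := if_neg h

theorem apply_clampBelow (x : ℕ) (e : IExpr) (σ : RAMState) :
    (Prog.ite (.leI e (.var x)) .skip (.setI x e)).apply σ =
      { σ with intVar := Function.update σ.intVar x (max (e.eval σ) (σ.intVar x)) } := by
  by_cases h : e.eval σ ≤ σ.intVar x
  · rw [Prog.apply_ite_of_pos (b := .leI e (.var x)) (σ := σ) h, max_eq_right h, Function.update_eq_self, Prog.apply]
  · rw [Prog.apply_ite_of_neg (b := .leI e (.var x)) (σ := σ) h, max_eq_left (not_le.1 h).le, Prog.apply]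

theorem apply_clampAbove (x : ℕ) (e : IExpr) (σ : RAMState) :
    (Prog.ite (.leI (.var x) e) .skip (.setI x e)).apply σ =
      { σ with intVar := Function.update σ.intVar x (min (e.eval σ) (σ.intVar x)) } := by
  by_cases h : σ.intVar x ≤ e.eval σ
  · rw [Prog.apply_ite_of_pos (b := .leI (.var x) e) (σ := σ) h, min_eq_right h, Function.update_eq_self, Prog.apply]
  · rw [Prog.apply_ite_of_neg (b := .leI (.var x) e) (σ := σ) h, min_eq_left (not_le.1 h).le, Prog.apply]

/-- The point of `[0, T + 1]` next to `y`. -/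
def clip (T y : ℤ) : ℤ := min (T + 1) (max 0 y)

theorem clip_mono (T : ℤ) {x y : ℤ} (h : x ≤ y) : clip T x ≤ clip T y := by
  simp only [clip]; omega

theorem clip_of_mem {T y : ℤ} (h0 : 0 ≤ y) (h1 : y ≤ T + 1) : clip T y = y := by
  simp only [clip]; omega

/-- The cells `0, …, a - 1` contain a nondecreasing sequence in `[0, T + 1]`. -/
structure SortedArr (T a : ℤ) (X : ℤ → ℤ) : Prop where
  mono : ∀ p q, 0 ≤ p → p ≤ q → q < a → X p ≤ X q
  nonneg : ∀ p, 0 ≤ p → p < a → 0 ≤ X p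
  le_horizon : ∀ p, 0 ≤ p → p < a → X p ≤ T + 1

/-- The state of merging `A` (of length `a`) and `Y` (of length `b`) into `X` from the back, when
the entries up to `i` and `j` are left. -/
structure MergeInv (T a b : ℤ) (A Y X : ℤ → ℤ) (i j : ℤ) : Prop where
  i_ge : -1 ≤ i
  i_lt : i < a
  j_ge : -1 ≤ j
  j_lt : j < b
  keep : ∀ p, 0 ≤ p → p ≤ i → X p = A p
  mono : ∀ p q, i + j + 2 ≤ p → p ≤ q → q < a + b → X p ≤ X q
  nonneg : ∀ p, i + j + 2 ≤ p → p < a + b → 0 ≤ X p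
  le_horizon : ∀ p, i + j + 2 ≤ p → p < a + b → X p ≤ T + 1
  left_le : ∀ q p, 0 ≤ q → q ≤ i → i + j + 2 ≤ p → p < a + b → A q ≤ X p
  right_le : ∀ q p, 0 ≤ q → q ≤ j → i + j + 2 ≤ p → p < a + b → Y q ≤ X p
  left_mem : ∀ q, i < q → q < a → ∃ p, i + j + 2 ≤ p ∧ p < a + b ∧ X p = A q
  right_mem : ∀ q, j < q → q < b → ∃ p, i + j + 2 ≤ p ∧ p < a + b ∧ X p = Y q

namespace MergeInv

variable {T a b : ℤ} {A Y X : ℤ → ℤ} {i j : ℤ}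

/-- The larger of the two last remaining entries goes to the last free cell i + j + 1. Since j ≥ 0,
this cell lies beyond i, so merging in place never destroys an unread entry of the target. -/
theorem step_left (hA : SortedArr T a A) (hY : SortedArr T b Y) (h : MergeInv T a b A Y X i j)
    (hi : 0 ≤ i) (hj : 0 ≤ j) (hlt : Y j ≤ A i) :
    MergeInv T a b A Y (Function.update X (i + j + 1) (X i)) (i - 1) j := by
  have hXi := h.keep i hi le_rfl
  have hX : ∀ p, p ≠ i + j + 1 → Function.update X (i + j + 1) (X i) p = X p := fun p hp =>
    Function.update_of_ne hp _ _
  have hX' : Function.update X (i + j + 1) (X i) (i + j + 1) = A i := by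
    rw [Function.update_self, hXi]
  have hl := h.i_lt
  have hl' := h.j_lt
  refine ⟨by omega, by omega, by omega, by omega, ?_, ?_, ?_, ?_, ?_, ?_, ?_, ?_⟩
  · intro p h0 hp
    rw [hX p (by omega), h.keep p h0 (by omega)]
  · intro p q hp hpq hq
    by_cases h1 : p = i + j + 1
    · by_cases h2 : q = i + j + 1
      · rw [h1, h2]
      · rw [h1, hX', hX q h2]; exact h.left_le i q hi le_rfl (by omega) hq
    · rw [hX p h1, hX q (by omega)]; exact h.mono p q (by omega) hpq hq
  · intro p hp hq
    by_cases h1 : p = i + j + 1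
    · rw [h1, hX']; exact hA.nonneg i hi hl
    · rw [hX p h1]; exact h.nonneg p (by omega) hq
  · intro p hp hq
    by_cases h1 : p = i + j + 1
    · rw [h1, hX']; exact hA.le_horizon i hi hl
    · rw [hX p h1]; exact h.le_horizon p (by omega) hq
  · intro q p h0 hq hp hlt
    by_cases h1 : p = i + j + 1
    · rw [h1, hX']; exact hA.mono q i h0 (by omega) hl
    · rw [hX p h1]; exact h.left_le q p h0 (by omega) (by omega) hlt
  · intro q p h0 hq hp hlt'
    by_cases h1 : p = i + j + 1
    · rw [h1, hX']; exact (hY.mono q j h0 hq hl').trans hlt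
    · rw [hX p h1]; exact h.right_le q p h0 hq (by omega) hlt'
  · intro q hq hqa
    by_cases h1 : q = i
    · exact ⟨i + j + 1, by omega, by omega, by rw [hX', h1]⟩
    · obtain ⟨p, h2, h3, h4⟩ := h.left_mem q (by omega) hqa
      exact ⟨p, by omega, h3, by rw [hX p (by omega), h4]⟩
  · intro q hq hqb
    obtain ⟨p, h2, h3, h4⟩ := h.right_mem q hq hqb
    exact ⟨p, by omega, h3, by rw [hX p (by omega), h4]⟩

theorem step_right (hA : SortedArr T a A) (hY : SortedArr T b Y) (h : MergeInv T a b A Y X i j)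
    (hj : 0 ≤ j) (hle : 0 ≤ i → A i ≤ Y j) :
    MergeInv T a b A Y (Function.update X (i + j + 1) (Y j)) i (j - 1) := by
  have hX : ∀ p, p ≠ i + j + 1 → Function.update X (i + j + 1) (Y j) p = X p := fun p hp =>
    Function.update_of_ne hp _ _
  have hX' : Function.update X (i + j + 1) (Y j) (i + j + 1) = Y j := Function.update_self _ _ _
  have hl := h.i_lt
  have hl' := h.j_lt
  have hg := h.i_ge
  refine ⟨by omega, by omega, by omega, by omega, ?_, ?_, ?_, ?_, ?_, ?_, ?_, ?_⟩
  · intro p h0 hp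
    rw [hX p (by omega), h.keep p h0 (by omega)]
  · intro p q hp hpq hq
    by_cases h1 : p = i + j + 1
    · by_cases h2 : q = i + j + 1
      · rw [h1, h2]
      · rw [h1, hX', hX q h2]; exact h.right_le j q hj le_rfl (by omega) hq
    · rw [hX p h1, hX q (by omega)]; exact h.mono p q (by omega) hpq hq
  · intro p hp hq
    by_cases h1 : p = i + j + 1
    · rw [h1, hX']; exact hY.nonneg j hj hl'
    · rw [hX p h1]; exact h.nonneg p (by omega) hq
  · intro p hp hq
    by_cases h1 : p = i + j + 1
    · rw [h1, hX']; exact hY.le_horizon j hj hl'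
    · rw [hX p h1]; exact h.le_horizon p (by omega) hq
  · intro q p h0 hq hp hlt
    by_cases h1 : p = i + j + 1
    · rw [h1, hX']; exact (hA.mono q i h0 hq hl).trans (hle (by omega))
    · rw [hX p h1]; exact h.left_le q p h0 hq (by omega) hlt
  · intro q p h0 hq hp hlt'
    by_cases h1 : p = i + j + 1
    · rw [h1, hX']; exact hY.mono q j h0 (by omega) hl'
    · rw [hX p h1]; exact h.right_le q p h0 (by omega) (by omega) hlt'
  · intro q hq hqa
    obtain ⟨p, h2, h3, h4⟩ := h.left_mem q hq hqa
    exact ⟨p, by omega, h3, by rw [hX p (by omega), h4]⟩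
  · intro q hq hqb
    by_cases h1 : q = j
    · exact ⟨i + j + 1, by omega, by omega, by rw [hX', h1]⟩
    · obtain ⟨p, h2, h3, h4⟩ := h.right_mem q (by omega) hqb
      exact ⟨p, by omega, h3, by rw [hX p (by omega), h4]⟩

/-- Once the source is exhausted, the remaining entries of the target are already in their places.
-/
theorem finish (hA : SortedArr T a A) (h : MergeInv T a b A Y X i j) (hj : j < 0) :
    SortedArr T (a + b) X ∧ (∀ q, 0 ≤ q → q < a → ∃ p, 0 ≤ p ∧ p < a + b ∧ X p = A q) ∧
      ∀ q, 0 ≤ q → q < b → ∃ p, 0 ≤ p ∧ p < a + b ∧ X p = Y q := by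
  have hl := h.i_lt
  have hg := h.i_ge
  have hg' := h.j_ge
  have hl' := h.j_lt
  obtain rfl : j = -1 := by omega
  refine ⟨⟨?_, ?_, ?_⟩, ?_, ?_⟩
  · intro p q h0 hpq hq
    by_cases h1 : q ≤ i
    · rw [h.keep p h0 (by omega), h.keep q (by omega) h1]; exact hA.mono p q h0 hpq (by omega)
    · by_cases h2 : p ≤ i
      · rw [h.keep p h0 h2]; exact h.left_le p q h0 h2 (by omega) hq
      · exact h.mono p q (by omega) hpq hq
  · intro p h0 hp
    by_cases h1 : p ≤ i
    · rw [h.keep p h0 h1]; exact hA.nonneg p h0 (by omega)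
    · exact h.nonneg p (by omega) hp
  · intro p h0 hp
    by_cases h1 : p ≤ i
    · rw [h.keep p h0 h1]; exact hA.le_horizon p h0 (by omega)
    · exact h.le_horizon p (by omega) hp
  · intro q h0 hq
    by_cases h1 : q ≤ i
    · exact ⟨q, h0, by omega, h.keep q h0 h1⟩
    · obtain ⟨p, h2, h3, h4⟩ := h.left_mem q (by omega) hq
      exact ⟨p, by omega, h3, h4⟩
  · intro q h0 hq
    obtain ⟨p, h2, h3, h4⟩ := h.right_mem q (by omega) hq
    exact ⟨p, by omega, h3, h4⟩

end MergeInv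

/-- One step of a merge. The integer variables are `4`: `T`, `9`: first cell of the source,
`10`: length of the source, `11`: number added to the entries of the source, `12`: length of the
target, `13` and `14`: the last entries of target and source that are left, `16`: scratch. -/
def mergeStep (tgt src : ℕ) : Prog :=
  .seq (.setI 16 (.add (.get src (.add (.var 9) (.var 14))) (.var 11))) <|
  .seq (.ite (.leI (.const 0) (.var 16)) .skip (.setI 16 (.const 0))) <|
  .seq (.ite (.leI (.var 16) (.add (.var 4) (.const 1))) .skip
    (.setI 16 (.add (.var 4) (.const 1)))) <|
  .ite (.and (.leI (.const 0) (.var 13)) (.not (.leI (.get tgt (.var 13)) (.var 16))))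
    (.seq (.putI tgt (.add (.add (.var 13) (.var 14)) (.const 1)) (.get tgt (.var 13)))
      (.setI 13 (.sub (.var 13) (.const 1))))
    (.seq (.putI tgt (.add (.add (.var 13) (.var 14)) (.const 1)) (.var 16))
      (.setI 14 (.sub (.var 14) (.const 1))))

/-- Merge the array `src`, shifted and clipped, into the array `tgt`. -/
def mergeProg (tgt src : ℕ) : Prog :=
  .seq (.setI 13 (.sub (.var 12) (.const 1))) <|
  .seq (.setI 14 (.sub (.var 10) (.const 1))) <|
  .seq (.setI 12 (.add (.var 12) (.var 10))) <|
  .loop (.leI (.const 0) (.var 14)) (mergeStep tgt src)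

theorem mergeStep_loopFree (tgt src : ℕ) : (mergeStep tgt src).LoopFree := by
  simp [mergeStep, Prog.LoopFree]

theorem mergeStep_maxCost (tgt src : ℕ) : (mergeStep tgt src).maxCost = 45 := by
  simp [mergeStep, Prog.maxCost, IExpr.cost, BExpr.cost]

theorem mergeStep_apply {tgt src : ℕ} (σ : RAMState) (y : ℤ)
    (hy : y = clip (σ.intVar 4) (σ.intArr src (σ.intVar 9 + σ.intVar 14) + σ.intVar 11)) :
    (0 ≤ σ.intVar 13 ∧ y < σ.intArr tgt (σ.intVar 13) →
      ((mergeStep tgt src).apply σ).intVar 13 = σ.intVar 13 - 1 ∧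
      ((mergeStep tgt src).apply σ).intVar 14 = σ.intVar 14 ∧
      ((mergeStep tgt src).apply σ).intArr tgt = Function.update (σ.intArr tgt)
        (σ.intVar 13 + σ.intVar 14 + 1) (σ.intArr tgt (σ.intVar 13))) ∧
    (¬ (0 ≤ σ.intVar 13 ∧ y < σ.intArr tgt (σ.intVar 13)) →
      ((mergeStep tgt src).apply σ).intVar 13 = σ.intVar 13 ∧
      ((mergeStep tgt src).apply σ).intVar 14 = σ.intVar 14 - 1 ∧
      ((mergeStep tgt src).apply σ).intArr tgt = Function.update (σ.intArr tgt)
        (σ.intVar 13 + σ.intVar 14 + 1) y) := by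
  have hy' : min (σ.intVar 4 + 1)
      (max 0 (σ.intArr src (σ.intVar 9 + σ.intVar 14) + σ.intVar 11)) = y := by
    rw [hy, clip]
  simp only [mergeStep, Prog.apply.eq_6, apply_clampBelow, apply_clampAbove]
  simp only [Prog.apply, BExpr.holds, IExpr.eval, Function.update_idem, Function.update_self,
    Function.update_of_ne, ne_eq, not_false_eq_true, Nat.reduceEqDiff, hy', not_le]
  constructor
  · intro h
    simp [h]
  · intro h
    rw [if_neg h]
    simp

/-- Shifting and clipping are monotone, so the modified source is still sorted. Each step settles
one entry of either array; 50 covers the 45 steps of the body and the loop test, and the potential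
is 50 times the number of entries left. -/
theorem merge_run {tgt src : ℕ} (hne : tgt ≠ src) {σ : RAMState} {T a b : ℕ} {off c : ℤ}
    (hT : σ.intVar 4 = T) (ha : σ.intVar 12 = a) (hb : σ.intVar 10 = b) (hoff : σ.intVar 9 = off)
    (hc : σ.intVar 11 = c) (hA : SortedArr T a (σ.intArr tgt))
    (hS : ∀ p q : ℤ, 0 ≤ p → p ≤ q → q < b → σ.intArr src (off + p) ≤ σ.intArr src (off + q)) :
    (mergeProg tgt src).Run σ (50 * (a + b) + 16) fun σ' =>
      σ'.intVar 12 = (a + b : ℕ) ∧ SortedArr T (a + b : ℕ) (σ'.intArr tgt) ∧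
      (∀ q : ℤ, 0 ≤ q → q < a → ∃ p : ℤ, 0 ≤ p ∧ p < (a + b : ℕ) ∧
        σ'.intArr tgt p = σ.intArr tgt q) ∧
      (∀ q : ℤ, 0 ≤ q → q < b → ∃ p : ℤ, 0 ≤ p ∧ p < (a + b : ℕ) ∧
        σ'.intArr tgt p = clip T (σ.intArr src (off + q) + c)) := by
  set Y : ℤ → ℤ := fun q => clip T (σ.intArr src (off + q) + c) with hYdef
  have hY : SortedArr T b Y := by
    refine ⟨fun p q h0 h1 h2 => clip_mono _ (by have := hS p q h0 h1 h2; omega),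
      fun p _ _ => ?_, fun p _ _ => ?_⟩ <;> simp only [hYdef, clip] <;> omega
  set Inv : ℕ → RAMState → Prop := fun v τ => τ.intVar 4 = T ∧ τ.intVar 9 = off ∧
    τ.intVar 11 = c ∧ τ.intVar 12 = (a + b : ℕ) ∧ τ.intArr src = σ.intArr src ∧
    MergeInv T a b (σ.intArr tgt) Y (τ.intArr tgt) (τ.intVar 13) (τ.intVar 14) ∧
    (v : ℤ) = 50 * (τ.intVar 13 + 1 + (τ.intVar 14 + 1)) with hInv
  have hloop := Prog.Run.loop (p := mergeStep tgt src) (b := .leI (.const 0) (.var 14)) Inv ?_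
  · have hpre : (Prog.setI 13 (.sub (.var 12) (.const 1))).LoopFree ∧
        (Prog.setI 14 (.sub (.var 10) (.const 1))).LoopFree ∧
        (Prog.setI 12 (.add (.var 12) (.var 10))).LoopFree := by simp [Prog.LoopFree]
    refine Prog.Run.mono (c := 4 + (4 + (4 + (50 * (a + b) + 3 + 1))))
      (.seq (hpre.1.run (.seq (hpre.2.1.run (.seq (hpre.2.2.run
        (Prog.Run.mono (hloop (50 * (a + b)) _ ?_) le_rfl ?_))))))) (by omega)
      (fun _ _ h => h)
    · simp only [hInv, Prog.apply, IExpr.eval, Function.update_self, Function.update_of_ne, ne_eq,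
        not_false_eq_true, Nat.reduceEqDiff, hT, hoff, hc, ha, hb, true_and]
      refine ⟨by push_cast; ring, ?_, by push_cast; ring⟩
      refine ⟨by omega, by omega, by omega, by omega, fun _ _ _ => rfl, ?_, ?_, ?_, ?_, ?_, ?_, ?_⟩
      all_goals intros; omega
    · rintro τ - ⟨⟨v, -, -, -, h12, -, hm, -⟩, hb⟩
      obtain ⟨h1, h2, h3⟩ := hm.finish hA (by simpa [BExpr.holds, IExpr.eval] using hb)
      push_cast at h12 ⊢
      exact ⟨h12, h1, h2, h3⟩
  · rintro v τ ⟨h4, h9, h11, h12, hsrc, hm, hv⟩ hb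
    have hj : 0 ≤ τ.intVar 14 := by simpa [BExpr.holds, IExpr.eval] using hb
    refine ⟨45, ?_⟩
    rw [← mergeStep_maxCost tgt src]
    have hfr : (mergeStep tgt src).Frame τ ((mergeStep tgt src).apply τ) := by
      obtain ⟨k, σ', h1, -, h2⟩ := (mergeStep_loopFree tgt src).run (σ := τ)
        (Q := fun σ' => σ' = (mergeStep tgt src).apply τ) rfl
      exact h2 ▸ h1.frame
    refine (mergeStep_loopFree tgt src).run ?_
    have hap := mergeStep_apply (tgt := tgt) (src := src) τ (Y (τ.intVar 14))
      (by rw [h4, h9, h11, hsrc])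
    rw [mergeStep_maxCost]
    have hx : ∀ x, x ∉ (mergeStep tgt src).intVarsSet → _ := hfr.intVar
    have hkeep : ((mergeStep tgt src).apply τ).intVar 4 = T ∧
        ((mergeStep tgt src).apply τ).intVar 9 = off ∧
        ((mergeStep tgt src).apply τ).intVar 11 = c ∧
        ((mergeStep tgt src).apply τ).intVar 12 = (a + b : ℕ) ∧
        ((mergeStep tgt src).apply τ).intArr src = σ.intArr src := by
      rw [hx 4 (by simp [mergeStep, Prog.intVarsSet]), hx 9 (by simp [mergeStep, Prog.intVarsSet]),
        hx 11 (by simp [mergeStep, Prog.intVarsSet]), hx 12 (by simp [mergeStep, Prog.intVarsSet]),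
        hfr.intArr src (by simp [mergeStep, Prog.intArrsSet, hne.symm])]
      exact ⟨h4, h9, h11, h12, hsrc⟩
    obtain ⟨k1, k2, k3, k4, k5⟩ := hkeep
    by_cases hcase : 0 ≤ τ.intVar 13 ∧ Y (τ.intVar 14) < τ.intArr tgt (τ.intVar 13)
    · obtain ⟨e1, e2, e3⟩ := hap.1 hcase
      have hle : Y (τ.intVar 14) ≤ σ.intArr tgt (τ.intVar 13) := by
        rw [← hm.keep _ hcase.1 le_rfl]; exact hcase.2.le
      refine ⟨v - 50, by simp only [BExpr.cost, IExpr.cost]; omega, k1, k2, k3, k4, k5, ?_, ?_⟩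
      · rw [e1, e2, e3]
        exact hm.step_left hA hY hcase.1 hj hle
      · rw [e1, e2]; omega
    · obtain ⟨e1, e2, e3⟩ := hap.2 hcase
      have hi1 := hm.i_ge
      refine ⟨v - 50, by simp only [BExpr.cost, IExpr.cost]; omega, k1, k2, k3, k4, k5, ?_, ?_⟩
      · rw [e1, e2, e3]
        refine hm.step_right hA hY hj fun h0 => ?_
        rw [← hm.keep _ h0 le_rfl]
        by_contra hlt
        exact hcase ⟨h0, not_le.1 hlt⟩
      · rw [e1, e2]; omega

/-! ## The program that builds the condensed network -/

/-- The data of a maximum flow over time problem as a program sees them: the pieces of the edge `e`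
are `(tm e q, vl e q)` for `q < len e`, and they are stored from the cell `off e` on. -/
structure InstData where
  (n m s d T τ : ℕ)
  (tl hd len off : ℕ → ℕ)
  tm : ℕ → ℕ → ℤ
  vl : ℕ → ℕ → ℝ

namespace InstData

/-- The memory contains the data `I`. -/
structure Loaded (I : InstData) (σ : RAMState) : Prop where
  n_eq : σ.intVar 0 = I.n
  m_eq : σ.intVar 1 = I.m
  s_eq : σ.intVar 2 = I.s
  d_eq : σ.intVar 3 = I.d
  T_eq : σ.intVar 4 = I.T
  τ_eq : σ.intVar 5 = I.τ
  tail_eq : ∀ e < I.m, σ.intArr 0 e = I.tl e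
  head_eq : ∀ e < I.m, σ.intArr 1 e = I.hd e
  len_eq : ∀ e < I.m, σ.intArr 2 e = I.len e
  time_eq : ∀ e < I.m, ∀ q < I.len e, σ.intArr 3 (I.off e + q) = I.tm e q
  value_eq : ∀ e < I.m, ∀ q < I.len e, σ.realArr 0 (I.off e + q) = I.vl e q

theorem Loaded.frame {I : InstData} {p : Prog} {σ σ' : RAMState} (h : I.Loaded σ)
    (hf : p.Frame σ σ') (h1 : ∀ x ∈ p.intVarsSet, 6 ≤ x) (h2 : ∀ a ∈ p.intArrsSet, 4 ≤ a)
    (h3 : ∀ a ∈ p.realArrsSet, 1 ≤ a) : I.Loaded σ' := by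
  have e1 : ∀ x < 6, σ'.intVar x = σ.intVar x := fun x hx =>
    hf.intVar x fun h => by have := h1 x h; omega
  have e2 : ∀ x < 4, σ'.intArr x = σ.intArr x := fun x hx =>
    hf.intArr x fun h => by have := h2 x h; omega
  have e3 : σ'.realArr 0 = σ.realArr 0 := hf.realArr 0 fun h => by have := h3 0 h; omega
  exact ⟨by rw [e1 0 (by omega), h.n_eq], by rw [e1 1 (by omega), h.m_eq],
    by rw [e1 2 (by omega), h.s_eq], by rw [e1 3 (by omega), h.d_eq],
    by rw [e1 4 (by omega), h.T_eq], by rw [e1 5 (by omega), h.τ_eq],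
    by rw [e2 0 (by omega)]; exact h.tail_eq, by rw [e2 1 (by omega)]; exact h.head_eq,
    by rw [e2 2 (by omega)]; exact h.len_eq, by rw [e2 3 (by omega)]; exact h.time_eq,
    by rw [e3]; exact h.value_eq⟩

/-- The consistency of the data. -/
structure Valid (I : InstData) : Prop where
  m_pos : 1 ≤ I.m
  n_ge : 2 ≤ I.n
  off_zero : I.off 0 = 0
  off_succ : ∀ e, I.off (e + 1) = I.off e + I.len e
  len_pos : ∀ e < I.m, 1 ≤ I.len e
  tm_zero : ∀ e < I.m, I.tm e 0 ≤ 0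
  tm_mono : ∀ e < I.m, ∀ p q, p ≤ q → q < I.len e → I.tm e p ≤ I.tm e q

/-- The number of pieces. -/
def numPieces (I : InstData) : ℕ := I.off I.m

/-- How many multiples of `τ` in each direction are considered. -/
def range (I : InstData) : ℕ := min I.n (I.m + 1) + 1

theorem Valid.off_mono {I : InstData} (hI : I.Valid) : Monotone I.off :=
  monotone_nat_of_le_succ fun e => by rw [hI.off_succ]; omega

end InstData

/-! ### The sorted list of critical times -/

/-- Integer variable `6` becomes the number of multiples of `τ` to be considered. -/
def rangeProg : Prog :=
  .seq (.setI 6 (.add (.var 1) (.const 1))) <|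
  .seq (.ite (.leI (.var 6) (.var 0)) .skip (.setI 6 (.var 0))) <|
  .setI 6 (.add (.var 6) (.const 1))

theorem rangeProg_run {I : InstData} {σ : RAMState} (hσ : I.Loaded σ) :
    rangeProg.Run σ 14 fun σ' => σ'.intVar 6 = I.range := by
  have hLF : rangeProg.LoopFree := by simp [rangeProg, Prog.LoopFree]
  refine (hLF.run ?_).mono (c := rangeProg.maxCost) ?_ (fun _ _ h => h)
  · simp only [rangeProg, Prog.apply.eq_6, apply_clampAbove]
    simp only [Prog.apply, IExpr.eval, Function.update_self, Function.update_of_ne, ne_eq,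
      not_false_eq_true, Nat.reduceEqDiff, hσ.n_eq, hσ.m_eq, InstData.range]
    push_cast; rfl
  · simp [rangeProg, Prog.maxCost, IExpr.cost, BExpr.cost]

/-- The body of the loop of `changeProg`. -/
def changeBody : Prog :=
  .seq (.setI 10 (.get 2 (.var 8))) <|
  .seq (mergeProg 4 3) <|
  .seq (.setI 9 (.add (.var 9) (.var 10)))
    (.setI 8 (.add (.var 8) (.const 1)))

/-- The integer array `4` becomes a sorted list of `T + 1` and the starting times of the pieces,
the integer variable `7` its length. -/
def changeProg : Prog :=
  .seq (.seq (.putI 4 (.const 0) (.add (.var 4) (.const 1))) <|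
    .seq (.setI 12 (.const 1)) <| .seq (.setI 11 (.const 0)) <| .seq (.setI 8 (.const 0)) <|
    .setI 9 (.const 0)) <|
  .seq (.loop (.not (.leI (.var 1) (.var 8))) changeBody) <|
  .setI 7 (.var 12)

/-- The pieces of one edge are already sorted, so m merges into a list of length at most μ + 1 take
O(mμ) steps. The list starts from the single entry T + 1, which thus is always present. -/
theorem changeProg_run {I : InstData} (hI : I.Valid) {σ : RAMState} (hσ : I.Loaded σ) :
    changeProg.Run σ (I.m * (50 * (I.numPieces + 1) + 50) + 30) fun σ' =>
      σ'.intVar 7 = (I.numPieces + 1 : ℕ) ∧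
      SortedArr I.T (I.numPieces + 1 : ℕ) (σ'.intArr 4) ∧
      (∃ p : ℤ, 0 ≤ p ∧ p < (I.numPieces + 1 : ℕ) ∧ σ'.intArr 4 p = I.T + 1) ∧
      ∀ e < I.m, ∀ q < I.len e, ∃ p : ℤ, 0 ≤ p ∧ p < (I.numPieces + 1 : ℕ) ∧
        σ'.intArr 4 p = clip I.T (I.tm e q) := by
  set Inv : ℕ → RAMState → Prop := fun v τ => ∃ e ≤ I.m, I.Loaded τ ∧ τ.intVar 8 = e ∧
    τ.intVar 9 = I.off e ∧ τ.intVar 11 = 0 ∧ τ.intVar 12 = (I.off e + 1 : ℕ) ∧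
    SortedArr I.T (I.off e + 1 : ℕ) (τ.intArr 4) ∧
    (∃ p : ℤ, 0 ≤ p ∧ p < (I.off e + 1 : ℕ) ∧ τ.intArr 4 p = I.T + 1) ∧
    (∀ e' < e, ∀ q < I.len e', ∃ p : ℤ, 0 ≤ p ∧ p < (I.off e + 1 : ℕ) ∧
      τ.intArr 4 p = clip I.T (I.tm e' q)) ∧
    v = (I.m - e) * (50 * (I.numPieces + 1) + 50) with hInv
  have hloop := Prog.Run.loop (p := changeBody) (b := .not (.leI (.var 1) (.var 8))) Inv ?_
  · have hLF : (Prog.seq (.putI 4 (.const 0) (.add (.var 4) (.const 1))) <|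
      .seq (.setI 12 (.const 1)) <| .seq (.setI 11 (.const 0)) <| .seq (.setI 8 (.const 0)) <|
      .setI 9 (.const 0)).LoopFree := by simp [Prog.LoopFree]
    refine hLF.andThen (I.m * (50 * (I.numPieces + 1) + 50) + 7) ?_ (.andThen
      (I.m * (50 * (I.numPieces + 1) + 50) + 5) 2 (by omega) (hloop _ _ ?_) ?_)
    · simp only [Prog.maxCost, IExpr.cost]; omega
    · refine ⟨0, Nat.zero_le _, hσ.frame (hLF.frame σ) ?_ ?_ ?_, ?_⟩
      · simp [Prog.intVarsSet]
      · simp [Prog.intArrsSet]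
      · simp [Prog.realArrsSet]
      simp only [Prog.apply, IExpr.eval, Function.update_self, Function.update_of_ne, ne_eq,
        not_false_eq_true, Nat.reduceEqDiff, hσ.T_eq, hI.off_zero, Nat.sub_zero]
      refine ⟨rfl, rfl, trivial, rfl, ⟨?_, ?_, ?_⟩, ⟨0, le_rfl, by simp, by simp⟩, by simp, trivial⟩
      · intro p q h1 h2 h3
        obtain rfl : p = 0 := by simp at h3; omega
        obtain rfl : q = 0 := by simp at h3; omega
        rfl
      · intro p h1 h2
        obtain rfl : p = 0 := by simp at h2; omega
        simp; omega
      · intro p h1 h2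
        obtain rfl : p = 0 := by simp at h2; omega
        simp
    · rintro τ - ⟨⟨v, e, he, hl, h8, -, -, h12, hs, hT, hm, -⟩, hb⟩
      obtain rfl : e = I.m := by
        simp only [BExpr.holds, IExpr.eval, not_not, hl.m_eq, h8] at hb
        omega
      have hLF' : (Prog.setI 7 (.var 12)).LoopFree := by simp [Prog.LoopFree]
      refine hLF'.run ?_
      simp only [Prog.apply, IExpr.eval, Function.update_self, h12]
      exact ⟨rfl, hs, hT, hm⟩
  · rintro v τ ⟨e, he, hl, h8, h9, h11, h12, hs, hT, hm, rfl⟩ hb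
    have he : e < I.m := by
      simp only [BExpr.holds, IExpr.eval, hl.m_eq, h8] at hb
      omega
    have hoff : I.off (e + 1) ≤ I.numPieces := hI.off_mono he
    have hoff' := hI.off_succ e
    have hLF1 : (Prog.setI 10 (.get 2 (.var 8))).LoopFree := by simp [Prog.LoopFree]
    have hLF2 : (Prog.seq (.setI 9 (.add (.var 9) (.var 10)))
      (.setI 8 (.add (.var 8) (.const 1)))).LoopFree := by simp [Prog.LoopFree]
    refine ⟨3 + (50 * (I.off e + 1 + I.len e) + 16) + 8, ?_⟩
    set τ₁ := (Prog.setI 10 (.get 2 (.var 8))).apply τ with hτ₁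
    have hl1 : I.Loaded τ₁ := hl.frame (hLF1.frame τ) (by simp [Prog.intVarsSet])
      (by simp [Prog.intArrsSet]) (by simp [Prog.realArrsSet])
    have hτ₁8 : τ₁.intVar 8 = e := by
      simp only [hτ₁, Prog.apply, Function.update_of_ne, ne_eq, not_false_eq_true,
        Nat.reduceEqDiff, h8]
    have hτ₁9 : τ₁.intVar 9 = I.off e := by
      simp only [hτ₁, Prog.apply, Function.update_of_ne, ne_eq, not_false_eq_true,
        Nat.reduceEqDiff, h9]
    have hτ₁11 : τ₁.intVar 11 = 0 := by
      simp only [hτ₁, Prog.apply, Function.update_of_ne, ne_eq, not_false_eq_true,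
        Nat.reduceEqDiff, h11]
    have hτ₁12 : τ₁.intVar 12 = (I.off e + 1 : ℕ) := by
      simp only [hτ₁, Prog.apply, Function.update_of_ne, ne_eq, not_false_eq_true,
        Nat.reduceEqDiff, h12]
    have hτ₁10 : τ₁.intVar 10 = I.len e := by
      simp only [hτ₁, Prog.apply, IExpr.eval, Function.update_self, h8, hl.len_eq e he]
    have hτ₁4 : τ₁.intArr 4 = τ.intArr 4 := rfl
    have hsrc : ∀ p : ℤ, 0 ≤ p → p < I.len e →
        τ₁.intArr 3 (I.off e + p) = I.tm e p.toNat := by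
      intro p h0 hp
      lift p to ℕ using h0
      exact hl1.time_eq e he p (by exact_mod_cast hp)
    have hmerge := merge_run (tgt := 4) (src := 3) (by norm_num) hl1.T_eq hτ₁12 hτ₁10 hτ₁9 hτ₁11
      hs (fun p q h0 hpq hq => by
        rw [hsrc p h0 (by omega), hsrc q (by omega) hq]
        exact hI.tm_mono e he _ _ (by omega) (by omega))
    refine hLF1.andThen (50 * (I.off e + 1 + I.len e) + 16 + 8) ?_ (hmerge.andThen _ 8 le_rfl ?_)
    · simp only [Prog.maxCost, IExpr.cost]; omega
    · rintro τ₂ hf ⟨k12, ks, kA, kY⟩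
      have hl2 : I.Loaded τ₂ := hl1.frame hf
        (by simp [mergeProg, mergeStep, Prog.intVarsSet])
        (by simp [mergeProg, mergeStep, Prog.intArrsSet])
        (by simp [mergeProg, mergeStep, Prog.realArrsSet])
      refine hLF2.run ⟨(I.m - (e + 1)) * (50 * (I.numPieces + 1) + 50), ?_, e + 1, he, hl2.frame (hLF2.frame τ₂) (by simp [Prog.intVarsSet])
        (by simp [Prog.intArrsSet]) (by simp [Prog.realArrsSet]), ?_⟩
      · have h1 : I.m - e = I.m - (e + 1) + 1 := by omega
        rw [h1, add_mul, one_mul]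
        simp only [BExpr.cost, IExpr.cost]
        omega
      · have f8 := (hf.intVar 8 (by simp [mergeProg, mergeStep, Prog.intVarsSet])).trans hτ₁8
        have f9 := (hf.intVar 9 (by simp [mergeProg, mergeStep, Prog.intVarsSet])).trans hτ₁9
        have f10 := (hf.intVar 10 (by simp [mergeProg, mergeStep, Prog.intVarsSet])).trans hτ₁10
        have f11 := (hf.intVar 11 (by simp [mergeProg, mergeStep, Prog.intVarsSet])).trans hτ₁11
        have hlen : I.off e + 1 + I.len e = I.off (e + 1) + 1 := by omega
        simp only [Prog.apply, IExpr.eval, Function.update_self, Function.update_of_ne, ne_eq,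
          not_false_eq_true, Nat.reduceEqDiff, f8, f9, f10, f11, k12,
          hlen, true_and]
        rw [hlen] at ks kA kY
        refine ⟨by push_cast; ring, by rw [hoff']; push_cast; ring, ks, ?_, ?_, trivial⟩
        · obtain ⟨p, h0, h1, h2⟩ := hT
          obtain ⟨p', h3, h4, h5⟩ := kA p h0 h1
          exact ⟨p', h3, h4, by rw [h5, hτ₁4, h2]⟩
        · intro e' he' q hq
          rcases Nat.lt_succ_iff_lt_or_eq.1 he' with h | rfl
          · obtain ⟨p, h0, h1, h2⟩ := hm e' h q hq
            obtain ⟨p', h3, h4, h5⟩ := kA p h0 h1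
            exact ⟨p', h3, h4, by rw [h5, hτ₁4, h2]⟩
          · obtain ⟨p', h3, h4, h5⟩ := kY q (by omega) (by exact_mod_cast hq)
            refine ⟨p', h3, h4, by rw [h5, add_zero, hl1.time_eq _ he q hq]⟩

/-- The body of the loop of `timesProg`. -/
def timesBody : Prog :=
  .seq (mergeProg 5 4) <|
  .seq (.setI 11 (.add (.var 11) (.var 5)))
    (.setI 8 (.add (.var 8) (.const 1)))

/-- The integer array `5` becomes a sorted list of the critical times, the integer variable `18`
its length minus one. -/
def timesProg : Prog :=
  .seq (.seq (.setI 12 (.const 0)) <| .seq (.setI 9 (.const 0)) <| .seq (.setI 10 (.var 7)) <|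
    .seq (.setI 11 (.sub (.const 0) (.mul (.var 6) (.var 5)))) <|
    .setI 8 (.sub (.const 0) (.var 6))) <|
  .seq (.loop (.leI (.var 8) (.var 6)) timesBody) <|
  .setI 18 (.sub (.var 12) (.const 1))

/-- The list is merged with itself, shifted by lτ for -R ≤ l ≤ R. With R of order min(n, m) the
quadratic cost in R becomes O(nmμ). Repeated times are kept; they only produce empty blocks. -/
theorem timesProg_run {I : InstData} {σ : RAMState} (hσ : I.Loaded σ) {R a : ℕ}
    (hR : σ.intVar 6 = R) (ha : σ.intVar 7 = a) (hs : SortedArr I.T a (σ.intArr 4)) :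
    timesProg.Run σ ((2 * R + 1) * (50 * ((2 * R + 1) * a) + 50) + 30) fun σ' =>
      σ'.intVar 18 = ((2 * R + 1) * a : ℕ) - 1 ∧
      SortedArr I.T ((2 * R + 1) * a : ℕ) (σ'.intArr 5) ∧
      ∀ l : ℤ, |l| ≤ R → ∀ q : ℤ, 0 ≤ q → q < a →
        ∃ p : ℤ, 0 ≤ p ∧ p < ((2 * R + 1) * a : ℕ) ∧
          σ'.intArr 5 p = clip I.T (σ.intArr 4 q + l * I.τ) := by
  set Inv : ℕ → RAMState → Prop := fun v τ => ∃ c ≤ 2 * R + 1, I.Loaded τ ∧ τ.intVar 6 = R ∧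
    τ.intVar 8 = c - R ∧ τ.intVar 9 = 0 ∧ τ.intVar 10 = a ∧ τ.intVar 11 = (c - R) * I.τ ∧
    τ.intVar 12 = (c * a : ℕ) ∧ τ.intArr 4 = σ.intArr 4 ∧
    SortedArr I.T (c * a : ℕ) (τ.intArr 5) ∧
    (∀ l : ℤ, -R ≤ l → l < c - R → ∀ q : ℤ, 0 ≤ q → q < a →
      ∃ p : ℤ, 0 ≤ p ∧ p < (c * a : ℕ) ∧ τ.intArr 5 p = clip I.T (σ.intArr 4 q + l * I.τ)) ∧
    v = (2 * R + 1 - c) * (50 * ((2 * R + 1) * a) + 50) with hInv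
  have hloop := Prog.Run.loop (p := timesBody) (b := .leI (.var 8) (.var 6)) Inv ?_
  · have hLF : (Prog.seq (.setI 12 (.const 0)) <| .seq (.setI 9 (.const 0)) <|
      .seq (.setI 10 (.var 7)) <| .seq (.setI 11 (.sub (.const 0) (.mul (.var 6) (.var 5)))) <|
      .setI 8 (.sub (.const 0) (.var 6))).LoopFree := by simp [Prog.LoopFree]
    refine hLF.andThen ((2 * R + 1) * (50 * ((2 * R + 1) * a) + 50) + 8) ?_ (.andThen
      ((2 * R + 1) * (50 * ((2 * R + 1) * a) + 50) + 4) 4 (by omega) (hloop _ _ ?_) ?_)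
    · simp only [Prog.maxCost, IExpr.cost]; omega
    · refine ⟨0, Nat.zero_le _, hσ.frame (hLF.frame σ) ?_ ?_ ?_, ?_⟩
      · simp [Prog.intVarsSet]
      · simp [Prog.intArrsSet]
      · simp [Prog.realArrsSet]
      simp only [Prog.apply, IExpr.eval, Function.update_self, Function.update_of_ne, ne_eq,
        not_false_eq_true, Nat.reduceEqDiff, hσ.τ_eq, hR, ha, Nat.sub_zero, Nat.zero_mul,
        true_and, and_true, Nat.cast_zero, zero_sub, neg_mul]
      refine ⟨⟨?_, ?_, ?_⟩, ?_⟩ <;> intros <;> omega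
    · rintro τ - ⟨⟨v, c, hc, hl, h6, h8, -, -, -, h12, -, hs', hm, -⟩, hb⟩
      obtain rfl : c = 2 * R + 1 := by
        simp only [BExpr.holds, IExpr.eval, h6, h8] at hb
        omega
      have hLF' : (Prog.setI 18 (.sub (.var 12) (.const 1))).LoopFree := by simp [Prog.LoopFree]
      refine hLF'.run ?_
      simp only [Prog.apply, IExpr.eval, Function.update_self, h12]
      refine ⟨trivial, hs', fun l hl => ?_⟩
      rw [abs_le] at hl
      exact hm l hl.1 (by push_cast; omega)
  · rintro v τ ⟨c, hc, hl, h6, h8, h9, h10, h11, h12, h4, hs', hm, rfl⟩ hb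
    have hc : c < 2 * R + 1 := by
      simp only [BExpr.holds, IExpr.eval, h6, h8] at hb
      omega
    have hca : (c + 1) * a ≤ (2 * R + 1) * a := Nat.mul_le_mul_right _ hc
    have hca' : (c + 1) * a = c * a + a := by ring
    have hLF2 : (Prog.seq (.setI 11 (.add (.var 11) (.var 5)))
      (.setI 8 (.add (.var 8) (.const 1)))).LoopFree := by simp [Prog.LoopFree]
    have hmerge := merge_run (tgt := 5) (src := 4) (by norm_num) hl.T_eq h12 h10 h9 h11
      hs' (fun p q h0 hpq hq => by
        rw [h4, zero_add, zero_add]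
        exact hs.mono p q h0 hpq hq)
    refine ⟨50 * (c * a + a) + 16 + 8, hmerge.andThen _ 8 le_rfl ?_⟩
    rintro τ₂ hf ⟨k12, ks, kA, kY⟩
    have hl2 : I.Loaded τ₂ := hl.frame hf
      (by simp [mergeProg, mergeStep, Prog.intVarsSet])
      (by simp [mergeProg, mergeStep, Prog.intArrsSet])
      (by simp [mergeProg, mergeStep, Prog.realArrsSet])
    refine hLF2.run ⟨(2 * R + 1 - (c + 1)) * (50 * ((2 * R + 1) * a) + 50), ?_, c + 1, hc,
      hl2.frame (hLF2.frame τ₂) (by simp [Prog.intVarsSet])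
      (by simp [Prog.intArrsSet]) (by simp [Prog.realArrsSet]), ?_⟩
    · have h1 : 2 * R + 1 - c = 2 * R + 1 - (c + 1) + 1 := by omega
      rw [hca'] at hca
      generalize (2 * R + 1) * a = D at hca ⊢
      rw [h1, add_mul (2 * R + 1 - (c + 1)), one_mul]
      simp only [BExpr.cost, IExpr.cost]
      omega
    · have f6 := (hf.intVar 6 (by simp [mergeProg, mergeStep, Prog.intVarsSet])).trans h6
      have f8 := (hf.intVar 8 (by simp [mergeProg, mergeStep, Prog.intVarsSet])).trans h8
      have f9 := (hf.intVar 9 (by simp [mergeProg, mergeStep, Prog.intVarsSet])).trans h9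
      have f10 := (hf.intVar 10 (by simp [mergeProg, mergeStep, Prog.intVarsSet])).trans h10
      have f11 := (hf.intVar 11 (by simp [mergeProg, mergeStep, Prog.intVarsSet])).trans h11
      have f4 := (hf.intArr 4 (by simp [mergeProg, mergeStep, Prog.intArrsSet])).trans h4
      simp only [Prog.apply, IExpr.eval, Function.update_self, Function.update_of_ne, ne_eq,
        not_false_eq_true, Nat.reduceEqDiff, f6, f8, f9, f10, f11, f4, k12, hl2.τ_eq, hca',
        true_and]
      refine ⟨by push_cast; ring, by push_cast; ring, ks, ?_, trivial⟩
      intro l hl0 hl1 q hq0 hq1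
      by_cases hlc : l < c - R
      · obtain ⟨p, h0, h1, h2⟩ := hm l hl0 hlc q hq0 hq1
        obtain ⟨p', h3, h4, h5⟩ := kA p h0 h1
        exact ⟨p', h3, h4, by rw [h5, h2]⟩
      · obtain rfl : l = c - R := by push_cast at hl1; omega
        obtain ⟨p', h3, h4', h5⟩ := kY q hq0 hq1
        exact ⟨p', h3, h4', by rw [h5, zero_add, h4]⟩

/-! ### The list of edges -/

/-- The list `l` of edges (tail, head, capacity) is stored in the arrays from `32` on, its length in
the integer variable `17`. -/
structure Stored (l : List (ℤ × ℤ × ℝ)) (σ : RAMState) : Prop where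
  tail_eq : σ.intArr 32 = memOfList (l.map fun x => x.1)
  head_eq : σ.intArr 33 = memOfList (l.map fun x => x.2.1)
  cap_eq : σ.realArr 32 = memOfList (l.map fun x => x.2.2)
  length_eq : σ.intVar 17 = l.length

/-- Append the edge from the integer variable `21` to `22` with the capacity in the real
variable `2`. -/
def emitProg : Prog :=
  .seq (.putI 32 (.var 17) (.var 21)) <| .seq (.putI 33 (.var 17) (.var 22)) <|
  .seq (.putR 32 (.var 17) (.var 2)) <| .setI 17 (.add (.var 17) (.const 1))

theorem Stored.emit {l : List (ℤ × ℤ × ℝ)} {σ : RAMState} (h : Stored l σ) :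
    Stored (l ++ [(σ.intVar 21, σ.intVar 22, σ.realVar 2)]) (emitProg.apply σ) := by
  constructor
  · simp only [emitProg, Prog.apply, IExpr.eval, RExpr.eval, Function.update_self,
      Function.update_of_ne, ne_eq, not_false_eq_true, Nat.reduceEqDiff, List.map_append,
      List.map_cons, List.map_nil, memOfList_append_singleton, List.length_map, h.tail_eq,
      h.length_eq]
  · simp only [emitProg, Prog.apply, IExpr.eval, RExpr.eval, Function.update_self,
      Function.update_of_ne, ne_eq, not_false_eq_true, Nat.reduceEqDiff, List.map_append,
      List.map_cons, List.map_nil, memOfList_append_singleton, List.length_map, h.head_eq,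
      h.length_eq]
  · simp only [emitProg, Prog.apply, IExpr.eval, RExpr.eval, Function.update_self,
      List.map_append, List.map_cons, List.map_nil, memOfList_append_singleton, List.length_map,
      h.cap_eq, h.length_eq]
  · simp only [emitProg, Prog.apply, IExpr.eval, Function.update_self, h.length_eq,
      List.length_append, List.length_cons, List.length_nil]
    push_cast; ring

theorem Stored.frame {l : List (ℤ × ℤ × ℝ)} {p : Prog} {σ σ' : RAMState} (h : Stored l σ)
    (hf : p.Frame σ σ') (h1 : 17 ∉ p.intVarsSet) (h2 : 32 ∉ p.intArrsSet)
    (h3 : 33 ∉ p.intArrsSet) (h4 : 32 ∉ p.realArrsSet) : Stored l σ' :=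
  ⟨by rw [hf.intArr _ h2, h.tail_eq], by rw [hf.intArr _ h3, h.head_eq],
    by rw [hf.realArr _ h4, h.cap_eq], by rw [hf.intVar _ h1, h.length_eq]⟩

/-- A pointer that never overshoots the greatest admissible index and cannot advance has reached it.
-/
theorem findGreatest_eq_of_not_succ {P : ℕ → Prop} [DecidablePred P] {n j : ℕ}
    (hmono : ∀ a b, a ≤ b → b ≤ n → P b → P a) (hj : j ≤ Nat.findGreatest P n)
    (hnext : ¬ (j + 1 ≤ n ∧ P (j + 1))) : Nat.findGreatest P n = j := by
  by_contra hne
  have h1 : j + 1 ≤ Nat.findGreatest P n := by omega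
  have h2 := Nat.findGreatest_le (P := P) n
  exact hnext ⟨h1.trans h2, hmono _ _ h1 h2
    (Nat.findGreatest_of_ne_zero (n := n) (P := P) rfl (by omega))⟩

/-! ### Transit edges by a sweep with two pointers -/

namespace InstData

variable (I : InstData) (A : ℤ → ℤ) (k : ℕ)

/-- The block in which what leaves at the beginning of block `i` arrives. -/
def headIdx (i : ℕ) : ℕ := Nat.findGreatest (fun j => A (j : ℕ) ≤ A (i : ℕ) + I.τ) (k - 1)

/-- The piece of the edge `e` at the beginning of block `i`. -/
def pieceIdx (e i : ℕ) : ℕ := Nat.findGreatest (fun q => I.tm e q ≤ A (i : ℕ)) (I.len e - 1)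

/-- The capacity is constant on a block, so its total there is value times length. Blocks whose
first departure arrives after T get capacity zero but keep their edge, so the number of edges is
known in advance. -/
noncomputable def transitCap (e i : ℕ) : ℝ :=
  if A (i : ℕ) + I.τ ≤ I.T then I.vl e (I.pieceIdx A e i) * ((A ((i : ℕ) + 1) - A (i : ℕ) : ℤ) : ℝ)
  else 0

/-- Every vertex owns 2k consecutive nodes, and block i is the node at position 2i. Odd positions
only subdivide the chain, so that no transit edge is parallel to a chain edge. -/
noncomputable def transitEntry (e i : ℕ) : ℤ × ℤ × ℝ :=
  ((I.tl e * (2 * k) + 2 * i : ℤ), (I.hd e * (2 * k) + 2 * I.headIdx A k i : ℤ), I.transitCap A e i)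

noncomputable def transitList (e : ℕ) : List (ℤ × ℤ × ℝ) :=
  (List.range e).flatMap fun e' => (List.range k).map (I.transitEntry A k e')

theorem transitList_succ (e : ℕ) :
    I.transitList A k (e + 1) = I.transitList A k e ++ (List.range k).map (I.transitEntry A k e) := by
  simp [transitList, List.range_succ]

end InstData

/-- Append the next transit edge. The integer variables are `9` and `10`: first cell and number of
the pieces, `13`: block, `14`: block of the head, `15`: cell of the piece, `18`: number of blocks,
`19` and `20`: first nodes of tail and head. -/
def transitEmit : Prog :=
  .seq (.setI 21 (.add (.var 19) (.mul (.const 2) (.var 13)))) <|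
  .seq (.setI 22 (.add (.var 20) (.mul (.const 2) (.var 14)))) <|
  .seq (.ite (.leI (.add (.get 5 (.var 13)) (.var 5)) (.var 4))
    (.setR 2 (.mul (.get 0 (.var 15))
      (.ofInt (.sub (.get 5 (.add (.var 13) (.const 1))) (.get 5 (.var 13))))))
    (.setR 2 (.ofInt (.const 0)))) <|
  .seq emitProg <|
  .seq (.setR 1 (.add (.var 1) (.var 2))) <|
  .setI 13 (.add (.var 13) (.const 1))

def headTest : BExpr :=
  .and (.not (.leI (.var 18) (.add (.var 14) (.const 1))))
    (.leI (.get 5 (.add (.var 14) (.const 1))) (.add (.get 5 (.var 13)) (.var 5)))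

def pieceTest : BExpr :=
  .and (.not (.leI (.add (.var 9) (.var 10)) (.add (.var 15) (.const 1))))
    (.leI (.get 3 (.add (.var 15) (.const 1))) (.get 5 (.var 13)))

def transitBody : Prog :=
  .ite headTest (.setI 14 (.add (.var 14) (.const 1))) <|
  .ite pieceTest (.setI 15 (.add (.var 15) (.const 1))) transitEmit

theorem transitEmit_loopFree : transitEmit.LoopFree := by
  simp [transitEmit, emitProg, Prog.LoopFree]

theorem transitBody_loopFree : transitBody.LoopFree := by
  simp [transitBody, transitEmit, emitProg, Prog.LoopFree]

theorem transitBody_maxCost : transitBody.maxCost ≤ 100 := by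
  simp [transitBody, transitEmit, emitProg, headTest, pieceTest, Prog.maxCost, IExpr.cost,
    BExpr.cost, RExpr.cost]

/-- The state while the transit edges of `e` are appended to the list `l`. -/
structure TransitInv (I : InstData) (A : ℤ → ℤ) (k e : ℕ) (l : List (ℤ × ℤ × ℝ)) (i j q : ℕ)
    (σ : RAMState) : Prop where
  loaded : I.Loaded σ
  edge_eq : σ.intVar 8 = e
  off_eq : σ.intVar 9 = I.off e
  len_eq : σ.intVar 10 = I.len e
  i_eq : σ.intVar 13 = i
  j_eq : σ.intVar 14 = j
  q_eq : σ.intVar 15 = I.off e + q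
  k_eq : σ.intVar 18 = k
  tail_eq : σ.intVar 19 = I.tl e * (2 * k)
  head_eq : σ.intVar 20 = I.hd e * (2 * k)
  times_eq : σ.intArr 5 = A
  i_le : i ≤ k
  j_lt : j < k
  q_lt : q < I.len e
  j_le : i < k → j ≤ I.headIdx A k i
  q_le : i < k → q ≤ I.pieceIdx A e i
  stored : Stored (l ++ (List.range i).map (I.transitEntry A k e)) σ
  total : σ.realVar 1 = ((l ++ (List.range i).map (I.transitEntry A k e)).map fun x => x.2.2).sum

namespace TransitInv

variable {I : InstData} {A : ℤ → ℤ} {k e : ℕ} {l : List (ℤ × ℤ × ℝ)} {i j q : ℕ} {σ : RAMState}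

theorem headTest_iff (h : TransitInv I A k e l i j q σ) :
    headTest.holds σ ↔ j + 1 ≤ k - 1 ∧ A (j + 1 : ℕ) ≤ A i + I.τ := by
  simp only [headTest, BExpr.holds, IExpr.eval, h.k_eq, h.j_eq, h.times_eq, h.i_eq, h.loaded.τ_eq]
  push_cast
  have := h.j_lt
  constructor <;> rintro ⟨h1, h2⟩ <;> exact ⟨by omega, h2⟩

theorem pieceTest_iff (hI : I.Valid) (he : e < I.m) (h : TransitInv I A k e l i j q σ) :
    pieceTest.holds σ ↔ q + 1 ≤ I.len e - 1 ∧ I.tm e (q + 1) ≤ A i := by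
  simp only [pieceTest, BExpr.holds, IExpr.eval, h.off_eq, h.len_eq, h.q_eq, h.times_eq, h.i_eq]
  have := hI.len_pos e he
  constructor
  · rintro ⟨h1, h2⟩
    have h3 : q + 1 < I.len e := by omega
    refine ⟨by omega, ?_⟩
    rw [← h.loaded.time_eq e he (q + 1) h3]
    push_cast
    rw [← add_assoc]; exact h2
  · rintro ⟨h1, h2⟩
    have h3 : q + 1 < I.len e := by omega
    refine ⟨by omega, ?_⟩
    rw [← h.loaded.time_eq e he (q + 1) h3] at h2
    push_cast at h2
    rw [add_assoc]; exact h2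

theorem step_head (h : TransitInv I A k e l i j q σ)
    (ht : j + 1 ≤ k - 1 ∧ A (j + 1 : ℕ) ≤ A i + I.τ) :
    TransitInv I A k e l i (j + 1) q ((Prog.setI 14 (.add (.var 14) (.const 1))).apply σ) := by
  have hLF : (Prog.setI 14 (.add (.var 14) (.const 1))).LoopFree := by simp [Prog.LoopFree]
  refine ⟨h.loaded.frame (hLF.frame σ) (by simp [Prog.intVarsSet])
      (by simp [Prog.intArrsSet]) (by simp [Prog.realArrsSet]), h.edge_eq, h.off_eq, h.len_eq,
    h.i_eq, ?_, h.q_eq, h.k_eq, h.tail_eq, h.head_eq, h.times_eq, h.i_le, by omega, h.q_lt,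
    fun _ => Nat.le_findGreatest ht.1 ht.2, h.q_le, h.stored.frame (hLF.frame σ)
      (by simp [Prog.intVarsSet]) (by simp [Prog.intArrsSet]) (by simp [Prog.intArrsSet])
      (by simp [Prog.realArrsSet]), h.total⟩
  simp [Prog.apply, IExpr.eval, h.j_eq]

theorem step_piece (h : TransitInv I A k e l i j q σ)
    (ht : q + 1 ≤ I.len e - 1 ∧ I.tm e (q + 1) ≤ A i) :
    TransitInv I A k e l i j (q + 1) ((Prog.setI 15 (.add (.var 15) (.const 1))).apply σ) := by
  have hLF : (Prog.setI 15 (.add (.var 15) (.const 1))).LoopFree := by simp [Prog.LoopFree]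
  refine ⟨h.loaded.frame (hLF.frame σ) (by simp [Prog.intVarsSet])
      (by simp [Prog.intArrsSet]) (by simp [Prog.realArrsSet]), h.edge_eq, h.off_eq, h.len_eq,
    h.i_eq, h.j_eq, ?_, h.k_eq, h.tail_eq, h.head_eq, h.times_eq, h.i_le, h.j_lt, by omega,
    h.j_le, fun _ => Nat.le_findGreatest ht.1 ht.2, h.stored.frame (hLF.frame σ)
      (by simp [Prog.intVarsSet]) (by simp [Prog.intArrsSet]) (by simp [Prog.intArrsSet])
      (by simp [Prog.realArrsSet]), h.total⟩
  simp [Prog.apply, IExpr.eval, h.q_eq]; ring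

theorem step_emit (hI : I.Valid) (he : e < I.m)
    (hA : ∀ a b : ℕ, a ≤ b → b ≤ k → A a ≤ A b)
    (h : TransitInv I A k e l i j q σ) (hi : i < k)
    (h1 : ¬ (j + 1 ≤ k - 1 ∧ A (j + 1 : ℕ) ≤ A i + I.τ))
    (h2 : ¬ (q + 1 ≤ I.len e - 1 ∧ I.tm e (q + 1) ≤ A i)) :
    TransitInv I A k e l (i + 1) j q (transitEmit.apply σ) := by
  have hlen := hI.len_pos e he
  have hj : I.headIdx A k i = j := findGreatest_eq_of_not_succ
    (fun a b hab hb hP => (hA a b hab (by omega)).trans hP) (h.j_le hi) h1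
  have hq : I.pieceIdx A e i = q := findGreatest_eq_of_not_succ
    (fun a b hab hb hP => (hI.tm_mono e he a b hab (by omega)).trans hP) (h.q_le hi) h2
  set σ₁ := (Prog.seq (.setI 21 (.add (.var 19) (.mul (.const 2) (.var 13)))) <|
    .seq (.setI 22 (.add (.var 20) (.mul (.const 2) (.var 14)))) <|
    .ite (.leI (.add (.get 5 (.var 13)) (.var 5)) (.var 4))
      (.setR 2 (.mul (.get 0 (.var 15))
        (.ofInt (.sub (.get 5 (.add (.var 13) (.const 1))) (.get 5 (.var 13))))))
      (.setR 2 (.ofInt (.const 0)))).apply σ with hσ₁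
  have hLF₁ : (Prog.seq (.setI 21 (.add (.var 19) (.mul (.const 2) (.var 13)))) <|
    .seq (.setI 22 (.add (.var 20) (.mul (.const 2) (.var 14)))) <|
    .ite (.leI (.add (.get 5 (.var 13)) (.var 5)) (.var 4))
      (.setR 2 (.mul (.get 0 (.var 15))
        (.ofInt (.sub (.get 5 (.add (.var 13) (.const 1))) (.get 5 (.var 13))))))
      (.setR 2 (.ofInt (.const 0)))).LoopFree := by simp [Prog.LoopFree]
  have hf₁ := hLF₁.frame σ
  rw [← hσ₁] at hf₁
  have hσ₁' : σ₁.intVar 21 = I.tl e * (2 * k) + 2 * i ∧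
      σ₁.intVar 22 = I.hd e * (2 * k) + 2 * I.headIdx A k i ∧
      σ₁.realVar 2 = I.transitCap A e i := by
    rw [hj, InstData.transitCap, hq]
    by_cases hc : A i + I.τ ≤ I.T
    · rw [hσ₁, Prog.apply.eq_6, Prog.apply.eq_6, Prog.apply_ite_of_pos, if_pos hc]
      · simp only [Prog.apply, IExpr.eval, RExpr.eval, Function.update_self, Function.update_of_ne,
          ne_eq, not_false_eq_true, Nat.reduceEqDiff, h.tail_eq, h.head_eq, h.i_eq, h.j_eq,
          h.q_eq, h.times_eq, h.loaded.value_eq e he q h.q_lt, and_self]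
      · simpa [BExpr.holds, Prog.apply, IExpr.eval, h.times_eq, h.i_eq, h.loaded.τ_eq,
          h.loaded.T_eq] using hc
    · rw [hσ₁, Prog.apply.eq_6, Prog.apply.eq_6, Prog.apply_ite_of_neg, if_neg hc]
      · simp only [Prog.apply, IExpr.eval, RExpr.eval, Function.update_self, Function.update_of_ne,
          ne_eq, not_false_eq_true, Nat.reduceEqDiff, h.tail_eq, h.head_eq, h.i_eq, h.j_eq,
          Int.cast_zero, and_self]
      · simpa [BExpr.holds, Prog.apply, IExpr.eval, h.times_eq, h.i_eq, h.loaded.τ_eq,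
          h.loaded.T_eq] using hc
  have happly : transitEmit.apply σ = (Prog.seq (.setR 1 (.add (.var 1) (.var 2)))
      (.setI 13 (.add (.var 13) (.const 1)))).apply (emitProg.apply σ₁) := rfl
  have hLF₃ : (Prog.seq (.setR 1 (.add (.var 1) (.var 2)))
      (.setI 13 (.add (.var 13) (.const 1)))).LoopFree := by simp [Prog.LoopFree]
  have hst := (h.stored.frame hf₁ (by simp [Prog.intVarsSet]) (by simp [Prog.intArrsSet])
    (by simp [Prog.intArrsSet]) (by simp [Prog.realArrsSet])).emit
  have hlist : l ++ (List.range (i + 1)).map (I.transitEntry A k e) =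
      l ++ (List.range i).map (I.transitEntry A k e) ++
        [(σ₁.intVar 21, σ₁.intVar 22, σ₁.realVar 2)] := by
    rw [hσ₁'.1, hσ₁'.2.1, hσ₁'.2.2, List.range_succ, List.map_append, ← List.append_assoc]
    rfl
  have hst' := hst.frame (hLF₃.frame _) (by simp [Prog.intVarsSet]) (by simp [Prog.intArrsSet])
    (by simp [Prog.intArrsSet]) (by simp [Prog.realArrsSet])
  rw [← hlist, ← happly] at hst'
  have hf := transitEmit_loopFree.frame σ
  have hv : ∀ x, x ∉ [21, 22, 17, 13] → (transitEmit.apply σ).intVar x = σ.intVar x := fun x hx =>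
    hf.intVar x (by simpa [transitEmit, emitProg, Prog.intVarsSet] using hx)
  refine ⟨h.loaded.frame hf (by simp [transitEmit, emitProg, Prog.intVarsSet])
      (by simp [transitEmit, emitProg, Prog.intArrsSet])
      (by simp [transitEmit, emitProg, Prog.realArrsSet]),
    by rw [hv 8 (by simp), h.edge_eq], by rw [hv 9 (by simp), h.off_eq],
    by rw [hv 10 (by simp), h.len_eq], ?_, by rw [hv 14 (by simp), h.j_eq],
    by rw [hv 15 (by simp), h.q_eq], by rw [hv 18 (by simp), h.k_eq],
    by rw [hv 19 (by simp), h.tail_eq], by rw [hv 20 (by simp), h.head_eq],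
    by rw [hf.intArr 5 (by simp [transitEmit, emitProg, Prog.intArrsSet]), h.times_eq],
    hi, h.j_lt, h.q_lt, fun hi' => ?_, fun hi' => ?_, hst', ?_⟩
  · have h13 : σ₁.intVar 13 = i := by
      rw [hf₁.intVar 13 (by simp [Prog.intVarsSet]), h.i_eq]
    rw [happly]
    simp [Prog.apply, emitProg, IExpr.eval, h13]
  -- The head block and, below, the piece are monotone in the block, so neither pointer has to be
  -- moved back.
  · rw [← hj]
    refine Nat.findGreatest_mono (fun a ha => ?_) le_rfl
    have := hA i (i + 1) (by omega) (by omega)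
    exact ha.trans (by omega)
  · rw [← hq]
    refine Nat.findGreatest_mono (fun a ha => ?_) le_rfl
    exact ha.trans (hA i (i + 1) (by omega) (by omega))
  · have h1 : σ₁.realVar 1 = σ.realVar 1 := hf₁.realVar 1 (by simp [Prog.realVarsSet])
    rw [happly, hlist, List.map_append, List.sum_append, ← h.total]
    simp [Prog.apply, emitProg, RExpr.eval, h1]

end TransitInv

/-- Each iteration advances exactly one of block, head pointer and piece pointer, which bounds the
number of iterations by 2k plus the number of pieces; 105 is the cost of body and test. -/
theorem TransitInv.run {I : InstData} {A : ℤ → ℤ} {k e : ℕ} {l : List (ℤ × ℤ × ℝ)}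
    {σ : RAMState} (hI : I.Valid) (he : e < I.m) (hA : ∀ a b : ℕ, a ≤ b → b ≤ k → A a ≤ A b)
    (h : TransitInv I A k e l 0 0 0 σ) :
    (Prog.loop (.not (.leI (.var 18) (.var 13))) transitBody).Run σ
      ((2 * k + I.len e) * 105 + 5) fun σ' => ∃ j q, TransitInv I A k e l k j q σ' := by
  have hloop := Prog.Run.loop (p := transitBody) (b := .not (.leI (.var 18) (.var 13)))
    (fun v τ => ∃ i j q, TransitInv I A k e l i j q τ ∧
      v = ((k - i) + (k - j) + (I.len e - q)) * 105) ?_ _ _ ⟨0, 0, 0, h, rfl⟩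
  · refine hloop.mono ?_ ?_
    · simp only [BExpr.cost, IExpr.cost]; omega
    · rintro τ - ⟨⟨v, i, j, q, hτ, -⟩, hb⟩
      simp only [BExpr.holds, IExpr.eval, not_not, hτ.k_eq, hτ.i_eq] at hb
      have := hτ.i_le
      obtain rfl : i = k := by omega
      exact ⟨j, q, hτ⟩
  · rintro v τ ⟨i, j, q, hτ, rfl⟩ hb
    simp only [BExpr.holds, IExpr.eval, hτ.k_eq, hτ.i_eq] at hb
    have hi : i < k := by omega
    have hj := hτ.j_lt
    have hq := hτ.q_lt
    refine ⟨100, transitBody_loopFree.run_of_le transitBody_maxCost ?_⟩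
    simp only [BExpr.cost, IExpr.cost]
    rw [transitBody]
    by_cases h1 : j + 1 ≤ k - 1 ∧ A (j + 1 : ℕ) ≤ A i + I.τ
    · rw [Prog.apply_ite_of_pos (hτ.headTest_iff.2 h1)]
      exact ⟨_, by omega, i, j + 1, q, hτ.step_head h1, rfl⟩
    · rw [Prog.apply_ite_of_neg (mt hτ.headTest_iff.1 h1)]
      by_cases h2 : q + 1 ≤ I.len e - 1 ∧ I.tm e (q + 1) ≤ A i
      · rw [Prog.apply_ite_of_pos ((hτ.pieceTest_iff hI he).2 h2)]
        exact ⟨_, by omega, i, j, q + 1, hτ.step_piece h2, rfl⟩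
      · rw [Prog.apply_ite_of_neg (mt (hτ.pieceTest_iff hI he).1 h2)]
        exact ⟨_, by omega, i + 1, j, q, hτ.step_emit hI he hA hi h1 h2, rfl⟩

/-- Initialisation for the edge in the integer variable `8`. -/
def edgeInit : Prog :=
  .seq (.setI 10 (.get 2 (.var 8))) <|
  .seq (.setI 19 (.mul (.get 0 (.var 8)) (.mul (.const 2) (.var 18)))) <|
  .seq (.setI 20 (.mul (.get 1 (.var 8)) (.mul (.const 2) (.var 18)))) <|
  .seq (.setI 13 (.const 0)) <| .seq (.setI 14 (.const 0)) <| .setI 15 (.var 9)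

def edgeNext : Prog :=
  .seq (.setI 9 (.add (.var 9) (.var 10))) (.setI 8 (.add (.var 8) (.const 1)))

/-- Stores the transit edges, and their total capacity in real variable `1`. -/
def transitProg : Prog :=
  .seq (.seq (.setI 8 (.const 0)) <| .seq (.setI 9 (.const 0)) <| .seq (.setI 17 (.const 0)) <|
    .setR 1 (.ofInt (.const 0))) <|
  .loop (.not (.leI (.var 1) (.var 8))) <|
    .seq edgeInit <| .seq (.loop (.not (.leI (.var 18) (.var 13))) transitBody) edgeNext

/-- The arrays that receive the list of edges are zero. -/
structure Fresh (σ : RAMState) : Prop where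
  tail_eq : σ.intArr 32 = fun _ => 0
  head_eq : σ.intArr 33 = fun _ => 0
  cap_eq : σ.realArr 32 = fun _ => 0

/-- Fresh arrays are required because the final memory must equal an initial state of the given
algorithm, including the zeros past the lists. The running total of capacities is needed for the
substitute of infinity on the chains. -/
theorem transitProg_run {I : InstData} (hI : I.Valid) {A : ℤ → ℤ} {k : ℕ} (hk : 1 ≤ k)
    (hA : ∀ a b : ℕ, a ≤ b → b ≤ k → A a ≤ A b) {σ : RAMState} (hσ : I.Loaded σ)
    (h18 : σ.intVar 18 = k) (h5 : σ.intArr 5 = A) (hz : Fresh σ) :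
    transitProg.Run σ (I.m * (210 * k + 50) + 105 * I.numPieces + 20) fun σ' =>
      Stored (I.transitList A k I.m) σ' ∧
      σ'.realVar 1 = ((I.transitList A k I.m).map fun x => x.2.2).sum := by
  have hloop := Prog.Run.loop (p := .seq edgeInit <|
      .seq (.loop (.not (.leI (.var 18) (.var 13))) transitBody) edgeNext)
    (b := .not (.leI (.var 1) (.var 8)))
    (fun v τ => ∃ e ≤ I.m, I.Loaded τ ∧ τ.intVar 8 = e ∧ τ.intVar 9 = I.off e ∧
      τ.intVar 18 = k ∧ τ.intArr 5 = A ∧ Stored (I.transitList A k e) τ ∧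
      τ.realVar 1 = ((I.transitList A k e).map fun x => x.2.2).sum ∧
      v = (I.m - e) * (210 * k + 50) + 105 * (I.numPieces - I.off e)) ?_
  · have hLF : (Prog.seq (.setI 8 (.const 0)) <| .seq (.setI 9 (.const 0)) <|
      .seq (.setI 17 (.const 0)) <| .setR 1 (.ofInt (.const 0))).LoopFree := by
      simp [Prog.LoopFree]
    refine hLF.andThen (I.m * (210 * k + 50) + 105 * I.numPieces + 5) ?_ ((hloop
      ((I.m - 0) * (210 * k + 50) + 105 * (I.numPieces - I.off 0)) _
      ⟨0, Nat.zero_le _, hσ.frame (hLF.frame σ) ?_ ?_ ?_, ?_⟩).mono ?_ ?_)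
    · simp only [Prog.maxCost, IExpr.cost, RExpr.cost]; omega
    · simp [Prog.intVarsSet]
    · simp [Prog.intArrsSet]
    · simp [Prog.realArrsSet]
    · refine ⟨by simp [Prog.apply, IExpr.eval], by simp [Prog.apply, IExpr.eval, hI.off_zero],
        by simp [Prog.apply, h18], by simp [Prog.apply, h5], ⟨?_, ?_, ?_, ?_⟩, ?_, rfl⟩
      · simp only [Prog.apply, hz.tail_eq]; funext i; simp [InstData.transitList, memOfList]
      · simp only [Prog.apply, hz.head_eq]; funext i; simp [InstData.transitList, memOfList]
      · simp only [Prog.apply, hz.cap_eq]; funext i; simp [InstData.transitList, memOfList]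
      · simp [Prog.apply, InstData.transitList, IExpr.eval]
      · simp [Prog.apply, InstData.transitList, IExpr.eval, RExpr.eval]
    · simp only [BExpr.cost, IExpr.cost, hI.off_zero, Nat.sub_zero]; omega
    · rintro τ - ⟨⟨v, e, he, hl, h8, -, -, -, hs, ht, -⟩, hb⟩
      obtain rfl : e = I.m := by
        simp only [BExpr.holds, IExpr.eval, not_not, hl.m_eq, h8] at hb
        omega
      exact ⟨hs, ht⟩
  · rintro v τ ⟨e, he, hl, h8, h9, h18, h5, hs, ht, rfl⟩ hb
    have he : e < I.m := by
      simp only [BExpr.holds, IExpr.eval, hl.m_eq, h8] at hb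
      omega
    have hoff : I.off (e + 1) ≤ I.numPieces := hI.off_mono he
    have hoff' := hI.off_succ e
    have hLF₁ : edgeInit.LoopFree := by simp [edgeInit, Prog.LoopFree]
    have hLF₂ : edgeNext.LoopFree := by simp [edgeNext, Prog.LoopFree]
    have hinv : TransitInv I A k e (I.transitList A k e) 0 0 0 (edgeInit.apply τ) := by
      refine ⟨hl.frame (hLF₁.frame τ) (by simp [edgeInit, Prog.intVarsSet])
        (by simp [edgeInit, Prog.intArrsSet]) (by simp [edgeInit, Prog.realArrsSet]),
        ?_, ?_, ?_, ?_, ?_, ?_, ?_, ?_, ?_, ?_, Nat.zero_le _, hk, hI.len_pos e he,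
        fun _ => Nat.zero_le _, fun _ => Nat.zero_le _, ?_, ?_⟩
      · simp [edgeInit, Prog.apply, h8]
      · simp [edgeInit, Prog.apply, h9]
      · simp [edgeInit, Prog.apply, IExpr.eval, h8, hl.len_eq e he]
      · simp [edgeInit, Prog.apply, IExpr.eval]
      · simp [edgeInit, Prog.apply, IExpr.eval]
      · simp [edgeInit, Prog.apply, IExpr.eval, h9]
      · simp [edgeInit, Prog.apply, h18]
      · simp [edgeInit, Prog.apply, IExpr.eval, h8, h18, hl.tail_eq e he]
      · simp [edgeInit, Prog.apply, IExpr.eval, h8, h18, hl.head_eq e he]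
      · simp [edgeInit, Prog.apply, h5]
      · rw [List.range_zero, List.map_nil, List.append_nil]
        exact hs.frame (hLF₁.frame τ) (by simp [edgeInit, Prog.intVarsSet])
          (by simp [edgeInit, Prog.intArrsSet]) (by simp [edgeInit, Prog.intArrsSet])
          (by simp [edgeInit, Prog.realArrsSet])
      · rw [List.range_zero, List.map_nil, List.append_nil, ← ht]
        simp [edgeInit, Prog.apply]
    refine ⟨210 * k + 105 * I.len e + 45, hLF₁.andThen (210 * k + 105 * I.len e + 15) ?_
      (Prog.Run.andThen (210 * k + 105 * I.len e + 5) 10 (by omega)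
        ((hinv.run hI he hA).mono (by omega) fun _ _ h => h) ?_)⟩
    · simp only [edgeInit, Prog.maxCost, IExpr.cost]; omega
    · rintro τ₂ hf ⟨j, q, h⟩
      refine hLF₂.run_of_le (by simp [edgeNext, Prog.maxCost, IExpr.cost]) ?_
      refine ⟨(I.m - (e + 1)) * (210 * k + 50) + 105 * (I.numPieces - I.off (e + 1)), ?_,
        e + 1, he, h.loaded.frame (hLF₂.frame τ₂) (by simp [edgeNext, Prog.intVarsSet])
        (by simp [edgeNext, Prog.intArrsSet]) (by simp [edgeNext, Prog.realArrsSet]),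
        ?_, ?_, ?_, ?_, ?_, ?_, rfl⟩
      · have h1 : I.m - e = I.m - (e + 1) + 1 := by omega
        rw [h1, add_mul (I.m - (e + 1)), one_mul]
        simp only [BExpr.cost, IExpr.cost]
        omega
      · simp [edgeNext, Prog.apply, IExpr.eval, h.edge_eq]
      · simp [edgeNext, Prog.apply, IExpr.eval, h.off_eq, h.len_eq, hoff']
      · simp [edgeNext, Prog.apply, h.k_eq]
      · simp [edgeNext, Prog.apply, h.times_eq]
      · rw [InstData.transitList_succ]
        exact h.stored.frame (hLF₂.frame τ₂) (by simp [edgeNext, Prog.intVarsSet])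
          (by simp [edgeNext, Prog.intArrsSet]) (by simp [edgeNext, Prog.intArrsSet])
          (by simp [edgeNext, Prog.realArrsSet])
      · rw [InstData.transitList_succ, ← h.total]
        simp [edgeNext, Prog.apply]

/-! ### Chain edges -/

/-- The chain edges of the first `n` vertices; `k` is the number of blocks. -/
def chainList (k n : ℕ) (c : ℝ) : List (ℤ × ℤ × ℝ) :=
  (List.range n).flatMap fun x : ℕ => (List.range (2 * k - 1)).map fun p : ℕ =>
    ((x * (2 * k) + p : ℤ), (x * (2 * k) + p + 1 : ℤ), c)

theorem chainList_succ (k n : ℕ) (c : ℝ) : chainList k (n + 1) c = chainList k n c ++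
    (List.range (2 * k - 1)).map fun p : ℕ =>
      ((n * (2 * k) + p : ℤ), (n * (2 * k) + p + 1 : ℤ), c) := by
  simp [chainList, List.range_succ]

def chainBody : Prog :=
  .seq (.setI 21 (.add (.var 19) (.var 13))) <|
  .seq (.setI 22 (.add (.var 21) (.const 1))) <|
  .seq emitProg <|
  .setI 13 (.add (.var 13) (.const 1))

theorem chainBody_loopFree : chainBody.LoopFree := by
  simp [chainBody, emitProg, Prog.LoopFree]

/-- Appends the chain edges, whose capacity is the content of real variable `1` plus one. -/
def chainProg : Prog :=
  .seq (.seq (.setI 8 (.const 0)) <| .seq (.setI 19 (.const 0)) <|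
    .setR 2 (.add (.var 1) (.ofInt (.const 1)))) <|
  .loop (.not (.leI (.var 0) (.var 8))) <|
    .seq (.setI 13 (.const 0)) <|
    .seq (.loop (.not (.leI (.mul (.const 2) (.var 18)) (.add (.var 13) (.const 1)))) chainBody) <|
    .seq (.setI 19 (.add (.var 19) (.mul (.const 2) (.var 18)))) (.setI 8 (.add (.var 8) (.const 1)))

theorem chainInner_run {k x : ℕ} {l : List (ℤ × ℤ × ℝ)} {σ : RAMState} {c : ℝ}
    (h18 : σ.intVar 18 = k) (h19 : σ.intVar 19 = x * (2 * k)) (h13 : σ.intVar 13 = 0)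
    (hr : σ.realVar 2 = c) (hs : Stored l σ) :
    (Prog.loop (.not (.leI (.mul (.const 2) (.var 18)) (.add (.var 13) (.const 1)))) chainBody).Run
      σ (2 * k * 60 + 10) fun σ' =>
        Stored (l ++ (List.range (2 * k - 1)).map fun p : ℕ =>
          ((x * (2 * k) + p : ℤ), (x * (2 * k) + p + 1 : ℤ), c)) σ' := by
  have hloop := Prog.Run.loop (p := chainBody)
    (b := .not (.leI (.mul (.const 2) (.var 18)) (.add (.var 13) (.const 1))))
    (fun v τ => ∃ p ≤ 2 * k - 1, τ.intVar 18 = k ∧ τ.intVar 19 = x * (2 * k) ∧ τ.intVar 13 = p ∧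
      τ.realVar 2 = c ∧ Stored (l ++ (List.range p).map fun p : ℕ =>
          ((x * (2 * k) + p : ℤ), (x * (2 * k) + p + 1 : ℤ), c)) τ ∧ v = (2 * k - p) * 60) ?_ _ _
    ⟨0, Nat.zero_le _, h18, h19, h13, hr, by simpa using hs, rfl⟩
  · refine hloop.mono ?_ ?_
    · simp only [BExpr.cost, IExpr.cost]; omega
    · rintro τ - ⟨⟨v, p, hp, h18, -, h13, -, hs, -⟩, hb⟩
      simp only [BExpr.holds, IExpr.eval, not_not, h18, h13] at hb
      obtain rfl : p = 2 * k - 1 := by omega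
      exact hs
  · rintro v τ ⟨p, hp, h18, h19, h13, hr, hs, rfl⟩ hb
    simp only [BExpr.holds, IExpr.eval, h18, h13] at hb
    have hp : p < 2 * k - 1 := by omega
    refine ⟨40, chainBody_loopFree.run_of_le (by
      simp [chainBody, emitProg, Prog.maxCost, IExpr.cost, RExpr.cost]) ⟨(2 * k - (p + 1)) * 60, ?_,
      p + 1, hp, ?_, ?_, ?_, ?_, ?_, rfl⟩⟩
    · simp only [BExpr.cost, IExpr.cost]; omega
    · simp [chainBody, emitProg, Prog.apply, h18]
    · simp [chainBody, emitProg, Prog.apply, h19]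
    · simp [chainBody, emitProg, Prog.apply, IExpr.eval, h13]
    · simp [chainBody, emitProg, Prog.apply, hr]
    · set σ₁ := (Prog.seq (.setI 21 (.add (.var 19) (.var 13)))
        (.setI 22 (.add (.var 21) (.const 1)))).apply τ with hσ₁
      have hLF₁ : (Prog.seq (.setI 21 (.add (.var 19) (.var 13)))
        (.setI 22 (.add (.var 21) (.const 1)))).LoopFree := by simp [Prog.LoopFree]
      have hLF₂ : (Prog.setI 13 (.add (.var 13) (.const 1))).LoopFree := by simp [Prog.LoopFree]
      have h := ((hs.frame (hLF₁.frame τ) (by simp [Prog.intVarsSet]) (by simp [Prog.intArrsSet])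
        (by simp [Prog.intArrsSet]) (by simp [Prog.realArrsSet])).emit).frame (hLF₂.frame _)
        (by simp [Prog.intVarsSet]) (by simp [Prog.intArrsSet])
        (by simp [Prog.intArrsSet]) (by simp [Prog.realArrsSet])
      have e1 : σ₁.intVar 21 = x * (2 * k) + p := by simp [hσ₁, Prog.apply, IExpr.eval, h19, h13]
      have e2 : σ₁.intVar 22 = x * (2 * k) + p + 1 := by
        simp [hσ₁, Prog.apply, IExpr.eval, h19, h13]
      have e3 : σ₁.realVar 2 = c := by simp [hσ₁, Prog.apply, hr]
      rw [← hσ₁, e1, e2, e3] at h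
      rw [List.range_succ, List.map_append, ← List.append_assoc]
      exact h

theorem chainProg_run {I : InstData} {k : ℕ} {l : List (ℤ × ℤ × ℝ)} {σ : RAMState}
    (hσ : I.Loaded σ) (h18 : σ.intVar 18 = k) (hs : Stored l σ) :
    chainProg.Run σ (I.n * (120 * k + 50) + 20) fun σ' =>
      Stored (l ++ chainList k I.n (σ.realVar 1 + 1)) σ' := by
  set c := σ.realVar 1 + 1 with hc
  have hloop := Prog.Run.loop (p := .seq (.setI 13 (.const 0)) <|
    .seq (.loop (.not (.leI (.mul (.const 2) (.var 18)) (.add (.var 13) (.const 1)))) chainBody) <|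
    .seq (.setI 19 (.add (.var 19) (.mul (.const 2) (.var 18)))) (.setI 8 (.add (.var 8) (.const 1))))
    (b := .not (.leI (.var 0) (.var 8)))
    (fun v τ => ∃ x ≤ I.n, τ.intVar 0 = I.n ∧ τ.intVar 8 = x ∧ τ.intVar 18 = k ∧
      τ.intVar 19 = x * (2 * k) ∧ τ.realVar 2 = c ∧ Stored (l ++ chainList k x c) τ ∧
      v = (I.n - x) * (120 * k + 50)) ?_
  · have hLF : (Prog.seq (.setI 8 (.const 0)) <| .seq (.setI 19 (.const 0)) <|
      .setR 2 (.add (.var 1) (.ofInt (.const 1)))).LoopFree := by simp [Prog.LoopFree]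
    refine hLF.andThen (I.n * (120 * k + 50) + 5) ?_ ((hloop
      ((I.n - 0) * (120 * k + 50)) _ ⟨0, Nat.zero_le _, ?_, ?_, ?_, ?_, ?_, ?_, rfl⟩).mono ?_ ?_)
    · simp only [Prog.maxCost, IExpr.cost, RExpr.cost]; omega
    · simp [Prog.apply, hσ.n_eq]
    · simp [Prog.apply, IExpr.eval]
    · simp [Prog.apply, h18]
    · simp [Prog.apply, IExpr.eval]
    · simp [Prog.apply, IExpr.eval, RExpr.eval, hc]
    · simp only [chainList, List.range_zero, List.flatMap_nil, List.append_nil]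
      exact hs.frame (hLF.frame σ) (by simp [Prog.intVarsSet]) (by simp [Prog.intArrsSet])
        (by simp [Prog.intArrsSet]) (by simp [Prog.realArrsSet])
    · simp only [BExpr.cost, IExpr.cost, Nat.sub_zero]; omega
    · rintro τ - ⟨⟨v, x, hx, h0, h8, -, -, -, hs, -⟩, hb⟩
      simp only [BExpr.holds, IExpr.eval, not_not, h0, h8] at hb
      obtain rfl : x = I.n := by omega
      exact hs
  · rintro v τ ⟨x, hx, h0, h8, h18, h19, hr, hs, rfl⟩ hb
    simp only [BExpr.holds, IExpr.eval, h0, h8] at hb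
    have hx : x < I.n := by omega
    have hLF₁ : (Prog.setI 13 (.const 0)).LoopFree := by simp [Prog.LoopFree]
    have hLF₂ : (Prog.seq (.setI 19 (.add (.var 19) (.mul (.const 2) (.var 18))))
      (.setI 8 (.add (.var 8) (.const 1)))).LoopFree := by simp [Prog.LoopFree]
    have hin := chainInner_run (k := k) (x := x) (c := c) (l := l ++ chainList k x c)
      (σ := (Prog.setI 13 (.const 0)).apply τ) (by simp [Prog.apply, h18])
      (by simp [Prog.apply, h19]) (by simp [Prog.apply, IExpr.eval]) (by simp [Prog.apply, hr])
      (hs.frame (hLF₁.frame τ) (by simp [Prog.intVarsSet]) (by simp [Prog.intArrsSet])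
        (by simp [Prog.intArrsSet]) (by simp [Prog.realArrsSet]))
    refine ⟨120 * k + 30, hLF₁.andThen (120 * k + 28) (by simp [Prog.maxCost, IExpr.cost]; omega)
      (Prog.Run.andThen (2 * k * 60 + 10) 15 (by omega) hin ?_)⟩
    intro τ₂ hf hs₂
    have g : ∀ y ∉ [21, 22, 17, 13], τ₂.intVar y = τ.intVar y := by
      intro y hy
      have h1 := hf.intVar y (by simpa [chainBody, emitProg, Prog.intVarsSet] using hy)
      have h2 := (hLF₁.frame τ).intVar y (by simp at hy; simp [Prog.intVarsSet]; omega)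
      rw [h1, h2]
    have g2 : τ₂.realVar 2 = c := by
      rw [hf.realVar 2 (by simp [chainBody, emitProg, Prog.realVarsSet])]
      simp [Prog.apply, hr]
    refine hLF₂.run_of_le (by simp [Prog.maxCost, IExpr.cost])
      ⟨(I.n - (x + 1)) * (120 * k + 50), ?_, x + 1, hx, ?_, ?_, ?_, ?_, ?_, ?_, rfl⟩
    · have h1 : I.n - x = I.n - (x + 1) + 1 := by omega
      rw [h1, add_mul (I.n - (x + 1)), one_mul]
      simp only [BExpr.cost, IExpr.cost]
      omega
    · simp [Prog.apply, g 0 (by simp), h0]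
    · simp [Prog.apply, IExpr.eval, g 8 (by simp), h8]
    · simp [Prog.apply, g 18 (by simp), h18]
    · simp [Prog.apply, IExpr.eval, g 18 (by simp), g 19 (by simp), h18, h19]; ring
    · simp [Prog.apply, g2]
    · rw [chainList_succ, ← List.append_assoc]
      exact hs₂.frame (hLF₂.frame τ₂) (by simp [Prog.intVarsSet]) (by simp [Prog.intArrsSet])
        (by simp [Prog.intArrsSet]) (by simp [Prog.realArrsSet])

/-- The memory that holds `n`, the length of `l`, `s`, `d` and the list `l` of edges. -/
def listState (n s d : ℤ) (l : List (ℤ × ℤ × ℝ)) : RAMState where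
  intVar := fun x => memOfList [n, (l.length : ℤ), s, d] x
  realVar := fun _ => 0
  intArr := fun a =>
    if a = 0 then memOfList (l.map fun x => x.1)
    else if a = 1 then memOfList (l.map fun x => x.2.1)
    else fun _ => 0
  realArr := fun a => if a = 0 then memOfList (l.map fun x => x.2.2) else fun _ => 0

/-! ### Assembly of the building program -/

namespace InstData

/-- The number of blocks of the condensed network that is built from `I`. -/
def numBlocks (I : InstData) : ℕ := (2 * I.range + 1) * (I.numPieces + 1) - 1

theorem numBlocks_pos (I : InstData) : 1 ≤ I.numBlocks := by
  have h : 1 ≤ I.range := by simp [range]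
  have : 3 * 1 ≤ (2 * I.range + 1) * (I.numPieces + 1) := Nat.mul_le_mul (by omega) (by omega)
  rw [numBlocks]; omega

theorem numBlocks_add_one (I : InstData) :
    I.numBlocks + 1 = (2 * I.range + 1) * (I.numPieces + 1) := by
  have := I.numBlocks_pos
  rw [numBlocks] at this ⊢; omega

/-- The starting times of the blocks, followed by `T + 1`. -/
structure Blocks (I : InstData) (A : ℤ → ℤ) : Prop where
  mono : ∀ a b : ℕ, a ≤ b → b ≤ I.numBlocks → A a ≤ A b
  nonneg : ∀ a : ℕ, a ≤ I.numBlocks → 0 ≤ A a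
  le_horizon : ∀ a : ℕ, a ≤ I.numBlocks → A a ≤ I.T + 1
  horizon_mem : ∀ l : ℤ, |l| ≤ I.range → ∃ a ≤ I.numBlocks, A (a : ℕ) = clip I.T (I.T + 1 + l * I.τ)
  -- Starting times are clipped to [0, T + 1] before the shift as well as after it. Nothing is lost,
  -- because `pieceTimes` consists of clipped times.
  piece_mem : ∀ e < I.m, ∀ q < I.len e, ∀ l : ℤ, |l| ≤ I.range →
    ∃ a ≤ I.numBlocks, A (a : ℕ) = clip I.T (clip I.T (I.tm e q) + l * I.τ)

/-- The edges of the condensed network. -/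
noncomputable def edgeList (I : InstData) (A : ℤ → ℤ) : List (ℤ × ℤ × ℝ) :=
  I.transitList A I.numBlocks I.m ++ chainList I.numBlocks I.n
    (((I.transitList A I.numBlocks I.m).map fun x => x.2.2).sum + 1)

def buildCost (I : InstData) : ℕ :=
  14 + (I.m * (50 * (I.numPieces + 1) + 50) + 30 +
  ((2 * I.range + 1) * (50 * ((2 * I.range + 1) * (I.numPieces + 1)) + 50) + 30 +
  (I.m * (210 * I.numBlocks + 50) + 105 * I.numPieces + 20 +
  (I.n * (120 * I.numBlocks + 50) + 20 + 40))))

end InstData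

def headerProg : Prog :=
  .seq (.setI 32 (.mul (.var 0) (.mul (.const 2) (.var 18)))) <|
  .seq (.setI 33 (.var 17)) <|
  .seq (.setI 34 (.mul (.var 2) (.mul (.const 2) (.var 18)))) <|
  .setI 35 (.add (.mul (.var 3) (.mul (.const 2) (.var 18)))
    (.mul (.const 2) (.sub (.var 18) (.const 1))))

/-- Stores the condensed network from the variables and arrays `32` on. -/
def buildProg : Prog :=
  .seq rangeProg <| .seq changeProg <| .seq timesProg <| .seq transitProg <|
    .seq chainProg headerProg

/-- Besides the contents of the lists, all other cells from address 32 on must still be zero; the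
frame conditions of the stages provide this. -/
theorem buildProg_run {I : InstData} (hI : I.Valid) {σ : RAMState} (hσ : I.Loaded σ)
    (hz : σ.view 32 = ⟨fun _ => 0, fun _ => 0, fun _ _ => 0, fun _ _ => 0⟩) :
    buildProg.Run σ I.buildCost fun σ' => ∃ A, I.Blocks A ∧ σ'.view 32 =
      listState (I.n * (2 * I.numBlocks) : ℕ) (I.s * (2 * I.numBlocks) : ℕ)
        (I.d * (2 * I.numBlocks) + 2 * (I.numBlocks - 1) : ℕ) (I.edgeList A) := by
  have hk := I.numBlocks_pos
  have hk1 := I.numBlocks_add_one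
  have z1 : ∀ x, σ.intVar (x + 32) = 0 := fun x => congrFun (congrArg RAMState.intVar hz) x
  have z2 : ∀ x, σ.realVar (x + 32) = 0 := fun x => congrFun (congrArg RAMState.realVar hz) x
  have z3 : ∀ x, σ.intArr (x + 32) = fun _ => 0 := fun x => congrFun (congrArg RAMState.intArr hz) x
  have z4 : ∀ x, σ.realArr (x + 32) = fun _ => 0 :=
    fun x => congrFun (congrArg RAMState.realArr hz) x
  refine Prog.Run.andThen 14 _ le_rfl (rangeProg_run hσ) fun σ₁ f₁ r₁ => ?_
  have l₁ : I.Loaded σ₁ := hσ.frame f₁ (by simp [rangeProg, Prog.intVarsSet])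
    (by simp [rangeProg, Prog.intArrsSet]) (by simp [rangeProg, Prog.realArrsSet])
  refine Prog.Run.andThen _ _ le_rfl (changeProg_run hI l₁) fun σ₂ f₂ r₂ => ?_
  have l₂ : I.Loaded σ₂ := l₁.frame f₂
    (by simp [changeProg, changeBody, mergeProg, mergeStep, Prog.intVarsSet])
    (by simp [changeProg, changeBody, mergeProg, mergeStep, Prog.intArrsSet])
    (by simp [changeProg, changeBody, mergeProg, mergeStep, Prog.realArrsSet])
  obtain ⟨h7, hs4, ⟨p₀, hp₀, hp₀', hT4⟩, hm4⟩ := r₂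
  have h6 : σ₂.intVar 6 = I.range := by
    rw [f₂.intVar 6 (by simp [changeProg, changeBody, mergeProg, mergeStep, Prog.intVarsSet]), r₁]
  refine Prog.Run.andThen _ _ le_rfl (timesProg_run l₂ h6 h7 hs4) fun σ₃ f₃ r₃ => ?_
  have l₃ : I.Loaded σ₃ := l₂.frame f₃
    (by simp [timesProg, timesBody, mergeProg, mergeStep, Prog.intVarsSet])
    (by simp [timesProg, timesBody, mergeProg, mergeStep, Prog.intArrsSet])
    (by simp [timesProg, timesBody, mergeProg, mergeStep, Prog.realArrsSet])
  rw [← hk1] at r₃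
  obtain ⟨h18, hs5, hm5⟩ := r₃
  have h18 : σ₃.intVar 18 = I.numBlocks := by rw [h18]; push_cast; ring
  have hA : ∀ l : ℤ, |l| ≤ I.range → ∀ q : ℤ, 0 ≤ q → q < (I.numPieces + 1 : ℕ) →
      ∃ a ≤ I.numBlocks, σ₃.intArr 5 (a : ℕ) = clip I.T (σ₂.intArr 4 q + l * I.τ) := by
    intro l hl q h1 h2
    obtain ⟨p, h3, h4, h5⟩ := hm5 l hl q h1 h2
    lift p to ℕ using h3
    exact ⟨p, by omega, h5⟩
  have hB : I.Blocks (σ₃.intArr 5) := by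
    refine ⟨fun a b hab hb => hs5.mono _ _ (by omega) (by omega) (by omega),
      fun a ha => hs5.nonneg _ (by omega) (by omega),
      fun a ha => hs5.le_horizon _ (by omega) (by omega), fun l hl => ?_,
      fun e he q hq l hl => ?_⟩
    · obtain ⟨a, h1, h2⟩ := hA l hl p₀ hp₀ hp₀'
      exact ⟨a, h1, by rw [h2, hT4]⟩
    · obtain ⟨p, h0, h1, h2⟩ := hm4 e he q hq
      obtain ⟨a, h3, h4⟩ := hA l hl p h0 h1
      exact ⟨a, h3, by rw [h4, h2]⟩
  have g₃ : ∀ a, σ₃.intArr (a + 32) = fun _ => 0 := by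
    intro a
    rw [f₃.intArr _ (by simp [timesProg, timesBody, mergeProg, mergeStep, Prog.intArrsSet]),
      f₂.intArr _ (by simp [changeProg, changeBody, mergeProg, mergeStep, Prog.intArrsSet]),
      f₁.intArr _ (by simp [rangeProg, Prog.intArrsSet]), z3]
  have g₃' : ∀ a, σ₃.realArr (a + 32) = fun _ => 0 := by
    intro a
    rw [f₃.realArr _ (by simp [timesProg, timesBody, mergeProg, mergeStep, Prog.realArrsSet]),
      f₂.realArr _ (by simp [changeProg, changeBody, mergeProg, mergeStep, Prog.realArrsSet]),
      f₁.realArr _ (by simp [rangeProg, Prog.realArrsSet]), z4]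
  refine Prog.Run.andThen _ _ le_rfl (transitProg_run hI hk hB.mono l₃ h18 rfl
    ⟨g₃ 0, g₃ 1, g₃' 0⟩) fun σ₄ f₄ r₄ => ?_
  have l₄ : I.Loaded σ₄ := l₃.frame f₄
    (by simp [transitProg, edgeInit, edgeNext, transitBody, transitEmit, emitProg,
      Prog.intVarsSet])
    (by simp [transitProg, edgeInit, edgeNext, transitBody, transitEmit, emitProg,
      Prog.intArrsSet])
    (by simp [transitProg, edgeInit, edgeNext, transitBody, transitEmit, emitProg,
      Prog.realArrsSet])
  have h18₄ : σ₄.intVar 18 = I.numBlocks := by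
    rw [f₄.intVar 18 (by simp [transitProg, edgeInit, edgeNext, transitBody, transitEmit, emitProg,
      Prog.intVarsSet]), h18]
  refine Prog.Run.andThen _ _ le_rfl (chainProg_run l₄ h18₄ r₄.1) fun σ₅ f₅ r₅ => ?_
  have l₅ : I.Loaded σ₅ := l₄.frame f₅
    (by simp [chainProg, chainBody, emitProg, Prog.intVarsSet])
    (by simp [chainProg, chainBody, emitProg, Prog.intArrsSet])
    (by simp [chainProg, chainBody, emitProg, Prog.realArrsSet])
  have h18₅ : σ₅.intVar 18 = I.numBlocks := by
    rw [f₅.intVar 18 (by simp [chainProg, chainBody, emitProg, Prog.intVarsSet]), h18₄]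
  rw [r₄.2] at r₅
  have hLF : headerProg.LoopFree := by simp [headerProg, Prog.LoopFree]
  refine hLF.run_of_le (by simp [headerProg, Prog.maxCost, IExpr.cost]) ⟨_, hB, ?_⟩
  have f₆ := hLF.frame σ₅
  have v1 : ∀ x, (headerProg.apply σ₅).intVar (x + 4 + 32) = 0 := by
    intro x
    rw [f₆.intVar _ (by simp [headerProg, Prog.intVarsSet]),
      f₅.intVar _ (by simp [chainProg, chainBody, emitProg, Prog.intVarsSet]),
      f₄.intVar _ (by simp [transitProg, edgeInit, edgeNext, transitBody, transitEmit, emitProg,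
        Prog.intVarsSet]),
      f₃.intVar _ (by simp [timesProg, timesBody, mergeProg, mergeStep, Prog.intVarsSet]),
      f₂.intVar _ (by simp [changeProg, changeBody, mergeProg, mergeStep, Prog.intVarsSet]),
      f₁.intVar _ (by simp [rangeProg, Prog.intVarsSet]), z1]
  have v2 : ∀ x, (headerProg.apply σ₅).realVar (x + 32) = 0 := by
    intro x
    rw [f₆.realVar _ (by simp [headerProg, Prog.realVarsSet]),
      f₅.realVar _ (by simp [chainProg, chainBody, emitProg, Prog.realVarsSet]),
      f₄.realVar _ (by simp [transitProg, edgeInit, edgeNext, transitBody, transitEmit, emitProg,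
        Prog.realVarsSet]),
      f₃.realVar _ (by simp [timesProg, timesBody, mergeProg, mergeStep, Prog.realVarsSet]),
      f₂.realVar _ (by simp [changeProg, changeBody, mergeProg, mergeStep, Prog.realVarsSet]),
      f₁.realVar _ (by simp [rangeProg, Prog.realVarsSet]), z2]
  have v3 : ∀ x, (headerProg.apply σ₅).intArr (x + 2 + 32) = fun _ => 0 := by
    intro x
    rw [f₆.intArr _ (by simp [headerProg, Prog.intArrsSet]),
      f₅.intArr _ (by simp [chainProg, chainBody, emitProg, Prog.intArrsSet]),
      f₄.intArr _ (by simp [transitProg, edgeInit, edgeNext, transitBody, transitEmit, emitProg,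
        Prog.intArrsSet]), g₃]
  have v4 : ∀ x, (headerProg.apply σ₅).realArr (x + 1 + 32) = fun _ => 0 := by
    intro x
    rw [f₆.realArr _ (by simp [headerProg, Prog.realArrsSet]),
      f₅.realArr _ (by simp [chainProg, chainBody, emitProg, Prog.realArrsSet]),
      f₄.realArr _ (by simp [transitProg, edgeInit, edgeNext, transitBody, transitEmit, emitProg,
        Prog.realArrsSet]), g₃']
  have r₆ := r₅.frame f₆ (by simp [headerProg, Prog.intVarsSet])
    (by simp [headerProg, Prog.intArrsSet]) (by simp [headerProg, Prog.intArrsSet])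
    (by simp [headerProg, Prog.realArrsSet])
  simp only [RAMState.view, listState, RAMState.mk.injEq]
  refine ⟨funext fun x => ?_, funext v2, funext fun x => ?_, funext fun x => ?_⟩
  · rw [memOfList_natCast]
    match x with
    | 0 => simp [headerProg, Prog.apply, IExpr.eval, l₅.n_eq, h18₅]
    | 1 => simp [headerProg, Prog.apply, IExpr.eval, r₅.length_eq, InstData.edgeList]
    | 2 => simp [headerProg, Prog.apply, IExpr.eval, l₅.s_eq, h18₅]
    | 3 =>
      simp [headerProg, Prog.apply, IExpr.eval, l₅.d_eq, h18₅, Nat.cast_sub hk]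
    | x + 4 => rw [v1]; simp
  · match x with
    | 0 => simpa [InstData.edgeList] using r₆.tail_eq
    | 1 => simpa [InstData.edgeList] using r₆.head_eq
    | x + 2 => rw [v3]; simp
  · match x with
    | 0 => simpa [InstData.edgeList] using r₆.cap_eq
    | x + 1 => rw [v4]; simp

/-! ### The network on the stored list of edges -/

namespace FlowNetwork

/-- The network with the source `s`, the sink `d` and the edges in the list `L`, where the edge `i`
joins the pair `pr i` and has capacity `c i`. -/
theorem exists_initState_eq {ι : Type*} [Fintype ι] {N : ℕ} {pr : ι → Fin N × Fin N}
    (hpr : Function.Injective pr) (c : ι → ℝ≥0) (s d : Fin N) {L : List ι} (hL : L.Nodup)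
    (hL' : ∀ i, i ∈ L) :
    ∃ G : FlowNetwork (Fin N), G.source = s ∧ G.sink = d ∧ (∀ p, p ∈ G.E ↔ ∃ i, pr i = p) ∧
      (∀ i, G.cap (pr i) = c i) ∧ G.E.card = L.length ∧
      ∃ edge : Fin G.E.card ≃ G.E, G.initState edge = listState N (s : ℕ) (d : ℕ)
        (L.map fun i => (((pr i).1 : ℕ), ((pr i).2 : ℕ), (c i : ℝ))) := by
  classical
  let G : FlowNetwork (Fin N) := ⟨Finset.univ.image pr,
    Function.extend pr (fun i => (c i : ℝ≥0∞)) 0, s, d⟩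
  have hmem : ∀ p, p ∈ G.E ↔ ∃ i, pr i = p := by simp [G]
  have hcap : ∀ i, G.cap (pr i) = c i := fun i =>
    show Function.extend pr (fun i => (c i : ℝ≥0∞)) 0 (pr i) = _ from hpr.extend_apply _ _ _
  let eL : Fin L.length ≃ ι := hL.getEquivOfForallMemList L hL'
  have hcard : G.E.card = L.length := by
    rw [show G.E.card = Fintype.card ι from Finset.card_image_of_injective _ hpr,
      ← Fintype.card_congr eL, Fintype.card_fin]
  let eG : ι ≃ G.E := Equiv.ofBijective (fun i => ⟨pr i, (hmem _).2 ⟨i, rfl⟩⟩)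
    ⟨fun i j h => hpr (congrArg Subtype.val h), fun p => by
      obtain ⟨i, hi⟩ := (hmem p).1 p.2
      exact ⟨i, Subtype.ext hi⟩⟩
  let edge := ((finCongr hcard).trans eL).trans eG
  have hedge : ∀ j (hj : j < L.length), ((edge ⟨j, hcard ▸ hj⟩ : G.E) : Fin N × Fin N) = pr L[j] :=
    fun j hj => rfl
  refine ⟨G, rfl, rfl, hmem, hcap, hcard, edge, ?_⟩
  have key : ∀ {α : Type} (g : Fin N × Fin N → α) (h : ι → α), (∀ i, g (pr i) = h i) →
      (List.ofFn fun j => g (edge j)) = L.map h := by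
    intro α g h hgh
    refine List.ext_getElem (by simp [hcard]) fun j h1 h2 => ?_
    have hj : j < L.length := by simpa using h2
    rw [List.getElem_ofFn, List.getElem_map, ← hgh, ← hedge j hj]
  simp only [initState, listState, RAMState.mk.injEq, true_and, List.map_map, List.length_map]
  refine ⟨?_, ?_, ?_⟩
  · rw [← hcard]
  · rw [key (fun p => ((p.1 : ℕ) : ℤ)) _ fun i => rfl, key (fun p => ((p.2 : ℕ) : ℤ)) _ fun i => rfl]
    rfl
  · rw [key (fun p => (G.cap p).toReal) (fun i => (c i : ℝ)) fun i => by rw [hcap]; rfl]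
    rfl

open Classical in
/-- The maximum flow value of a network with edges of a second kind that have a large capacity. -/
theorem isGreatest_flowValues_of_cut {W ι κ : Type*} [Fintype W] [Fintype ι] [Fintype κ]
    {pr : ι ⊕ κ → W × W} (hpr : Function.Injective pr) (c : ι → ℝ≥0) {G : FlowNetwork W}
    (hE : ∀ p, p ∈ G.E ↔ ∃ i, pr i = p) (hcap : ∀ i, G.cap (pr i) =
      (Sum.elim c (fun _ => ∑ i, c i + 1) i : ℝ≥0)) {v : ℝ}
    (hle : ∀ S : Set W, G.source ∈ S → G.sink ∉ S →
      (∀ h, (pr (.inr h)).1 ∈ S → (pr (.inr h)).2 ∈ S) →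
      v ≤ ∑ i, if (pr (.inl i)).1 ∈ S ∧ (pr (.inl i)).2 ∉ S then (c i : ℝ) else 0)
    (hge : ∃ S : Set W, G.source ∈ S ∧ G.sink ∉ S ∧
      (∀ h, (pr (.inr h)).1 ∈ S → (pr (.inr h)).2 ∈ S) ∧
      ∑ i, (if (pr (.inl i)).1 ∈ S ∧ (pr (.inl i)).2 ∉ S then (c i : ℝ) else 0) ≤ v) :
    IsGreatest G.flowValues v := by
  obtain ⟨S₀, hs₀, ht₀, hc₀, hv₀⟩ := hge
  have hub : ∀ w ∈ G.flowValues, w ≤ v := by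
    rintro w ⟨f, hf, rfl⟩
    refine (flow_value_le_cut hf S₀ hs₀ ht₀ _ ?_ ?_).trans hv₀
    · exact Finset.sum_nonneg fun i _ => by split_ifs; exacts [(c i).2, le_rfl]
    · have hEi : G.E = Finset.univ.image pr := by ext p; simp [hE]
      rw [Finset.sum_filter, hEi, Finset.sum_image fun i _ j _ h => hpr h, Fintype.sum_sum_type,
        ENNReal.ofReal_sum_of_nonneg fun i _ => by split_ifs; exacts [(c i).2, le_rfl]]
      have h0 : ∑ h : κ, (if (pr (.inr h)).1 ∈ S₀ ∧ (pr (.inr h)).2 ∉ S₀ then G.cap (pr (.inr h))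
          else 0) = 0 :=
        Finset.sum_eq_zero fun h _ => if_neg fun hh => hh.2 (hc₀ h hh.1)
      rw [h0, add_zero]
      refine Finset.sum_le_sum fun i _ => ?_
      split_ifs
      · rw [hcap]; simp
      · simp
  -- The minimum cut obtained here avoids the edges of the second kind, so `hle` applies to it.
  obtain ⟨f, hf, S, hs, ht, hcl, hval⟩ := exists_maxFlow_minCut_sum (fun e => (pr e).1)
    (fun e => (pr e).2) (fun i => (c i : ℝ)) (fun i => (c i).2) S₀ hs₀ ht₀ hc₀
  have hmem := mem_flowValues_of_multiFlow (src := fun e => (pr e).1) (dst := fun e => (pr e).2) f G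
    hf.nonneg (fun p => ?_) (fun p hp e he => absurd ((hE p).2 ⟨e, he⟩) hp) hf.conservation
  · have h1 := hub _ hmem
    have h2 := hle S hs ht hcl
    rw [← hval] at h2
    rw [le_antisymm h2 h1]
    exact ⟨hmem, h1.antisymm h2 ▸ hub⟩
  · by_cases hp : ∃ i, pr i = p
    · obtain ⟨i, rfl⟩ := hp
      rw [Finset.sum_eq_single i (fun j _ hj => if_neg fun h => hj (hpr h)) (by simp),
        if_pos rfl, hcap]
      have := hf.le_capacity i
      refine ENNReal.ofReal_le_of_le_toReal (this.trans_eq ?_)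
      rw [ENNReal.coe_toReal]
      rcases i with i | i <;> simp
    · rw [Finset.sum_eq_zero fun j _ => if_neg fun h => hp ⟨j, h⟩]
      simp

end FlowNetwork

/-! ### Block boundaries and the cost of a cut block by block -/

namespace InstData

/-- The data `I` describe the temporal network `N`. -/
structure Represents (I : InstData) (N : TemporalNetwork (Fin I.n)) (ed : Fin I.m ≃ N.E) :
    Prop where
  τ_eq : N.τ = I.τ
  s_eq : I.s = N.s
  d_eq : I.d = N.d
  tl_eq : ∀ e : Fin I.m, I.tl e = (ed e : Fin I.n × Fin I.n).1
  hd_eq : ∀ e : Fin I.m, I.hd e = (ed e : Fin I.n × Fin I.n).2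
  u_eq : ∀ (e : Fin I.m) (q : ℕ), q < I.len e → ∀ t : ℤ, I.tm e q ≤ t →
    (q + 1 < I.len e → t < I.tm e (q + 1)) → (N.u (ed e) t : ℝ) = I.vl e q

namespace Blocks

variable {I : InstData} {A : ℤ → ℤ} (hB : I.Blocks A)

include hB

theorem lt_of_lt {a b : ℕ} (ha : a ≤ I.numBlocks) (h : A a < A b) : a < b := by
  by_contra hab
  exact absurd (hB.mono b a (not_lt.1 hab) ha) (not_le.2 h)

theorem last_eq : A I.numBlocks = I.T + 1 := by
  obtain ⟨a, ha, h⟩ := hB.horizon_mem 0 (by simp)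
  have h1 := hB.mono a I.numBlocks ha le_rfl
  have h2 := hB.le_horizon I.numBlocks le_rfl
  rw [h, zero_mul, add_zero, clip_of_mem (by positivity) le_rfl] at h1
  omega

/-- The first piece of any edge starts at a time ≤ 0, which is clipped to 0; hence time 0 needs no
separate insertion. -/
theorem first_eq (hI : I.Valid) : A (0 : ℕ) = 0 := by
  obtain ⟨a, ha, h⟩ := hB.piece_mem 0 hI.m_pos 0 (hI.len_pos 0 hI.m_pos) 0 (by simp)
  have h1 := hB.mono 0 a (Nat.zero_le _) ha
  have h2 := hB.nonneg 0 (Nat.zero_le _)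
  have h3 := hI.tm_zero 0 hI.m_pos
  simp only [clip] at h
  omega

/-- Within a block no capacity changes. -/
theorem u_eq (hI : I.Valid) {N : TemporalNetwork (Fin I.n)} {ed : Fin I.m ≃ N.E}
    (hR : I.Represents N ed) (e : Fin I.m) {i : ℕ} (hi : i < I.numBlocks) {t : ℤ}
    (h1 : A (i : ℕ) ≤ t) (h2 : t < A ((i + 1 : ℕ))) :
    (N.u (ed e) t : ℝ) = I.vl e (I.pieceIdx A e i) := by
  have hlen := hI.len_pos e e.2
  have h0 := hB.nonneg i hi.le
  have hle : I.pieceIdx A e i ≤ I.len e - 1 := Nat.findGreatest_le _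
  have hspec : I.tm e (I.pieceIdx A e i) ≤ A (i : ℕ) :=
    Nat.findGreatest_spec (P := fun q => I.tm e q ≤ A (i : ℕ)) (Nat.zero_le _)
      ((hI.tm_zero e e.2).trans h0)
  refine hR.u_eq e _ (by omega) t (hspec.trans h1) fun hq => ?_
  have hgt : A (i : ℕ) < I.tm e (I.pieceIdx A e i + 1) := by
    by_contra hle'
    exact Nat.findGreatest_is_greatest (P := fun q => I.tm e q ≤ A (i : ℕ)) (n := I.len e - 1)
      (k := I.pieceIdx A e i + 1) (Nat.lt_succ_self (I.pieceIdx A e i)) (by omega) (not_lt.1 hle')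
  -- The start of the next piece, clipped, is itself a boundary after block i, so block i ends no
  -- later.
  obtain ⟨a, ha, h⟩ := hB.piece_mem e e.2 _ hq 0 (by simp)
  have hT := hB.le_horizon (i + 1) hi
  have hai : i < a := hB.lt_of_lt hi.le (by rw [h]; simp only [clip]; omega)
  have := hB.mono (i + 1) a hai ha
  rw [h] at this
  simp only [clip] at this
  omega

theorem transitCap_eq (hI : I.Valid) {N : TemporalNetwork (Fin I.n)} {ed : Fin I.m ≃ N.E}
    (hR : I.Represents N ed) (e : Fin I.m) {i : ℕ} (hi : i < I.numBlocks) :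
    I.transitCap A e i = if A (i : ℕ) + I.τ ≤ I.T then
      ∑ t ∈ Finset.Ico (A (i : ℕ)) (A (i + 1 : ℕ)), (N.u (ed e) t : ℝ) else 0 := by
  rw [transitCap]
  split_ifs
  · rw [Finset.sum_congr rfl fun t ht => hB.u_eq hI hR e hi (Finset.mem_Ico.1 ht).1
      (Finset.mem_Ico.1 ht).2, Finset.sum_const, Int.card_Ico, nsmul_eq_mul, mul_comm]
    have := hB.mono i (i + 1) (Nat.le_succ _) hi
    push_cast at this ⊢
    rw [← Int.cast_natCast (R := ℝ) (Int.toNat _), Int.toNat_of_nonneg (by omega)]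
    push_cast; rfl
  · rfl

theorem transitCap_nonneg (hI : I.Valid) {N : TemporalNetwork (Fin I.n)} {ed : Fin I.m ≃ N.E}
    (hR : I.Represents N ed) (e : Fin I.m) {i : ℕ} (hi : i < I.numBlocks) :
    0 ≤ I.transitCap A e i := by
  rw [hB.transitCap_eq hI hR e hi]
  split_ifs
  exacts [Finset.sum_nonneg fun _ _ => NNReal.coe_nonneg _, le_rfl]

theorem sum_blocks (g : ℤ → ℝ) (a : ℕ) (ha : a ≤ I.numBlocks) :
    ∑ i ∈ Finset.range a, ∑ t ∈ Finset.Ico (A (i : ℕ)) (A (i + 1 : ℕ)), g t =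
      ∑ t ∈ Finset.Ico (A (0 : ℕ)) (A (a : ℕ)), g t := by
  induction a with
  | zero => simp
  | succ a ih =>
    rw [Finset.sum_range_succ, ih (by omega), ← Finset.sum_union
      (Finset.Ico_disjoint_Ico_consecutive _ _ _), Finset.Ico_union_Ico_eq_Ico
      (hB.mono 0 a (Nat.zero_le _) (by omega)) (hB.mono a (a + 1) (Nat.le_succ _) ha)]

/-- The cost of a cut as a sum over blocks. -/
theorem cutCost_eq (hI : I.Valid) {N : TemporalNetwork (Fin I.n)} {ed : Fin I.m ≃ N.E}
    (hR : I.Represents N ed) {α : Fin I.n → ℤ} (hα : N.IsTimeCut I.T α) :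
    N.cutCost α = ∑ p : Fin I.m × Fin I.numBlocks,
      ∑ t ∈ Finset.Ico (A ((p.2 : ℕ) : ℤ)) (A ((p.2 : ℕ) + 1 : ℕ)),
        if α (ed p.1 : Fin I.n × Fin I.n).1 ≤ t ∧ t < α (ed p.1 : Fin I.n × Fin I.n).2 - I.τ
          then (N.u (ed p.1) t : ℝ) else 0 := by
  rw [TemporalNetwork.cutCost, ← Finset.sum_coe_sort, ← ed.sum_comp, Fintype.sum_prod_type]
  refine Finset.sum_congr rfl fun e _ => ?_
  rw [Fin.sum_univ_eq_sum_range (fun i => ∑ t ∈ Finset.Ico (A ((i : ℕ) : ℤ)) (A (i + 1 : ℕ)),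
        if α (ed e : Fin I.n × Fin I.n).1 ≤ t ∧ t < α (ed e : Fin I.n × Fin I.n).2 - I.τ
          then (N.u (ed e) t : ℝ) else 0), hB.sum_blocks _ _ le_rfl, hB.first_eq hI, hB.last_eq,
    ← Finset.sum_filter, hR.τ_eq]
  refine Finset.sum_congr ?_ fun _ _ => rfl
  ext t
  have h1 := hα.nonneg (ed e : Fin I.n × Fin I.n).1
  have h2 := hα.le_horizon (ed e : Fin I.n × Fin I.n).2
  simp only [Finset.mem_Ico, Finset.mem_filter]
  omega

end Blocks

end InstData

/-! ### Numbering of the nodes and edges -/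

namespace InstData

variable (I : InstData) {N : TemporalNetwork (Fin I.n)} (ed : Fin I.m ≃ N.E) (A : ℤ → ℤ)

/-- The node number `p` of the vertex `x`. -/
def node (x : Fin I.n) (p : ℕ) (hp : p < 2 * I.numBlocks) : Fin (I.n * (2 * I.numBlocks)) :=
  finProdFinEquiv (x, ⟨p, hp⟩)

variable {I} in
theorem node_inj {x y : Fin I.n} {p q : ℕ} {hp hq} (h : I.node x p hp = I.node y q hq) :
    x = y ∧ p = q := by
  have := finProdFinEquiv.injective h
  simpa using this

theorem node_val (x : Fin I.n) (p : ℕ) (hp) :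
    (I.node x p hp : ℕ) = x * (2 * I.numBlocks) + p := by
  simp [node, finProdFinEquiv_apply_val]; ring

variable {I} in
theorem headIdx_lt (i : ℕ) : I.headIdx A I.numBlocks i < I.numBlocks := by
  have h1 := I.numBlocks_pos
  have h2 : I.headIdx A I.numBlocks i ≤ I.numBlocks - 1 := Nat.findGreatest_le _
  omega

/-- The edges of the condensed network. -/
abbrev Index : Type := (Fin I.m × Fin I.numBlocks) ⊕ (Fin I.n × Fin (2 * I.numBlocks - 1))

def indexList : List I.Index :=
  (List.finRange I.m ×ˢ List.finRange I.numBlocks).map .inl ++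
    (List.finRange I.n ×ˢ List.finRange (2 * I.numBlocks - 1)).map .inr

def ends : I.Index → Fin (I.n * (2 * I.numBlocks)) × Fin (I.n * (2 * I.numBlocks))
  | .inl p => (I.node (ed p.1 : Fin I.n × Fin I.n).1 (2 * p.2) (by omega),
      I.node (ed p.1 : Fin I.n × Fin I.n).2 (2 * I.headIdx A I.numBlocks p.2)
        (by have := headIdx_lt (I := I) A p.2; omega))
  | .inr p => (I.node p.1 p.2 (by omega), I.node p.1 (p.2 + 1) (by omega))

noncomputable def blockCap (p : Fin I.m × Fin I.numBlocks) : ℝ≥0 :=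
  (I.transitCap A p.1 p.2).toNNReal

/-- Transit edges join even positions, chain edges join positions of different parity, so the two
kinds never coincide. Within each kind, the vertices and the position of the tail determine the
edge. This is why blocks are spread over two positions: a network has at most one edge per pair. -/
theorem ends_injective : Function.Injective (I.ends ed A) := by
  rintro (⟨e, i⟩ | ⟨x, p⟩) (⟨e', i'⟩ | ⟨x', p'⟩) h
  · obtain ⟨h1, h2⟩ := Prod.ext_iff.1 h
    have h3 := node_inj h1
    have h4 := node_inj h2
    have he : e = e' := ed.injective (Subtype.ext (Prod.ext h3.1 h4.1))
    have hi : i = i' := Fin.ext (by have := h3.2; simp only at this; omega)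
    rw [he, hi]
  · obtain ⟨h1, h2⟩ := Prod.ext_iff.1 h
    have h3 := (node_inj h1).2
    have h4 := (node_inj h2).2
    simp only at h3 h4
    omega
  · obtain ⟨h1, h2⟩ := Prod.ext_iff.1 h
    have h3 := (node_inj h1).2
    have h4 := (node_inj h2).2
    simp only at h3 h4
    omega
  · obtain ⟨h1, h2⟩ := Prod.ext_iff.1 h
    have h3 := node_inj h1
    have hx : x = x' := h3.1
    have hp : p = p' := Fin.ext h3.2
    rw [hx, hp]

theorem indexList_nodup : I.indexList.Nodup := by
  refine List.Nodup.append ?_ ?_ ?_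
  · exact ((List.nodup_finRange _).product (List.nodup_finRange _)).map Sum.inl_injective
  · exact ((List.nodup_finRange _).product (List.nodup_finRange _)).map Sum.inr_injective
  · intro x h1 h2
    obtain ⟨a, -, rfl⟩ := List.mem_map.1 h1
    obtain ⟨b, -, h⟩ := List.mem_map.1 h2
    cases h

theorem mem_indexList (i : I.Index) : i ∈ I.indexList := by
  rcases i with ⟨e, i⟩ | ⟨x, p⟩ <;>
    simp [indexList]

theorem length_indexList :
    I.indexList.length = I.m * I.numBlocks + I.n * (2 * I.numBlocks - 1) := by
  simp [indexList, List.length_product]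

theorem flatMap_range {α : Type*} (a b : ℕ) (f : ℕ → ℕ → α) :
    ((List.range a).flatMap fun x => (List.range b).map (f x)) =
      (List.finRange a ×ˢ List.finRange b).map fun p => f p.1 p.2 := by
  rw [← List.map_coe_finRange_eq_range, ← List.map_coe_finRange_eq_range, List.flatMap_map]
  simp only [SProd.sprod, List.product, List.map_flatMap, List.map_map]
  rfl

variable {I A ed} in
theorem Blocks.edgeList_eq (hI : I.Valid) (hR : I.Represents N ed) (hB : I.Blocks A) :
    I.edgeList A = I.indexList.map fun i => ((((I.ends ed A i).1 : ℕ) : ℤ), (((I.ends ed A i).2 : ℕ) : ℤ),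
      ((Sum.elim (I.blockCap A) (fun _ => ∑ i, I.blockCap A i + 1) i : ℝ≥0) : ℝ)) := by
  have hcap : ∀ p, ((I.blockCap A p : ℝ≥0) : ℝ) = I.transitCap A p.1 p.2 := fun p =>
    Real.coe_toNNReal _ (hB.transitCap_nonneg hI hR p.1 p.2.2)
  have h1 : I.transitList A I.numBlocks I.m = (List.finRange I.m ×ˢ List.finRange I.numBlocks).map
      fun p => I.transitEntry A I.numBlocks p.1 p.2 := by
    rw [transitList, flatMap_range]
  have hsum : ((I.transitList A I.numBlocks I.m).map fun x => x.2.2).sum =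
      ∑ p, (I.blockCap A p : ℝ) := by
    rw [h1, List.map_map, ← List.sum_toFinset _ ((List.nodup_finRange _).product
      (List.nodup_finRange _))]
    refine Finset.sum_congr ?_ fun p _ => (hcap p).symm
    ext ⟨a, b⟩; simp
  rw [edgeList, hsum, h1, chainList, flatMap_range, indexList, List.map_append, List.map_map,
    List.map_map]
  congr 1
  · refine List.map_congr_left fun p _ => ?_
    simp [ends, transitEntry, node_val, hcap, hR.tl_eq, hR.hd_eq]
  · refine List.map_congr_left fun p _ => ?_
    simp [ends, node_val]
    ring

end InstData

/-! ### Cuts of the constructed network and cuts over time -/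

namespace InstData

variable {I : InstData} {N : TemporalNetwork (Fin I.n)} {ed : Fin I.m ≃ N.E} {A : ℤ → ℤ}

/-- The times `T + 1` and the starting times of the pieces. -/
def pieceTimes (I : InstData) : Set ℤ :=
  {t | t = I.T + 1 ∨ ∃ e < I.m, ∃ q < I.len e, t = clip I.T (I.tm e q)}

/-- If the piece valid at t began before t, it is also valid at t - 1 and nothing changes at t.
Pieces may also start without a change of value; only the inclusion matters. -/
theorem mem_pieceTimes_of_ne (hI : I.Valid) (hR : I.Represents N ed) {e : Fin I.n × Fin I.n}
    (he : e ∈ N.E) {t : ℤ} (h0 : 0 < t) (hT : t ≤ I.T) (hne : N.u e t ≠ N.u e (t - 1)) :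
    t ∈ I.pieceTimes := by
  obtain ⟨e, rfl⟩ : ∃ e', (ed e' : Fin I.n × Fin I.n) = e := ⟨ed.symm ⟨e, he⟩, by simp⟩
  have hlen := hI.len_pos e e.2
  set q := Nat.findGreatest (fun q => I.tm e q ≤ t) (I.len e - 1) with hq
  have hle : q ≤ I.len e - 1 := Nat.findGreatest_le _
  have hspec : I.tm e q ≤ t := Nat.findGreatest_spec (P := fun q => I.tm e q ≤ t) (Nat.zero_le _)
    ((hI.tm_zero e e.2).trans h0.le)
  have hgt : q + 1 < I.len e → t < I.tm e (q + 1) := fun h => by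
    by_contra hle'
    exact Nat.findGreatest_is_greatest (P := fun q => I.tm e q ≤ t) (n := I.len e - 1)
      (k := q + 1) (Nat.lt_succ_self q) (by omega) (not_lt.1 hle')
  refine .inr ⟨e, e.2, q, by omega, ?_⟩
  by_contra hc
  have hlt : I.tm e q ≤ t - 1 := by
    simp only [clip] at hc
    omega
  refine hne (NNReal.coe_injective ?_)
  rw [hR.u_eq e q (by omega) t hspec hgt, hR.u_eq e q (by omega) (t - 1) hlt
    fun h => by have := hgt h; omega]

theorem Blocks.mem_of_mem_pieceTimes (hB : I.Blocks A) {t θ l : ℤ} (hθ : θ ∈ I.pieceTimes)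
    (hl : |l| ≤ I.range) (ht : t = θ + l * I.τ) (h0 : 0 ≤ t) (hT : t ≤ I.T + 1) :
    ∃ b ≤ I.numBlocks, A (b : ℕ) = t := by
  rcases hθ with rfl | ⟨e, he, q, hq, rfl⟩
  · obtain ⟨b, hb, h⟩ := hB.horizon_mem l hl
    exact ⟨b, hb, by rw [h, ← ht, clip_of_mem h0 hT]⟩
  · obtain ⟨b, hb, h⟩ := hB.piece_mem e he q hq l hl
    exact ⟨b, hb, by rw [h, ← ht, clip_of_mem h0 hT]⟩

theorem Blocks.headIdx_spec (hI : I.Valid) (hB : I.Blocks A) {i : ℕ} (hi : i < I.numBlocks) :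
    A (I.headIdx A I.numBlocks i : ℕ) ≤ A (i : ℕ) + I.τ := by
  have h0 := hB.nonneg i hi.le
  exact Nat.findGreatest_spec (P := fun j => A (j : ℕ) ≤ A (i : ℕ) + I.τ) (Nat.zero_le _)
    (by rw [hB.first_eq hI]; positivity)

theorem Blocks.coe_blockCap (hI : I.Valid) (hR : I.Represents N ed) (hB : I.Blocks A)
    (p : Fin I.m × Fin I.numBlocks) : ((I.blockCap A p : ℝ≥0) : ℝ) =
      if A ((p.2 : ℕ) : ℤ) + I.τ ≤ I.T then
        ∑ t ∈ Finset.Ico (A ((p.2 : ℕ) : ℤ)) (A ((p.2 : ℕ) + 1 : ℕ)), (N.u (ed p.1) t : ℝ) else 0 := by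
  rw [← hB.transitCap_eq hI hR p.1 p.2.2]
  exact Real.coe_toNNReal _ (hB.transitCap_nonneg hI hR p.1 p.2.2)

open Classical in
/-- A cut of the condensed network that is closed along chains yields a time cut. -/
theorem Blocks.exists_timeCut (hI : I.Valid) (hR : I.Represents N ed) (hB : I.Blocks A)
    (S : Set (Fin (I.n * (2 * I.numBlocks)))) {h₁ h₂} (hs : I.node N.s 0 h₁ ∈ S)
    (ht : I.node N.d (2 * (I.numBlocks - 1)) h₂ ∉ S)
    (hcl : ∀ h, (I.ends ed A (.inr h)).1 ∈ S → (I.ends ed A (.inr h)).2 ∈ S) :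
    ∃ α, N.IsTimeCut I.T α ∧ N.cutCost α ≤ ∑ i, if (I.ends ed A (.inl i)).1 ∈ S ∧
      (I.ends ed A (.inl i)).2 ∉ S then (I.blockCap A i : ℝ) else 0 := by
  have hk := I.numBlocks_pos
  have hmono : ∀ (x : Fin I.n) (p q : ℕ) (hpq : p ≤ q) (hq : q < 2 * I.numBlocks),
      I.node x p (by omega) ∈ S → I.node x q hq ∈ S := by
    intro x p q hpq
    induction q, hpq using Nat.le_induction with
    | base => exact fun _ h => h
    | succ q hpq ih => exact fun hq h => hcl (x, ⟨q, by omega⟩) (ih (by omega) h)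
  have hex : ∀ x : Fin I.n, ∃ i, I.numBlocks ≤ i ∨ ∃ h, I.node x (2 * i) h ∈ S :=
    fun x => ⟨I.numBlocks, .inl le_rfl⟩
  -- The threshold index is the first block whose even node lies in `S`, or the number of blocks,
  -- which stands for time T + 1.
  let κ : Fin I.n → ℕ := fun x => Nat.find (hex x)
  have hκle : ∀ x, κ x ≤ I.numBlocks := fun x => Nat.find_min' (hex x) (.inl le_rfl)
  have hκs : κ N.s = 0 := Nat.le_zero.1 (Nat.find_min' (hex N.s) (.inr ⟨by omega, hs⟩))
  have hκd : κ N.d = I.numBlocks := by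
    refine le_antisymm (hκle _) ?_
    rcases Nat.find_spec (hex N.d) with h | ⟨h, h'⟩
    · exact h
    · exact absurd (hmono _ _ _ (by omega) h₂ h') ht
  have hα : N.IsTimeCut I.T fun x => A (κ x : ℕ) :=
    ⟨fun x => hB.nonneg _ (hκle x), fun x => hB.le_horizon _ (hκle x),
      by simp only [hκs]; exact hB.first_eq hI, by simp only [hκd]; exact hB.last_eq⟩
  refine ⟨_, hα, ?_⟩
  rw [hB.cutCost_eq hI hR hα]
  refine Finset.sum_le_sum fun p _ => ?_
  obtain ⟨e, i⟩ := p
  -- If some time t of the block is counted by the time cut, the transit edge of the block crosses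
  -- `S` and its capacity pays for the whole block: the tail node lies past the threshold of x, and
  -- the head block starts no later than t + τ, hence before the threshold of y.
  by_cases h : ∃ t ∈ Finset.Ico (A ((i : ℕ) : ℤ)) (A ((i : ℕ) + 1 : ℕ)),
      A (κ (ed e : Fin I.n × Fin I.n).1 : ℕ) ≤ t ∧ t < A (κ (ed e : Fin I.n × Fin I.n).2 : ℕ) - I.τ
  · obtain ⟨t, ht, h1, h2⟩ := h
    rw [Finset.mem_Ico] at ht
    have h3 : κ (ed e : Fin I.n × Fin I.n).1 < i + 1 := hB.lt_of_lt (hκle _) (h1.trans_lt ht.2)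
    have h4 : (I.ends ed A (.inl (e, i))).1 ∈ S := by
      rcases Nat.find_spec (hex (ed e : Fin I.n × Fin I.n).1) with h | ⟨h, h'⟩
      · exact absurd (Nat.lt_of_lt_of_le h3 i.2) (not_lt.2 h)
      · exact hmono _ _ (2 * (i : ℕ)) (show 2 * κ _ ≤ 2 * (i : ℕ) by omega) _ h'
    have h5 : I.headIdx A I.numBlocks i < κ (ed e : Fin I.n × Fin I.n).2 := by
      refine hB.lt_of_lt (headIdx_lt A _).le ?_
      have := hB.headIdx_spec hI i.2
      omega
    have h6 : (I.ends ed A (.inl (e, i))).2 ∉ S := fun h =>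
      Nat.find_min (hex (ed e : Fin I.n × Fin I.n).2) h5 (.inr ⟨_, h⟩)
    have h7 := hB.le_horizon _ (hκle (ed e : Fin I.n × Fin I.n).2)
    rw [if_pos ⟨h4, h6⟩, hB.coe_blockCap hI hR, if_pos (by simp only; omega)]
    refine Finset.sum_le_sum fun t _ => ?_
    split_ifs
    exacts [le_rfl, NNReal.coe_nonneg _]
  · rw [Finset.sum_eq_zero fun t ht => if_neg fun h' => h ⟨t, ht, h'⟩]
    split_ifs
    exacts [NNReal.coe_nonneg _, le_rfl]

open Classical in
/-- The cut of the condensed network that belongs to a time cut at critical times. -/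
theorem Blocks.exists_cut (hI : I.Valid) (hR : I.Represents N ed) (hB : I.Blocks A)
    {α : Fin I.n → ℤ} (hα : N.IsTimeCut I.T α)
    (hcrit : ∀ x, ∃ θ ∈ I.pieceTimes, ∃ l : ℤ, |l| + 1 ≤ I.range ∧ α x = θ + l * I.τ) (h₁ h₂) :
    ∃ S : Set (Fin (I.n * (2 * I.numBlocks))), I.node N.s 0 h₁ ∈ S ∧
      I.node N.d (2 * (I.numBlocks - 1)) h₂ ∉ S ∧
      (∀ h, (I.ends ed A (.inr h)).1 ∈ S → (I.ends ed A (.inr h)).2 ∈ S) ∧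
      ∑ i, (if (I.ends ed A (.inl i)).1 ∈ S ∧ (I.ends ed A (.inl i)).2 ∉ S
        then (I.blockCap A i : ℝ) else 0) ≤ N.cutCost α := by
  have hk := I.numBlocks_pos
  -- The sink has to be excluded explicitly: because of repeated boundaries, the last blocks may be
  -- empty and start at T + 1 = α d.
  let S : Set (Fin (I.n * (2 * I.numBlocks))) := {w | (finProdFinEquiv.symm w).1 ≠ N.d ∧
    α (finProdFinEquiv.symm w).1 ≤ A ((((finProdFinEquiv.symm w).2 : ℕ) / 2 : ℕ) : ℤ)}
  have hS : ∀ x p h, I.node x p h ∈ S ↔ x ≠ N.d ∧ α x ≤ A ((p / 2 : ℕ) : ℤ) := by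
    intro x p h
    simp only [S, node, Set.mem_ofPred_eq, Equiv.symm_apply_apply]
  refine ⟨S, ?_, ?_, ?_, ?_⟩
  · rw [hS, hα.source]
    exact ⟨N.s_ne_d, (hB.first_eq hI).ge⟩
  · rw [hS]; simp
  · rintro ⟨x, p⟩ h
    rw [ends, hS] at h ⊢
    exact ⟨h.1, h.2.trans (hB.mono _ _ (by omega) (by omega))⟩
  rw [hB.cutCost_eq hI hR hα]
  refine Finset.sum_le_sum fun p _ => ?_
  obtain ⟨e, i⟩ := p
  have hnn : ∀ t, (0 : ℝ) ≤ if α (ed e : Fin I.n × Fin I.n).1 ≤ t ∧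
      t < α (ed e : Fin I.n × Fin I.n).2 - I.τ then (N.u (ed e) t : ℝ) else 0 := fun t => by
    split_ifs
    exacts [NNReal.coe_nonneg _, le_rfl]
  split_ifs with hcross
  · rw [hB.coe_blockCap hI hR]
    split_ifs with hT
    · refine Finset.sum_le_sum fun t ht => le_of_eq (if_pos ?_).symm
      rw [Finset.mem_Ico] at ht
      simp only [ends, hS, Nat.mul_div_cancel_left _ two_pos] at hcross
      obtain ⟨⟨-, h1⟩, h2⟩ := hcross
      simp only at hT ht h1 h2 ⊢
      set y := (ed e : Fin I.n × Fin I.n).2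
      have hi := i.2
      have h0 := hB.nonneg i hi.le
      obtain ⟨θ, hθ, l, hl, hy⟩ := hcrit y
      -- Since α y is a boundary beyond the head block, it exceeds the arrival time of the first
      -- departure. If the head block is the last one, the boundary can only be T + 1.
      have hlt : A ((i : ℕ) : ℤ) + I.τ < α y := by
        by_cases hyd : y = N.d
        · rw [hyd, hα.sink]; omega
        · have h3 : A (I.headIdx A I.numBlocks i : ℕ) < α y := by
            by_contra hle
            exact h2 ⟨hyd, not_lt.1 hle⟩
          obtain ⟨b, hb, hby⟩ := hB.mem_of_mem_pieceTimes hθ (by omega) hy (hα.nonneg y)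
            (hα.le_horizon y)
          have h4 : I.headIdx A I.numBlocks i < b :=
            hB.lt_of_lt (headIdx_lt A _).le (by rw [hby]; exact h3)
          by_cases hj : I.headIdx A I.numBlocks i + 1 ≤ I.numBlocks - 1
          · have h5 : A ((i : ℕ) : ℤ) + I.τ < A (I.headIdx A I.numBlocks i + 1 : ℕ) := by
              by_contra hle
              exact Nat.findGreatest_is_greatest (P := fun j => A (j : ℕ) ≤ A ((i : ℕ) : ℤ) + I.τ)
                (n := I.numBlocks - 1) (k := I.headIdx A I.numBlocks i + 1)
                (Nat.lt_succ_self (I.headIdx A I.numBlocks i)) hj (not_lt.1 hle)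
            have h6 : A (I.headIdx A I.numBlocks i + 1 : ℕ) ≤ A (b : ℕ) := hB.mono _ _ h4 hb
            omega
          · obtain rfl : b = I.numBlocks := by omega
            rw [← hby, hB.last_eq]; omega
      -- This uses the additional multiple of τ in `range`: α y - τ is also a boundary, so all of
      -- block i departs before it and the transit edge is fully counted in the cost.
      obtain ⟨b, hb, hby⟩ := hB.mem_of_mem_pieceTimes (t := α y - I.τ) (l := l - 1) hθ
        ((abs_sub l 1).trans (by simpa using hl)) (by rw [hy]; ring) (by omega)
        (by have := hα.le_horizon y; omega)
      have hib : (i : ℕ) < b := hB.lt_of_lt hi.le (by omega)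
      have : A ((i : ℕ) + 1 : ℕ) ≤ A (b : ℕ) := hB.mono _ _ hib hb
      omega
    · exact Finset.sum_nonneg fun t _ => hnn t
  · exact Finset.sum_nonneg fun t _ => hnn t

/-- The memory after `buildProg` holds a network whose maximum flow has the value of a maximum flow
over time. -/
theorem Blocks.exists_network (hI : I.Valid) (hR : I.Represents N ed) (hB : I.Blocks A) {v : ℝ}
    (hv : IsGreatest (N.flowValues I.T) v) :
    ∃ (G : FlowNetwork (Fin (I.n * (2 * I.numBlocks)))) (edge : Fin G.E.card ≃ G.E),
      G.source ≠ G.sink ∧ (∀ e ∈ G.E, G.cap e ≠ ⊤) ∧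
      G.E.card = I.m * I.numBlocks + I.n * (2 * I.numBlocks - 1) ∧
      G.initState edge = listState (I.n * (2 * I.numBlocks) : ℕ) (I.s * (2 * I.numBlocks) : ℕ)
        (I.d * (2 * I.numBlocks) + 2 * (I.numBlocks - 1) : ℕ) (I.edgeList A) ∧
      IsGreatest G.flowValues v := by
  classical
  have hk := I.numBlocks_pos
  obtain ⟨G, hs, ht, hE, hcap, hcard, edge, hinit⟩ := FlowNetwork.exists_initState_eq
    (I.ends_injective ed A) (Sum.elim (I.blockCap A) (fun _ => ∑ i, I.blockCap A i + 1))
    (I.node N.s 0 (by omega)) (I.node N.d (2 * (I.numBlocks - 1)) (by omega)) I.indexList_nodup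
    I.mem_indexList
  refine ⟨G, edge, ?_, ?_, by rw [hcard, length_indexList], ?_, ?_⟩
  · rw [hs, ht]
    exact fun h => N.s_ne_d (node_inj h).1
  · intro e he
    obtain ⟨i, rfl⟩ := (hE e).1 he
    rw [hcap]
    exact ENNReal.coe_ne_top
  · rw [hinit, hB.edgeList_eq hI hR, node_val, node_val, hR.s_eq, hR.d_eq, add_zero]
  · refine FlowNetwork.isGreatest_flowValues_of_cut (I.ends_injective ed A) (I.blockCap A) hE hcap
      (fun S h1 h2 h3 => ?_) ?_
    · rw [hs] at h1
      rw [ht] at h2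
      obtain ⟨α, hα, hle⟩ := hB.exists_timeCut hI hR S h1 h2 h3
      obtain ⟨f, hf, hfv⟩ := hv.1
      rw [← hfv]
      refine (hf.value_le_cutCost hα).trans (hle.trans (le_of_eq ?_))
      exact Finset.sum_congr rfl fun i _ => by congr
    · obtain ⟨v', hv', ⟨α₀, hα₀, hαv⟩, -⟩ := N.exists_isGreatest_flowValues I.T
      -- The listed starting times may form a larger set than the true changes, so critical cuts are
      -- taken relative to them. Both bounds on l are used and give |l| ≤ min(n, m + 1).
      obtain ⟨α, hα, hmin, hcrit⟩ := N.exists_critical_cut (T := I.T) (Θ := I.pieceTimes)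
        (.inr ⟨0, hI.m_pos, 0, hI.len_pos 0 hI.m_pos, by
          have := hI.tm_zero 0 hI.m_pos
          simp only [clip]; omega⟩) (.inl rfl)
        (fun e he t h0 h1 hne => mem_pieceTimes_of_ne hI hR he h0 h1 hne)
      have hm : N.E.card = I.m := by
        rw [← Fintype.card_coe, ← Fintype.card_congr ed, Fintype.card_fin]
      obtain ⟨S, h1, h2, h3, h4⟩ := hB.exists_cut hI hR hα (fun x => by
        obtain ⟨θ, hθ, l, hl, hl', hx⟩ := hcrit x
        refine ⟨θ, hθ, l, ?_, by rw [hx, hR.τ_eq]⟩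
        rw [Fintype.card_fin] at hl
        rw [hm] at hl'
        simp only [range]
        omega) (by omega) (by omega)
      refine ⟨S, by rw [hs]; exact h1, by rw [ht]; exact h2, h3, ?_⟩
      rw [hv.unique hv', ← hαv]
      refine le_trans (le_of_eq ?_) (h4.trans (hmin α₀ hα₀))
      exact Finset.sum_congr rfl fun i _ => by congr

end InstData

/-! ### The data of a description -/

theorem List.getD_map_flatten {α β : Type*} (f : α → β) (L : List (List α)) (e q : ℕ) (x : β)
    (he : e < L.length) (hq : q < (L.getD e []).length) :
    (L.flatten.map f).getD (((L.take e).map List.length).sum + q) x =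
      ((L.getD e []).map f).getD q x := by
  induction L generalizing e with
  | nil => simp at he
  | cons l L ih =>
    rw [List.flatten_cons, List.map_append]
    cases e with
    | zero =>
      simp only [List.take_zero, List.map_nil, List.sum_nil, zero_add, List.getD_cons_zero] at hq ⊢
      exact List.getD_append _ _ _ _ (by simpa using hq)
    | succ e =>
      simp only [List.take_succ_cons, List.map_cons, List.sum_cons, List.getD_cons_succ] at hq ⊢
      rw [List.getD_append_right _ _ _ _ (by rw [List.length_map]; omega),
        ← ih e (by simpa using he) hq]
      congr 1
      rw [List.length_map]
      omega

namespace Description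

variable {n : ℕ} {N : TemporalNetwork (Fin n)} (D : Description N)

/-- The data that are stored for the description `D`. -/
def instData (T : ℕ) : InstData where
  n := n
  m := N.E.card
  s := N.s
  d := N.d
  T := T
  τ := N.τ
  tl e := (List.ofFn fun j => ((D.edge j : Fin n × Fin n).1 : ℕ)).getD e 0
  hd e := (List.ofFn fun j => ((D.edge j : Fin n × Fin n).2 : ℕ)).getD e 0
  len e := ((List.ofFn D.pieces).getD e []).length
  off e := (((List.ofFn D.pieces).take e).map List.length).sum
  tm e q := (((List.ofFn D.pieces).getD e []).map Prod.fst).getD q 0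
  vl e q := (((List.ofFn D.pieces).getD e []).map fun p => (p.2 : ℝ)).getD q 0

theorem getD_ofFn_pieces (e : Fin N.E.card) : (List.ofFn D.pieces).getD e [] = D.pieces e := by
  simp [List.getD_eq_getElem?_getD]

theorem instData_numPieces (T : ℕ) : (D.instData T).numPieces = D.numPieces := by
  have h : (List.ofFn D.pieces).take N.E.card = List.ofFn D.pieces :=
    List.take_of_length_le (by simp)
  simp only [InstData.numPieces, instData, h, List.map_ofFn, List.sum_ofFn, numPieces]
  rfl

theorem instData_loaded (T : ℕ) : (D.instData T).Loaded (D.initState T) := by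
  refine ⟨rfl, rfl, rfl, rfl, rfl, rfl, fun e he => ?_, fun e he => ?_, fun e he => ?_,
    fun e he q hq => ?_, fun e he q hq => ?_⟩
  · have he' : e < N.E.card := he
    simp [initState, instData, memOfList_natCast, List.getD_eq_getElem?_getD, he']
  · have he' : e < N.E.card := he
    simp [initState, instData, memOfList_natCast, List.getD_eq_getElem?_getD, he']
  · have he' : e < N.E.card := he
    simp [initState, instData, memOfList_natCast, List.getD_eq_getElem?_getD, he']
  · exact List.getD_map_flatten Prod.fst (List.ofFn D.pieces) e q 0
      (by rw [List.length_ofFn]; exact he) hq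
  · exact List.getD_map_flatten (fun p => (p.2 : ℝ)) (List.ofFn D.pieces) e q 0
      (by rw [List.length_ofFn]; exact he) hq

theorem instData_valid (hE : N.E.Nonempty) (T : ℕ) : (D.instData T).Valid := by
  have hlen : ∀ e : Fin N.E.card, (D.instData T).len e = (D.pieces e).length := fun e => by
    simp only [instData, getD_ofFn_pieces]
  have htm : ∀ (e : Fin N.E.card) q, (D.instData T).tm e q =
      ((D.pieces e).map Prod.fst).getD q 0 := fun e q => by
    simp only [instData, getD_ofFn_pieces]
  refine ⟨hE.card_pos, ?_, rfl, fun e => ?_, fun e he => ?_, fun e he => ?_,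
    fun e he p q hpq hq => ?_⟩
  · have h1 := N.s.2
    have h2 := N.d.2
    have h3 : (N.s : ℕ) ≠ N.d := fun h => N.s_ne_d (Fin.ext h)
    show 2 ≤ n
    omega
  · simp only [instData, List.take_add_one, List.map_append, List.sum_append,
      List.getD_eq_getElem?_getD]
    cases (List.ofFn D.pieces)[e]? <;> simp
  · rw [hlen ⟨e, he⟩]
    exact List.length_pos_iff.2 (D.pieces_ne_nil _)
  · rw [htm ⟨e, he⟩]
    have h := D.head_le ⟨e, he⟩
    cases hp : D.pieces ⟨e, he⟩ with
    | nil => simp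
    | cons a l => simpa [hp] using h
  · rw [hlen ⟨e, he⟩] at hq
    rw [htm ⟨e, he⟩, htm ⟨e, he⟩]
    rcases hpq.eq_or_lt with rfl | hpq
    · rfl
    · rw [List.getD_eq_getElem _ _ (by simp; omega), List.getD_eq_getElem _ _ (by simpa using hq)]
      exact (List.pairwise_iff_getElem.1 (D.increasing ⟨e, he⟩) p q _ _ hpq).le

theorem instData_represents (T : ℕ) : (D.instData T).Represents N D.edge := by
  have h1 : ∀ e : Fin N.E.card, (D.instData T).tl e = (D.edge e : Fin n × Fin n).1 := fun e => by
    simp [instData, List.getD_eq_getElem?_getD]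
  have h2 : ∀ e : Fin N.E.card, (D.instData T).hd e = (D.edge e : Fin n × Fin n).2 := fun e => by
    simp [instData, List.getD_eq_getElem?_getD]
  have h3 : ∀ (e : Fin N.E.card) (q : ℕ), q < (D.instData T).len e → ∀ t : ℤ,
      (D.instData T).tm e q ≤ t → (q + 1 < (D.instData T).len e → t < (D.instData T).tm e (q + 1)) →
      (N.u (D.edge e) t : ℝ) = (D.instData T).vl e q := by
    intro e q hq t h1 h2
    simp only [instData, getD_ofFn_pieces] at hq h1 h2 ⊢
    rw [List.getD_eq_getElem _ _ (by simpa using hq), List.getElem_map] at h1 ⊢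
    rw [D.spec e q _ (List.getElem?_eq_getElem hq) t h1]
    intro p hp
    obtain ⟨hq', rfl⟩ := List.getElem?_eq_some_iff.1 hp
    have h3 := h2 hq'
    rwa [List.getD_eq_getElem _ _ (by simpa using hq'), List.getElem_map] at h3
  exact ⟨rfl, rfl, rfl, h1, h2, h3⟩

theorem view_initState (T : ℕ) : (D.initState T).view 32 =
    ⟨fun _ => 0, fun _ => 0, fun _ _ => 0, fun _ _ => 0⟩ := by
  simp only [RAMState.view, initState, RAMState.mk.injEq, true_and]
  refine ⟨funext fun x => ?_, funext fun x => ?_, funext fun x => ?_⟩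
  · rw [memOfList_natCast, List.getD_eq_default]
    simp
  · simp
  · simp

end Description

/-! ### The running time -/

namespace InstData

variable {I : InstData}

/-- The number of blocks is bounded twice, as O(nμ) and as O(mμ). The first bound is multiplied by m
for transit edges, the second by n for chain edges, and both products are O(nmμ). -/
theorem numBlocks_le (hI : I.Valid) (hμ : I.m ≤ I.numPieces) :
    2 * I.range + 1 ≤ 4 * I.n ∧ I.numBlocks ≤ 8 * (I.n * I.numPieces) ∧
      I.numBlocks + 1 ≤ 14 * (I.m * I.numPieces) := by
  have hm := hI.m_pos
  have hn := hI.n_ge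
  have h1 : 2 * I.range + 1 ≤ 4 * I.n := by simp only [range]; omega
  have h2 : 2 * I.range + 1 ≤ 7 * I.m := by simp only [range]; omega
  have h3 : I.numPieces + 1 ≤ 2 * I.numPieces := by omega
  have h4 := I.numBlocks_add_one
  have h5 := Nat.mul_le_mul h1 h3
  have h6 := Nat.mul_le_mul h2 h3
  exact ⟨h1, by nlinarith, by nlinarith⟩

theorem numNodes_le (hI : I.Valid) (hμ : I.m ≤ I.numPieces) :
    I.n * (2 * I.numBlocks) ≤ 16 * (I.n ^ 2 * I.numPieces) := by
  obtain ⟨-, h, -⟩ := numBlocks_le hI hμ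
  calc I.n * (2 * I.numBlocks) ≤ I.n * (2 * (8 * (I.n * I.numPieces))) := by gcongr
    _ = _ := by ring

theorem numEdges_le (hI : I.Valid) (hμ : I.m ≤ I.numPieces) :
    I.m * I.numBlocks + I.n * (2 * I.numBlocks - 1) ≤ 36 * (I.m * I.n * I.numPieces) := by
  obtain ⟨-, h1, h2⟩ := numBlocks_le hI hμ
  calc I.m * I.numBlocks + I.n * (2 * I.numBlocks - 1)
      ≤ I.m * (8 * (I.n * I.numPieces)) + I.n * (2 * (14 * (I.m * I.numPieces))) := by
        gcongr; omega
    _ = _ := by ring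

theorem buildCost_le (hI : I.Valid) (hμ : I.m ≤ I.numPieces) :
    I.buildCost + 4 ≤ 10000 * (I.m * I.n * I.numPieces) := by
  obtain ⟨h0, h1, h2⟩ := numBlocks_le hI hμ
  have hm := hI.m_pos
  have hn := hI.n_ge
  have hk := I.numBlocks_add_one
  rw [buildCost, ← hk]
  generalize 2 * I.range + 1 = r at *
  generalize I.numBlocks = k at *
  generalize I.numPieces = μ at *
  generalize I.n = n at *
  generalize I.m = m at *
  have hmn : 1 ≤ m * n * μ := Nat.mul_pos (Nat.mul_pos hm (by omega)) (by omega)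
  have e1 : m * (50 * (μ + 1) + 50) ≤ 150 * (m * n * μ) := by
    calc m * (50 * (μ + 1) + 50) ≤ m * (150 * μ) := by gcongr; omega
      _ = 150 * (m * 1 * μ) := by ring
      _ ≤ 150 * (m * n * μ) := by gcongr; omega
  -- The cost quadratic in the range is balanced: one factor is bounded through n, the other through
  -- m.
  have e2 : r * (50 * (k + 1) + 50) ≤ 3000 * (m * n * μ) := by
    have hmμ : 1 ≤ m * μ := Nat.mul_pos hm (by omega)
    calc r * (50 * (k + 1) + 50) ≤ 4 * n * (50 * (14 * (m * μ)) + 50 * (m * μ)) := by gcongr; omega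
      _ = 3000 * (m * n * μ) := by ring
  have e3 : m * (210 * k + 50) ≤ 1730 * (m * n * μ) := by
    have hnμ : 1 ≤ n * μ := Nat.mul_pos (by omega) (by omega)
    calc m * (210 * k + 50) ≤ m * (210 * (8 * (n * μ)) + 50 * (n * μ)) := by gcongr; omega
      _ = 1730 * (m * n * μ) := by ring
  have e4 : 105 * μ ≤ 105 * (m * n * μ) := by
    have : 1 ≤ m * n := Nat.mul_pos hm (by omega)
    calc 105 * μ = 105 * (1 * μ) := by ring
      _ ≤ _ := by gcongr
  have e5 : n * (120 * k + 50) ≤ 1730 * (m * n * μ) := by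
    have hmμ : 1 ≤ m * μ := Nat.mul_pos hm (by omega)
    calc n * (120 * k + 50) ≤ n * (120 * (14 * (m * μ)) + 50 * (m * μ)) := by gcongr <;> omega
      _ = 1730 * (m * n * μ) := by ring
  omega

end InstData

namespace Description

variable {n : ℕ} {N : TemporalNetwork (Fin n)} (D : Description N)

theorem card_le_numPieces : N.E.card ≤ D.numPieces := by
  calc N.E.card = ∑ _j : Fin N.E.card, 1 := by simp
    _ ≤ D.numPieces := Finset.sum_le_sum fun j _ => List.length_pos_iff.2 (D.pieces_ne_nil j)

end Description

/-- The algorithm for flows over time that uses the maximum flow algorithm `P`. -/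
def overTimeProg (P : Prog) : Prog :=
  .seq buildProg <| .seq (P.shift 32) <| .setR 0 (.var 32)

/-- Seen from address 32 on, the memory after the construction is exactly an initial state of the
given algorithm, so its guarantee carries over through the relocation; the value is then copied to
the output variable. -/
theorem overTimeProg_run {P : Prog} {MF : ℕ → ℕ → ℕ} (hP : IsMaxFlowAlgorithm P MF) {n : ℕ}
    {N : TemporalNetwork (Fin n)} (T : ℕ) (D : Description N) (hE : N.E.Nonempty) :
    ∃ n' m', n' ≤ 16 * (n ^ 2 * D.numPieces) ∧ m' ≤ 36 * (N.E.card * n * D.numPieces) ∧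
      (overTimeProg P).Run (D.initState T) (MF n' m' + 10000 * (N.E.card * n * D.numPieces))
        fun σ => IsGreatest (N.flowValues T) (σ.realVar 0) := by
  have hI := D.instData_valid hE T
  have hR := D.instData_represents T
  have hμ : (D.instData T).m ≤ (D.instData T).numPieces := by
    rw [D.instData_numPieces]; exact D.card_le_numPieces
  have h1 := InstData.numNodes_le hI hμ
  have h2 := InstData.numEdges_le hI hμ
  have h3 := InstData.buildCost_le hI hμ
  rw [D.instData_numPieces] at h1 h2 h3
  obtain ⟨v, hv, -⟩ := N.exists_isGreatest_flowValues T
  refine ⟨_, _, h1, h2, Prog.Run.andThen (D.instData T).buildCost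
    (MF ((D.instData T).n * (2 * (D.instData T).numBlocks))
      ((D.instData T).m * (D.instData T).numBlocks +
        (D.instData T).n * (2 * (D.instData T).numBlocks - 1)) + 4) ?_
    (buildProg_run hI (D.instData_loaded T) (D.view_initState T)) ?_⟩
  · have h4 : (D.instData T).buildCost + 4 ≤ 10000 * (N.E.card * n * D.numPieces) := h3
    omega
  rintro σ - ⟨A, hB, hview⟩
  obtain ⟨G, edge, hne, htop, hcard, hinit, hG⟩ := hB.exists_network hI hR hv
  obtain ⟨k, σ', hexec, hval, hk⟩ := hP _ G edge hne htop
  rw [hcard] at hk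
  obtain ⟨ρ, hρ, hρ'⟩ := hexec.shift 32 σ (by rw [hview, hinit])
  refine Prog.Run.andThen (Q₁ := fun τ => τ = ρ) _ 4 le_rfl ⟨k, ρ, hρ, hk, rfl⟩ ?_
  rintro ρ' - rfl
  have hLF : (Prog.setR 0 (.var 32)).LoopFree := by simp [Prog.LoopFree]
  refine hLF.run_of_le (by simp [Prog.maxCost, RExpr.cost]) ?_
  have h5 : ((Prog.setR 0 (.var 32)).apply ρ').realVar 0 = v := by
    rw [← hval.unique hG, ← hρ']
    simp [Prog.apply, RExpr.eval, RAMState.view]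
  rw [h5]
  exact hv

theorem mainTheorem1 :
    ∃ K : ℕ,
      -- the maximum flow over time is the maximum flow of the condensed network, and its size
      (∀ (V : Type*) [Fintype V] (N : TemporalNetwork V) (T : ℕ) (μ : V × V → ℕ),
        (∀ e ∈ N.E, HasAtMostPieces (N.u e) (μ e)) →
        (∃ v : ℝ, IsGreatest (N.flowValues T) v ∧ IsGreatest (N.critCTEN T).flowValues v) ∧
        (N.E.Nonempty →
          Fintype.card (V × N.critTimes T) ≤ K * (Fintype.card V ^ 2 * ∑ e ∈ N.E, μ e) ∧
          (N.critCTEN T).E.card ≤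
            K * (Fintype.card V ^ 2 * ∑ e ∈ N.E, μ e +
              Fintype.card V * N.E.card * ∑ e ∈ N.E, μ e) ∧
          ((∀ x : V, ∃ e ∈ N.E, e.1 = x ∨ e.2 = x) →
            (N.critCTEN T).E.card ≤ K * (Fintype.card V * N.E.card * ∑ e ∈ N.E, μ e)))) ∧
      -- the running time
      (∀ (P : Prog) (MF : ℕ → ℕ → ℕ), IsMaxFlowAlgorithm P MF →
        ∃ Q : Prog, ∀ (n : ℕ) (N : TemporalNetwork (Fin n)) (T : ℕ) (D : Description N),
          N.E.Nonempty →
          ∃ (k : ℕ) (σ : RAMState), Exec Q (D.initState T) k σ ∧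
            IsGreatest (N.flowValues T) (σ.realVar 0) ∧
            (∃ n' m' : ℕ, n' ≤ K * (n ^ 2 * D.numPieces) ∧
              m' ≤ K * (N.E.card * n * D.numPieces) ∧
              k ≤ MF n' m' + K * (N.E.card * n * D.numPieces)) ∧
            ((∀ a b, b ≤ MF a b) → (∀ a a' b b', a ≤ a' → b ≤ b' → MF a b ≤ MF a' b') →
              k ≤ K * MF (K * (n ^ 2 * D.numPieces)) (K * (N.E.card * n * D.numPieces)))) := by
  refine ⟨10000, fun V _ N T μ hμ => ⟨N.exists_isGreatest_critCTEN T, fun hE =>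
    N.card_critCTEN_le T (by norm_num) hμ hE⟩, fun P MF hP => ⟨overTimeProg P,
    fun n N T D hE => ?_⟩⟩
  obtain ⟨n', m', hn', hm', k, σ, hexec, hk, hval⟩ := overTimeProg_run hP T D hE
  have hn'' : n' ≤ 10000 * (n ^ 2 * D.numPieces) := by omega
  have hm'' : m' ≤ 10000 * (N.E.card * n * D.numPieces) := by omega
  refine ⟨k, σ, hexec, hval, ⟨n', m', hn'', hm'', hk⟩, fun h1 h2 => ?_⟩
  have h3 := h2 _ _ _ _ hn'' hm''
  -- The construction cost is itself at most the value of MF at the enlarged arguments, so twice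
  -- that value bounds everything.
  have h4 := h1 (10000 * (n ^ 2 * D.numPieces)) (10000 * (N.E.card * n * D.numPieces))
  omega
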